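/- Let $n\ge 1$, $a>0$, and let $W:\mathbb R^n\to[0,\infty)$ satisfy $W\in L^\infty_{loc}(\mathbb R^n)$, $W(x)\to\infty$ as $|x|\to\infty$ and $\inf W=W(0)=0$. Let $\beta_1>\beta_2>\dots>\beta_k>0$. For a real-valued $V\in C_0^\infty(\mathbb R^n)$ let $L^W-aV=-\Delta+W-aV$ be the self-adjoint operator on $L^2(\mathbb R^n;\mathbb C)$ associated with the closed quadratic form $$\langle (L^W-aV)\phi,\phi\rangle:=\int_{\mathbb R^n}|\nabla\phi|^2+(W-aV)|\phi|^2,\qquad \phi\in Q:=\Big\{\phi\in L^2:\ \nabla\phi\in L^2,\ \int W|\phi|^2<\infty\Big\},$$ and let $\lambda_1(V)\le\lambda_2(V)\le\dots$ be its eigenvalues in increasing order, repeated according to multiplicity. Put $$G_{\beta,a}(V):=\inf\Big\{\sum_{j=1}^k\beta_j\langle (L^W-aV)\phi_j,\phi_j\rangle:\ \phi_1,\dots,\phi_k\in Q\ \text{orthonormal in } L^2\Big\}.$$ An eigenframe for $V$ is an orthonormal family $(\bar\phi_1,\dots,\bar\phi_k)$ with $(L^W-aV)\bar\phi_j=\lambda_j(V)\bar\phi_j$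 for all $j$. The sup-gradient of $G_{\beta,a}$ at $V$ is the set $\partial_VG_{\beta,a}$ of all $\zeta$ in the dual $(C_0^\infty(\mathbb R^n))'$ (real distributions) with $G_{\beta,a}(Z)\le G_{\beta,a}(V)+\langle Z-V,\zeta\rangle$ for all $Z\in C_0^\infty(\mathbb R^n)$. Then: 1. For every $V\in C_0^\infty(\mathbb R^n)$, $\lambda_1(V)<\lambda_2(V)\le\lambda_3(V)\le\dots$, an eigenframe exists, and $G_{\beta,a}(V)=\sum_{j=1}^k\beta_j\lambda_j(V)$. The infimum is a minimum, and it is attained at every eigenframe. 2. The functional $V\mapsto\sum_{j=1}^k\beta_j\lambda_j(V)$ is concave on $C_0^\infty(\mathbb R^n)$. 3. For every $V\in C_0^\infty(\mathbb R^n)$, $\partial_VG_{\beta,a}$ is the convex hull of the set of the functions $-a\sum_{j=1}^k\beta_j|\bar\phi_j|^2$, where $(\bar\phi_1,\dots,\bar\phi_k)$ ranges over the eigenframes for $V$. Every element of $\partial_VG_{\beta,a}$ is an $L^1$ function of $L^1$ norm $a\sum_{j=1}^k\beta_j$, which is $a$ if $\sum_{j=1}^k\beta_j=1$. If all eigenvalues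 of $L^W-aV$ are simple, then $\partial_VG_{\beta,a}$ consists of one element, i.e. $G_{\beta,a}$ is differentiable at $V$. -/

import Mathlib

open MeasureTheory Filter Topology TopologicalSpace Set
open scoped Distributions SchwartzMap LineDeriv ENNReal

namespace Choquard

noncomputable section

/-- Euclidean space `ℝⁿ`. -/
abbrev Rn (n : ℕ) := EuclideanSpace ℝ (Fin n)

/-- The complex Hilbert space `L²(ℝⁿ)`. -/
abbrev L2 (n : ℕ) := Lp ℂ 2 (volume : Measure (Rn n))

/-- `C₀^∞(ℝⁿ)`: real-valued smooth functions with compact support. -/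
abbrev TestFn (n : ℕ) := 𝓓((⊤ : Opens (Rn n)), ℝ)

/-- The dual `(C₀^∞(ℝⁿ))'`: real distributions on `ℝⁿ`. -/
abbrev Distr (n : ℕ) := 𝓓'((⊤ : Opens (Rn n)), ℝ)

/-- The assumptions on the background potential: `W ∈ L^∞_loc(ℝⁿ)`, `W(x) → ∞` as `|x| → ∞`, and
`inf W = W(0) = 0`. -/
structure IsConfining {n : ℕ} (W : Rn n → ℝ) : Prop where
  locallyBounded : ∀ K : Set (Rn n), IsCompact K → MemLp W ∞ (volume.restrict K)
  tendsto_atTop : Tendsto W (cocompact (Rn n)) atTop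
  nonneg : ∀ x, 0 ≤ W x
  zero : W 0 = 0

/-- `g ∈ L²` is the weak partial derivative `∂ᵢφ` of `φ ∈ L²`, that is, its distributional
derivative in the `i`-th coordinate direction. -/
def IsWeakPartial {n : ℕ} (i : Fin n) (φ g : L2 n) : Prop :=
  ∂_{EuclideanSpace.single i (1 : ℝ)} (φ : 𝓢'(Rn n, ℂ)) = (g : 𝓢'(Rn n, ℂ))

/-- Weak partial derivatives are unique. -/
theorem IsWeakPartial.unique {n : ℕ} {i : Fin n} {φ g g' : L2 n}
    (h : IsWeakPartial i φ g) (h' : IsWeakPartial i φ g') : g = g' := by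
  have h0 : (Lp.toTemperedDistributionCLM ℂ (volume : Measure (Rn n)) 2) g =
      (Lp.toTemperedDistributionCLM ℂ (volume : Measure (Rn n)) 2) g' :=
    h.symm.trans h'
  have hker := Lp.ker_toTemperedDistributionCLM_eq_bot (F := ℂ)
    (μ := (volume : Measure (Rn n))) (p := 2)
  exact (LinearMap.ker_eq_bot.mp hker) h0

open Classical in
/-- The weak partial derivative `∂ᵢφ ∈ L²` (by convention `0` if there is none in `L²`). -/
def weakPartial {n : ℕ} (i : Fin n) (φ : L2 n) : L2 n :=
  if h : ∃ g, IsWeakPartial i φ g then h.choose else 0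

/-- The form domain: all `φ ∈ L²` with `∇φ ∈ L²` and `∫ W|φ|² < ∞` (no normalization). -/
def formDomain {n : ℕ} (W : Rn n → ℝ) : Set (L2 n) :=
  {φ | (∀ i, ∃ g, IsWeakPartial i φ g) ∧ Integrable (fun x ↦ W x * ‖φ x‖ ^ 2)}

/-- The sesquilinear form of `-Δ + W - aV`:
`(φ, ψ) ↦ ∫ ∇φ · conj ∇ψ + (W - aV) φ conj ψ`. Mathlib's inner product is conjugate-linear in
its first argument. -/
def form {n : ℕ} (W : Rn n → ℝ) (a : ℝ) (V : TestFn n) (φ ψ : L2 n) : ℂ :=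
  (∑ i, inner ℂ (weakPartial i ψ) (weakPartial i φ)) +
    ∫ x, ((W x - a * V x : ℝ) : ℂ) * φ x * (starRingEnd ℂ) (ψ x)

/-- The quadratic form `⟨(L^W - aV)φ, φ⟩ = ∫ |∇φ|² + (W - aV)|φ|²`. -/
def energy {n : ℕ} (W : Rn n → ℝ) (a : ℝ) (V : TestFn n) (φ : L2 n) : ℝ :=
  (∑ i, ‖weakPartial i φ‖ ^ 2) + ∫ x, (W x - a * V x) * ‖φ x‖ ^ 2

/-- `φ` lies in the domain of the self-adjoint operator `L^W - aV = -Δ + W - aV` and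
`(L^W - aV)φ = f`. The operator is the one associated with its closed quadratic form. -/
def OperatorMaps {n : ℕ} (W : Rn n → ℝ) (a : ℝ) (V : TestFn n) (φ f : L2 n) : Prop :=
  φ ∈ formDomain W ∧ ∀ ψ ∈ formDomain W, form W a V φ ψ = inner ℂ ψ f

/-- The eigenspace of `L^W - aV` at `μ`: the (span of the) solutions of `(L^W - aV)φ = μφ`. It is
`⊥` if `μ` is not an eigenvalue. -/
def eigenspace {n : ℕ} (W : Rn n → ℝ) (a : ℝ) (V : TestFn n) (μ : ℝ) : Submodule ℂ (L2 n) :=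
  Submodule.span ℂ {φ | OperatorMaps W a V φ ((μ : ℂ) • φ)}

/-- The eigenvalues of `L^W - aV` in increasing order, repeated according to multiplicity,
starting from the index `0`: the `j`-th one is the least `μ` such that at least `j + 1`
eigenvalues, counted with multiplicity, are `≤ μ`. -/
def eigenvalue {n : ℕ} (W : Rn n → ℝ) (a : ℝ) (V : TestFn n) (j : ℕ) : ℝ :=
  sInf {μ : ℝ | ((j + 1 : ℕ) : Cardinal) ≤
    Module.rank ℂ ↥(⨆ (ν : ℝ) (_ : ν ≤ μ), eigenspace W a V ν)}

/-- The orthonormal `k`-frames of functions of finite energy. -/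
def frames {n : ℕ} (W : Rn n → ℝ) (k : ℕ) : Set (Fin k → L2 n) :=
  {φ | (∀ j, φ j ∈ formDomain W) ∧ Orthonormal ℂ φ}

/-- `∑ⱼ βⱼ ⟨(L^W - aV)φⱼ, φⱼ⟩`. -/
def frameEnergy {n k : ℕ} (W : Rn n → ℝ) (a : ℝ) (β : Fin k → ℝ) (V : TestFn n)
    (φ : Fin k → L2 n) : ℝ :=
  ∑ j, β j * energy W a V (φ j)

/-- `G_{β,a}(V)`, the infimum of `∑ⱼ βⱼ ⟨(L^W - aV)φⱼ, φⱼ⟩` over orthonormal frames. -/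
def G {n k : ℕ} (W : Rn n → ℝ) (a : ℝ) (β : Fin k → ℝ) (V : TestFn n) : ℝ :=
  sInf (frameEnergy W a β V '' frames W k)

/-- `φ` is an orthonormal frame of eigenfunctions of `L^W - aV` for the `k` lowest eigenvalues, in
increasing order. -/
def IsEigenframe {n k : ℕ} (W : Rn n → ℝ) (a : ℝ) (V : TestFn n) (φ : Fin k → L2 n) : Prop :=
  Orthonormal ℂ φ ∧ ∀ j, OperatorMaps W a V (φ j) ((eigenvalue W a V j : ℂ) • φ j)

/-- The density `∑ⱼ βⱼ|φⱼ|²`. -/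
def density {n k : ℕ} (β : Fin k → ℝ) (φ : Fin k → L2 n) (x : Rn n) : ℝ :=
  ∑ j, β j * ‖φ j x‖ ^ 2

/-- The sup-gradient of `F` at `V`. -/
def supGradient {n : ℕ} (F : TestFn n → ℝ) (V : TestFn n) : Set (Distr n) :=
  {ζ | ∀ Z, F Z ≤ F V + ζ (Z - V)}

/-- The distribution `Z ↦ ∫ Z f` given by a locally integrable function `f`. -/
def distr {n : ℕ} (f : Rn n → ℝ) : Distr n :=
  ContinuousLinearMap.toUniformConvergenceCLM (RingHom.id ℝ) ℝ _
    (TestFunction.integralAgainstBilinCLM (ContinuousLinearMap.mul ℝ ℝ) volume f)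

/-- `distr f` is integration against `f`. -/
theorem distr_apply {n : ℕ} {f : Rn n → ℝ} (hf : Integrable f) (Z : TestFn n) :
    distr f Z = ∫ x, Z x * f x := by
  have h : LocallyIntegrableOn f ((⊤ : Opens (Rn n)) : Set (Rn n)) volume :=
    hf.locallyIntegrable.locallyIntegrableOn _
  exact TestFunction.integralAgainstBilinCLM_eq_integral h

end

end Choquard

namespace Choquard

noncomputable section

open FourierTransform
open scoped Real

/-! ### Weak derivatives, translations and kinetic energy on the Fourier side -/

section FourierSide

variable {n : ℕ}

/-! The quadratic form of `-Δ + W - aV` is hermitian, bounded below and closed, and its sublevel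
sets are precompact in L²: the growth of W makes the mass far out small, and the gradient controls
translations, hence approximation by step functions on a ball (`IsConfining.totallyBounded`). These
properties, isolated in `CompactForm` together with the infinite dimension of the domain, give the
spectral theory: minimizing the Rayleigh quotient successively on orthogonal complements yields
orthonormal eigenvectors, complete in the form domain, with eigenvalues tending to infinity. These
minima are the eigenvalues counted with multiplicity (`sInf_rank_eq_val`).

The value of G is Ky Fan's principle. Bessel's inequality bounds the unweighted energy of an m-frame
from below by the sum of the m lowest eigenvalues. As the weights are positive and decreasing, Abel
summation carries this over to the weighted sum (`sum_mul_val_le`), with equality at eigenframes.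

The lowest eigenvalue is simple because real ground states have a sign. Taking real and imaginary
parts, or min and max, of a pair of functions is a pointwise contraction of ℂ² that preserves the
norm, so it does not raise the total energy and maps pairs of ground states to ground states. If u ≥
0 is a ground state and η a cutoff, the functions min(η, mu) have bounded energy and converge to η
restricted to {u > 0}. So the indicator of this set locally has finite Dirichlet energy, which
forces the set to be null or conull; no regularity of eigenfunctions is needed. A function of strict
sign is orthogonal to no ground state except zero, which excludes a second dimension.

For a fixed frame the energy is affine in V with slope -a∑βⱼ|φⱼ|². Hence G is concave, and each
eigenframe at V provides a supergradient. Conversely, let ζ be a supergradient. For each direction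
Z, eigenframes for V + tZ, used as competitors at V, accumulate as t ↓ 0 at an eigenframe for V
whose slope pairs with Z to at most ζ(Z) (`exists_densityDistr_le`). The slopes of eigenframes span
a finite-dimensional space and form a compact set, so separation in finite dimensions puts ζ into
their convex hull, with no closure to be taken (`mem_convexHull_of_forall_exists_le`). -/

theorem ae_eq_of_schwartz_integral_eq {f g : Rn n → ℂ} (hf : LocallyIntegrable f)
    (hg : LocallyIntegrable g) (h : ∀ u : 𝓢(Rn n, ℂ), ∫ x, u x * f x = ∫ x, u x * g x) :
    f =ᵐ[volume] g := by
  refine ae_eq_of_integral_contDiff_smul_eq hf hg fun u hu hc ↦ ?_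
  have hc' : HasCompactSupport (Complex.ofRealCLM ∘ u) := hc.comp_left rfl
  have hu' : ContDiff ℝ ((⊤ : ℕ∞) : WithTop ℕ∞) (Complex.ofRealCLM ∘ u) :=
    Complex.ofRealCLM.contDiff.comp hu
  simpa using h (hc'.toSchwartzMap hu')

theorem L2.locallyIntegrable (φ : L2 n) : LocallyIntegrable (φ : Rn n → ℂ) :=
  (Lp.memLp φ).locallyIntegrable (by norm_num)

theorem enorm_sq_eq_lintegral (φ : L2 n) : ‖φ‖ₑ ^ 2 = ∫⁻ x, ‖φ x‖ₑ ^ 2 := by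
  have h := eLpNorm_eq_lintegral_rpow_enorm_toReal (f := (φ : Rn n → ℂ)) (μ := volume)
    (p := 2) (by norm_num) (by norm_num)
  rw [Lp.enorm_def, h, ← ENNReal.rpow_natCast, ← ENNReal.rpow_mul]
  simp

theorem norm_sq_eq_integral (φ : L2 n) : ‖φ‖ ^ 2 = ∫ x, ‖φ x‖ ^ 2 := by
  have h := enorm_sq_eq_lintegral φ
  rw [integral_eq_lintegral_of_nonneg_ae (ae_of_all _ fun x ↦ by positivity)
    (by exact (Lp.aestronglyMeasurable φ).norm.pow 2)]
  have : ‖φ‖ ^ 2 = (‖φ‖ₑ ^ 2).toReal := by simp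
  rw [this, h]
  congr 1
  refine lintegral_congr fun x ↦ ?_
  rw [ENNReal.ofReal_pow (norm_nonneg _), ofReal_norm]

theorem integrable_norm_sq (φ : L2 n) : Integrable (fun x ↦ ‖φ x‖ ^ 2) :=
  (Lp.memLp φ).integrable_norm_pow (by norm_num)

/-- The symbol `2πi⟨ξ, v⟩` of the derivative in direction `v`. -/
def derivSymbol (v ξ : Rn n) : ℂ := (2 * π * Complex.I) * (inner ℝ ξ v : ℝ)

theorem continuous_derivSymbol (v : Rn n) : Continuous (derivSymbol v) := by
  unfold derivSymbol; fun_prop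

/-- The Fourier transform is injective on tempered distributions and turns the derivative into
multiplication by the symbol. This replaces a distributional identity by an a.e. identity of
functions. -/
theorem fourier_distribution_eq_iff (v : Rn n) (φ g : L2 n) :
    ∂_{v} (φ : 𝓢'(Rn n, ℂ)) = (g : 𝓢'(Rn n, ℂ)) ↔
      ((𝓕 g : L2 n) : Rn n → ℂ) =ᵐ[volume]
        fun ξ ↦ derivSymbol v ξ * ((𝓕 φ : L2 n) : Rn n → ℂ) ξ := by
  have hT : (fun ξ : Rn n ↦ ((inner ℝ ξ v : ℝ) : ℂ)).HasTemperateGrowth := by fun_prop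
  have key : ∂_{v} (φ : 𝓢'(Rn n, ℂ)) = (g : 𝓢'(Rn n, ℂ)) ↔
      ∀ u : 𝓢(Rn n, ℂ), ∫ x, u x * (derivSymbol v x * ((𝓕 φ : L2 n) : Rn n → ℂ) x) =
        ∫ x, u x * ((𝓕 g : L2 n) : Rn n → ℂ) x := by
    have hinj : ∂_{v} (φ : 𝓢'(Rn n, ℂ)) = (g : 𝓢'(Rn n, ℂ)) ↔
        𝓕 (∂_{v} (φ : 𝓢'(Rn n, ℂ))) = 𝓕 (g : 𝓢'(Rn n, ℂ)) := by
      refine ⟨fun h ↦ by rw [h], fun h ↦ ?_⟩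
      have := congrArg (fun T : 𝓢'(Rn n, ℂ) ↦ 𝓕⁻ T) h
      simpa using this
    rw [hinj, TemperedDistribution.fourier_lineDerivOp_eq, Lp.fourier_toTemperedDistribution_eq,
      Lp.fourier_toTemperedDistribution_eq]
    constructor
    · intro h u
      have := congrArg (fun T : 𝓢'(Rn n, ℂ) ↦ T u) h
      simp only [smul_apply, TemperedDistribution.smulLeftCLM_apply_apply,
        Lp.toTemperedDistribution_apply, smul_eq_mul] at this
      rw [← this, ← integral_const_mul]
      refine integral_congr_ae (ae_of_all _ fun x ↦ ?_)
      simp only [SchwartzMap.smulLeftCLM_apply_apply hT, derivSymbol, smul_eq_mul]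
      ring
    · intro h
      ext u
      simp only [smul_apply, TemperedDistribution.smulLeftCLM_apply_apply,
        Lp.toTemperedDistribution_apply, smul_eq_mul]
      rw [← h u, ← integral_const_mul]
      refine integral_congr_ae (ae_of_all _ fun x ↦ ?_)
      simp only [SchwartzMap.smulLeftCLM_apply_apply hT, derivSymbol, smul_eq_mul]
      ring
  rw [key]
  constructor
  · intro h
    refine (ae_eq_of_schwartz_integral_eq ?_ (L2.locallyIntegrable _) h).symm
    exact (L2.locallyIntegrable _).continuous_mul (continuous_derivSymbol v)
  · intro h u
    refine integral_congr_ae ?_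
    filter_upwards [h] with x hx
    rw [hx]

/-- The translation `φ ↦ φ(· + h)` on `L²`. -/
def translate (h : Rn n) : L2 n →ₗᵢ[ℂ] L2 n :=
  Lp.compMeasurePreservingₗᵢ ℂ (· + h) (measurePreserving_add_right volume h)

theorem coeFn_translate (h : Rn n) (φ : L2 n) :
    translate h φ =ᵐ[volume] fun x ↦ φ (x + h) :=
  Lp.coeFn_compMeasurePreserving φ (measurePreserving_add_right volume h)

/-- The character `e^{2πi⟨ξ, h⟩}`. -/
def character (h ξ : Rn n) : ℂ := Complex.exp (derivSymbol h ξ)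

theorem continuous_character (h : Rn n) : Continuous (character h) :=
  Complex.continuous_exp.comp (continuous_derivSymbol h)

theorem derivSymbol_eq (v ξ : Rn n) : derivSymbol v ξ = ((2 * π * inner ℝ ξ v : ℝ) : ℂ) * Complex.I := by
  simp [derivSymbol]; ring

/-- Defining w as the inverse transform of the shifted transform of u makes it a Schwartz function
at once; the product formula is then a change of variables. -/
theorem exists_schwartz_fourier_shift (h : Rn n) (u : 𝓢(Rn n, ℂ)) :
    ∃ w : 𝓢(Rn n, ℂ), (∀ ξ, w ξ = character h ξ * u ξ) ∧ ∀ x, 𝓕 w x = 𝓕 u (x - h) := by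
  refine ⟨𝓕⁻ ((𝓕 u).compSubConstCLM ℂ h), fun ξ ↦ ?_, fun x ↦ ?_⟩
  · have hu : u ξ = (𝓕⁻ (𝓕 u) : 𝓢(Rn n, ℂ)) ξ := by simp
    rw [hu, SchwartzMap.fourierInv_coe, SchwartzMap.fourierInv_coe,
      Real.fourierInv_eq', Real.fourierInv_eq', ← integral_const_mul,
      ← integral_add_right_eq_self _ h]
    refine integral_congr_ae (ae_of_all _ fun x ↦ ?_)
    simp only [SchwartzMap.compSubConstCLM_apply, add_sub_cancel_right, smul_eq_mul]
    rw [← mul_assoc, character, ← Complex.exp_add, derivSymbol_eq, inner_add_left,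
      real_inner_comm h ξ]
    congr 2
    push_cast
    ring
  · simp

/-- By duality: tested against a Schwartz function, the translation moves onto the transform of the
test function, where it becomes a modulation. -/
theorem fourier_translate (h : Rn n) (φ : L2 n) :
    ((𝓕 (translate h φ) : L2 n) : Rn n → ℂ) =ᵐ[volume]
      fun ξ ↦ character h ξ * ((𝓕 φ : L2 n) : Rn n → ℂ) ξ := by
  refine ae_eq_of_schwartz_integral_eq (L2.locallyIntegrable _)
    ((L2.locallyIntegrable _).continuous_mul (continuous_character h)) fun u ↦ ?_
  obtain ⟨w, hw, hw'⟩ := exists_schwartz_fourier_shift h u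
  have pair : ∀ (f : L2 n) (v : 𝓢(Rn n, ℂ)),
      ∫ x, v x * ((𝓕 f : L2 n) : Rn n → ℂ) x = ∫ x, 𝓕 v x * f x := by
    intro f v
    have := congrArg (fun T : 𝓢'(Rn n, ℂ) ↦ T v) (Lp.fourier_toTemperedDistribution_eq f)
    simp only [TemperedDistribution.fourier_apply, Lp.toTemperedDistribution_apply,
      smul_eq_mul] at this
    exact this.symm
  calc _ = ∫ x, 𝓕 u x * translate h φ x := pair _ _
    _ = ∫ x, 𝓕 u x * φ (x + h) := by
        refine integral_congr_ae ?_
        filter_upwards [coeFn_translate h φ] with x hx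
        rw [hx]
    _ = ∫ x, 𝓕 w x * φ x := by
        rw [← integral_add_right_eq_self (fun x ↦ 𝓕 w x * φ x) h]
        simp [hw']
    _ = ∫ x, w x * ((𝓕 φ : L2 n) : Rn n → ℂ) x := (pair _ _).symm
    _ = _ := by
        refine integral_congr_ae (ae_of_all _ fun x ↦ ?_)
        simp only [hw]
        ring

/-- `∫ |2π⟨ξ, v⟩|²|φ̂|²`, which is `‖∂_v φ‖²` if `∂_v φ ∈ L²` and infinite otherwise. -/
def kineticDir (v : Rn n) (φ : L2 n) : ℝ≥0∞ :=
  ∫⁻ ξ, ‖derivSymbol v ξ‖ₑ ^ 2 * ‖((𝓕 φ : L2 n) : Rn n → ℂ) ξ‖ₑ ^ 2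

theorem aemeasurable_fourier_enorm_sq (φ : L2 n) :
    AEMeasurable (fun ξ ↦ ‖((𝓕 φ : L2 n) : Rn n → ℂ) ξ‖ₑ ^ 2) :=
  (Lp.aestronglyMeasurable _).enorm.pow_const 2

theorem aemeasurable_mul_fourier_enorm_sq {w : Rn n → ℂ} (hw : Continuous w) (φ : L2 n) :
    AEMeasurable (fun ξ ↦ ‖w ξ‖ₑ ^ 2 * ‖((𝓕 φ : L2 n) : Rn n → ℂ) ξ‖ₑ ^ 2) :=
  (hw.enorm.measurable.pow_const 2).aemeasurable.mul (aemeasurable_fourier_enorm_sq φ)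

/-- The only candidate for the derivative is the inverse transform of symbol times transform, and
`kineticDir` decides whether that product is in L². -/
theorem exists_weakDeriv_iff (v : Rn n) (φ : L2 n) :
    (∃ g : L2 n, ∂_{v} (φ : 𝓢'(Rn n, ℂ)) = (g : 𝓢'(Rn n, ℂ))) ↔ kineticDir v φ ≠ ∞ := by
  have hm : AEStronglyMeasurable
      (fun ξ ↦ derivSymbol v ξ * ((𝓕 φ : L2 n) : Rn n → ℂ) ξ) volume :=
    (continuous_derivSymbol v).aestronglyMeasurable.mul (Lp.aestronglyMeasurable _)
  have heq : MemLp (fun ξ ↦ derivSymbol v ξ * ((𝓕 φ : L2 n) : Rn n → ℂ) ξ) 2 volume ↔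
      kineticDir v φ ≠ ∞ := by
    rw [MemLp, and_iff_right hm, ← lt_top_iff_ne_top,
      eLpNorm_lt_top_iff_lintegral_rpow_enorm_lt_top (by norm_num) (by norm_num), kineticDir]
    simp [mul_pow]
  constructor
  · rintro ⟨g, hg⟩
    rw [fourier_distribution_eq_iff] at hg
    exact heq.mp ((memLp_congr_ae hg).mp (Lp.memLp _))
  · intro h
    have hL := heq.mpr h
    refine ⟨𝓕⁻ (hL.toLp _), ?_⟩
    rw [fourier_distribution_eq_iff]
    simpa using hL.coeFn_toLp

theorem enorm_sq_weakDeriv {v : Rn n} {φ g : L2 n}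
    (h : ∂_{v} (φ : 𝓢'(Rn n, ℂ)) = (g : 𝓢'(Rn n, ℂ))) : ‖g‖ₑ ^ 2 = kineticDir v φ := by
  rw [fourier_distribution_eq_iff] at h
  have hF : ‖g‖ₑ = ‖(𝓕 g : L2 n)‖ₑ := by
    rw [← ofReal_norm, ← ofReal_norm, Lp.norm_fourier_eq]
  rw [hF, enorm_sq_eq_lintegral, kineticDir]
  refine lintegral_congr_ae ?_
  filter_upwards [h] with ξ hξ
  rw [hξ, enorm_mul, mul_pow]

theorem enorm_translate_sub_sq (h : Rn n) (φ : L2 n) :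
    ‖translate h φ - φ‖ₑ ^ 2 =
      ∫⁻ ξ, ‖character h ξ - 1‖ₑ ^ 2 * ‖((𝓕 φ : L2 n) : Rn n → ℂ) ξ‖ₑ ^ 2 := by
  have hF : ‖translate h φ - φ‖ₑ = ‖(𝓕 (translate h φ) - 𝓕 φ : L2 n)‖ₑ := by
    rw [← ofReal_norm, ← ofReal_norm, ← Lp.norm_fourier_eq]
    congr 2
    exact (Lp.fourierTransformₗᵢ (Rn n) ℂ).map_sub _ _
  rw [hF, enorm_sq_eq_lintegral]
  refine lintegral_congr_ae ?_
  filter_upwards [Lp.coeFn_sub (𝓕 (translate h φ) : L2 n) (𝓕 φ : L2 n),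
    fourier_translate h φ] with ξ h1 h2
  rw [h1, Pi.sub_apply, h2, ← mul_pow, ← enorm_mul]
  congr 2
  ring

theorem enorm_character_sub_one_le (h ξ : Rn n) :
    ‖character h ξ - 1‖ₑ ≤ ‖derivSymbol h ξ‖ₑ := by
  rw [← ofReal_norm, ← ofReal_norm]
  refine ENNReal.ofReal_le_ofReal ?_
  rw [character, derivSymbol_eq, mul_comm _ Complex.I]
  refine (Real.norm_exp_I_mul_ofReal_sub_one_le).trans ?_
  simp

theorem enorm_translate_sub_sq_le (h : Rn n) (φ : L2 n) :
    ‖translate h φ - φ‖ₑ ^ 2 ≤ kineticDir h φ := by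
  rw [enorm_translate_sub_sq]
  exact lintegral_mono fun ξ ↦ by gcongr; exact enorm_character_sub_one_le h ξ

theorem derivSymbol_smul (t : ℝ) (v ξ : Rn n) : derivSymbol (t • v) ξ = t * derivSymbol v ξ := by
  simp [derivSymbol, inner_smul_right]; ring

theorem kineticDir_smul (t : ℝ) (v : Rn n) (φ : L2 n) :
    kineticDir (t • v) φ = ‖t‖ₑ ^ 2 * kineticDir v φ := by
  rw [kineticDir, kineticDir, ← lintegral_const_mul' _ _ (by simp)]
  refine lintegral_congr fun ξ ↦ ?_
  rw [derivSymbol_smul, enorm_mul, mul_pow, mul_assoc]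
  congr 2
  rw [← ofReal_norm, ← ofReal_norm]; simp

theorem tendsto_character_quotient (v ξ : Rn n) :
    Tendsto (fun m : ℕ ↦ ‖((m : ℝ) + 1)‖ₑ ^ 2 * ‖character (((m : ℝ) + 1)⁻¹ • v) ξ - 1‖ₑ ^ 2)
      atTop (𝓝 (‖derivSymbol v ξ‖ₑ ^ 2)) := by
  have h0 : HasDerivAt (fun t : ℝ ↦ Complex.exp (t * derivSymbol v ξ)) (derivSymbol v ξ) 0 := by
    have h1 : HasDerivAt (fun t : ℝ ↦ (t : ℂ) * derivSymbol v ξ) (1 * derivSymbol v ξ) 0 :=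
      (Complex.ofRealCLM.hasDerivAt (x := (0 : ℝ))).mul_const _
    simpa using h1.cexp
  have h1 := h0.tendsto_slope
  have hs : Tendsto (fun m : ℕ ↦ ((m : ℝ) + 1)⁻¹) atTop (𝓝[≠] 0) := by
    refine tendsto_nhdsWithin_iff.mpr ⟨?_, Eventually.of_forall fun m ↦ ?_⟩
    · simpa using tendsto_one_div_add_atTop_nhds_zero_nat (𝕜 := ℝ)
    · simp only [mem_compl_iff, mem_singleton_iff, inv_eq_zero]; positivity
  have h2 := ((ENNReal.continuous_pow 2).tendsto _).comp ((h1.comp hs).enorm)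
  refine h2.congr fun m ↦ ?_
  simp only [Function.comp_apply, slope_def_module, sub_zero, Complex.ofReal_zero, zero_mul,
    Complex.exp_zero, inv_inv]
  rw [← mul_pow, enorm_smul, character, derivSymbol_smul]

/-- A bound on all difference quotients is a bound on the kinetic energy. -/
theorem kineticDir_add_le_of_translate {f₁ f₂ φ₁ φ₂ : L2 n}
    (h : ∀ v, ‖translate v f₁ - f₁‖ₑ ^ 2 + ‖translate v f₂ - f₂‖ₑ ^ 2 ≤
      ‖translate v φ₁ - φ₁‖ₑ ^ 2 + ‖translate v φ₂ - φ₂‖ₑ ^ 2) (v : Rn n) :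
    kineticDir v f₁ + kineticDir v f₂ ≤ kineticDir v φ₁ + kineticDir v φ₂ := by
  set F : Rn n → ℝ≥0∞ := fun ξ ↦
    ‖((𝓕 f₁ : L2 n) : Rn n → ℂ) ξ‖ₑ ^ 2 + ‖((𝓕 f₂ : L2 n) : Rn n → ℂ) ξ‖ₑ ^ 2 with hF
  have hFm : AEMeasurable F volume :=
    (aemeasurable_fourier_enorm_sq f₁).add (aemeasurable_fourier_enorm_sq f₂)
  have hsplit : ∀ w : Rn n → ℂ, Continuous w → ∫⁻ ξ, ‖w ξ‖ₑ ^ 2 * F ξ =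
      (∫⁻ ξ, ‖w ξ‖ₑ ^ 2 * ‖((𝓕 f₁ : L2 n) : Rn n → ℂ) ξ‖ₑ ^ 2) +
      ∫⁻ ξ, ‖w ξ‖ₑ ^ 2 * ‖((𝓕 f₂ : L2 n) : Rn n → ℂ) ξ‖ₑ ^ 2 := by
    intro w hw
    rw [← lintegral_add_left' (aemeasurable_mul_fourier_enorm_sq hw f₁)]
    simp [hF, mul_add]
  rw [kineticDir, kineticDir, ← hsplit _ (continuous_derivSymbol v)]
  -- By Plancherel, the integral of `G m` is the squared difference quotient along v/(m+1), summed
  -- over f₁ and f₂. The integrands converge to the symbol squared, so Fatou's lemma bounds the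
  -- kinetic energy; no regularity of f₁, f₂ is presupposed.
  set G : ℕ → Rn n → ℝ≥0∞ := fun m ξ ↦
    (‖((m : ℝ) + 1)‖ₑ ^ 2 * ‖character (((m : ℝ) + 1)⁻¹ • v) ξ - 1‖ₑ ^ 2) * F ξ with hG
  have hGm : ∀ m, AEMeasurable (G m) volume := fun m ↦
    ((((continuous_character _).sub continuous_const).enorm.measurable.pow_const
      2).const_mul _).aemeasurable.mul hFm
  have hlim : ∀ᵐ ξ : Rn n, Tendsto (fun m ↦ G m ξ) atTop (𝓝 (‖derivSymbol v ξ‖ₑ ^ 2 * F ξ)) := by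
    refine ae_of_all _ fun ξ ↦ ENNReal.Tendsto.mul_const (tendsto_character_quotient v ξ) ?_
    right
    simp [hF]
  calc _ = ∫⁻ ξ, liminf (fun m ↦ G m ξ) atTop := by
        refine lintegral_congr_ae ?_
        filter_upwards [hlim] with ξ hξ
        exact hξ.liminf_eq.symm
    _ ≤ liminf (fun m ↦ ∫⁻ ξ, G m ξ) atTop := lintegral_liminf_le' hGm
    _ ≤ liminf (fun _ : ℕ ↦ kineticDir v φ₁ + kineticDir v φ₂) atTop := by
        refine liminf_le_liminf (Eventually.of_forall fun m ↦ ?_)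
        have ht : ‖((m : ℝ) + 1)‖ₑ ^ 2 * ‖((m : ℝ) + 1)⁻¹‖ₑ ^ 2 = 1 := by
          rw [← mul_pow, ← enorm_mul, mul_inv_cancel₀ (by positivity)]; simp
        calc ∫⁻ ξ, G m ξ = ‖((m : ℝ) + 1)‖ₑ ^ 2 *
              (‖translate (((m : ℝ) + 1)⁻¹ • v) f₁ - f₁‖ₑ ^ 2 +
                ‖translate (((m : ℝ) + 1)⁻¹ • v) f₂ - f₂‖ₑ ^ 2) := by
              rw [enorm_translate_sub_sq, enorm_translate_sub_sq,
                ← hsplit (fun ξ ↦ character (((m : ℝ) + 1)⁻¹ • v) ξ - 1)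
                  ((continuous_character _).sub continuous_const),
                ← lintegral_const_mul' _ _ (by simp)]
              simp only [hG, mul_assoc]
          _ ≤ ‖((m : ℝ) + 1)‖ₑ ^ 2 * (kineticDir (((m : ℝ) + 1)⁻¹ • v) φ₁ +
                kineticDir (((m : ℝ) + 1)⁻¹ • v) φ₂) := by
              refine mul_le_mul' le_rfl ((h _).trans ?_)
              exact (add_le_add (enorm_translate_sub_sq_le _ _)
                (enorm_translate_sub_sq_le _ _))
          _ = _ := by
              rw [kineticDir_smul, kineticDir_smul, ← mul_add, ← mul_assoc, ht, one_mul]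
    _ = _ := by simp

/-- The kinetic energy `∫ |∇φ|²`, infinite if `∇φ ∉ L²`. -/
def kinetic (φ : L2 n) : ℝ≥0∞ := ∑ i, kineticDir (EuclideanSpace.single i (1 : ℝ)) φ

theorem exists_weakPartial_iff (φ : L2 n) :
    (∀ i, ∃ g, IsWeakPartial i φ g) ↔ kinetic φ ≠ ∞ := by
  simp only [IsWeakPartial, exists_weakDeriv_iff, kinetic, ne_eq, ENNReal.sum_eq_top,
    Finset.mem_univ, true_and, not_exists]

theorem isWeakPartial_weakPartial {i : Fin n} {φ : L2 n} (h : ∃ g, IsWeakPartial i φ g) :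
    IsWeakPartial i φ (weakPartial i φ) := by
  rw [weakPartial, dif_pos h]
  exact h.choose_spec

theorem sum_norm_weakPartial_sq {φ : L2 n} (h : kinetic φ ≠ ∞) :
    ∑ i, ‖weakPartial i φ‖ ^ 2 = (kinetic φ).toReal := by
  have h' := (exists_weakPartial_iff φ).mpr h
  have h'' : ∀ i, ‖weakPartial i φ‖ₑ ^ 2 = kineticDir (EuclideanSpace.single i (1 : ℝ)) φ :=
    fun i ↦ enorm_sq_weakDeriv (isWeakPartial_weakPartial (h' i))
  rw [kinetic, ENNReal.toReal_sum (fun i _ ↦ by rw [← h'']; simp)]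
  refine Finset.sum_congr rfl fun i _ ↦ ?_
  rw [← h'']
  simp

/-- Pointwise in ξ this is Cauchy-Schwarz for ⟨ξ, v⟩, because the squares of the coordinate symbols
add up to (2π|ξ|)². -/
theorem kineticDir_le (v : Rn n) (φ : L2 n) : kineticDir v φ ≤ ‖v‖ₑ ^ 2 * kinetic φ := by
  rw [kinetic]
  simp only [kineticDir]
  rw [← lintegral_finsetSum' _ fun i _ ↦
    aemeasurable_mul_fourier_enorm_sq (continuous_derivSymbol _) φ, ← lintegral_const_mul' _ _ (by simp)]
  refine lintegral_mono fun ξ ↦ ?_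
  simp only
  rw [← Finset.sum_mul, ← mul_assoc]
  gcongr
  have h1 : ∀ w : Rn n, ‖derivSymbol w ξ‖ₑ ^ 2 = ENNReal.ofReal ((2 * π) ^ 2 * (inner ℝ ξ w) ^ 2) := by
    intro w
    rw [← ofReal_norm, ← ENNReal.ofReal_pow (norm_nonneg _), derivSymbol_eq]
    simp [mul_pow]
  simp only [h1]
  rw [← ENNReal.ofReal_sum_of_nonneg fun i _ ↦ by positivity, ← ofReal_norm,
    ← ENNReal.ofReal_pow (norm_nonneg _), ← ENNReal.ofReal_mul (by positivity)]
  refine ENNReal.ofReal_le_ofReal ?_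
  rw [← Finset.mul_sum]
  have h2 : ∑ i, (inner ℝ ξ (EuclideanSpace.single i (1 : ℝ))) ^ 2 = ‖ξ‖ ^ 2 := by
    rw [EuclideanSpace.norm_sq_eq]
    simp [EuclideanSpace.inner_single_right]
  rw [h2]
  have h3 : (inner ℝ ξ v) ^ 2 ≤ (‖ξ‖ * ‖v‖) ^ 2 := by
    rw [← sq_abs]
    gcongr
    exact abs_real_inner_le_norm _ _
  calc _ ≤ (2 * π) ^ 2 * (‖ξ‖ * ‖v‖) ^ 2 := by gcongr
    _ = _ := by ring

theorem enorm_translate_sub_sq_le_kinetic (h : Rn n) (φ : L2 n) :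
    ‖translate h φ - φ‖ₑ ^ 2 ≤ ‖h‖ₑ ^ 2 * kinetic φ :=
  (enorm_translate_sub_sq_le h φ).trans (kineticDir_le h φ)

/-- Two functions are treated at once because a contraction of ℂ² controls only the sum of their
difference quotients. -/
theorem kinetic_add_le_of_translate {f₁ f₂ φ₁ φ₂ : L2 n}
    (h : ∀ v, ‖translate v f₁ - f₁‖ₑ ^ 2 + ‖translate v f₂ - f₂‖ₑ ^ 2 ≤
      ‖translate v φ₁ - φ₁‖ₑ ^ 2 + ‖translate v φ₂ - φ₂‖ₑ ^ 2) :
    kinetic f₁ + kinetic f₂ ≤ kinetic φ₁ + kinetic φ₂ := by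
  simp only [kinetic, ← Finset.sum_add_distrib]
  exact Finset.sum_le_sum fun i _ ↦ kineticDir_add_le_of_translate h _

end FourierSide

/-! ### Spectral theory of a closed form with compact sublevel sets -/

section AbstractSpectrum

open ComplexConjugate

/-- A hermitian form on a subspace of a Hilbert space that is closed, bounded below, has compact
sublevel sets and an infinite-dimensional domain. -/
structure CompactForm (H : Type*) [NormedAddCommGroup H] [InnerProductSpace ℂ H] where
  /-- The form domain. -/
  dom : Submodule ℂ H
  /-- The form, linear in the first argument. -/
  B : H → H → ℂ
  add_left : ∀ φ ∈ dom, ∀ φ' ∈ dom, ∀ ψ ∈ dom, B (φ + φ') ψ = B φ ψ + B φ' ψ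
  smul_left : ∀ c : ℂ, ∀ φ ∈ dom, ∀ ψ ∈ dom, B (c • φ) ψ = c * B φ ψ
  conj_symm : ∀ φ ∈ dom, ∀ ψ ∈ dom, conj (B φ ψ) = B ψ φ
  lower_bound : ∃ c : ℝ, ∀ φ ∈ dom, -c * ‖φ‖ ^ 2 ≤ (B φ φ).re
  compact : ∀ (φ : ℕ → H) (C : ℝ), (∀ m, φ m ∈ dom) → (∀ m, ‖φ m‖ ≤ C) →
    (∀ m, (B (φ m) (φ m)).re ≤ C) →
    ∃ ψ, ∃ σ : ℕ → ℕ, StrictMono σ ∧ Tendsto (φ ∘ σ) atTop (𝓝 ψ)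
  closed : ∀ (φ : ℕ → H) (ψ : H) (C : ℝ), (∀ m, φ m ∈ dom) → Tendsto φ atTop (𝓝 ψ) →
    (∀ m, (B (φ m) (φ m)).re ≤ C) → ψ ∈ dom ∧ (B ψ ψ).re ≤ C
  infinite : ∀ N : ℕ, ∃ f : Fin N → H, (∀ i, f i ∈ dom) ∧ LinearIndependent ℂ f

namespace CompactForm

variable {H : Type*} [NormedAddCommGroup H] [InnerProductSpace ℂ H] (F : CompactForm H)

/-- The quadratic form. -/
def q (φ : H) : ℝ := (F.B φ φ).re

variable {F}

theorem add_right {φ ψ ψ' : H} (hφ : φ ∈ F.dom) (hψ : ψ ∈ F.dom) (hψ' : ψ' ∈ F.dom) :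
    F.B φ (ψ + ψ') = F.B φ ψ + F.B φ ψ' := by
  rw [← F.conj_symm _ (add_mem hψ hψ') _ hφ, F.add_left _ hψ _ hψ' _ hφ, map_add,
    F.conj_symm _ hψ _ hφ, F.conj_symm _ hψ' _ hφ]

theorem smul_right (c : ℂ) {φ ψ : H} (hφ : φ ∈ F.dom) (hψ : ψ ∈ F.dom) :
    F.B φ (c • ψ) = conj c * F.B φ ψ := by
  rw [← F.conj_symm _ (F.dom.smul_mem c hψ) _ hφ, F.smul_left c _ hψ _ hφ, map_mul,
    F.conj_symm _ hψ _ hφ]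

theorem zero_left {ψ : H} (hψ : ψ ∈ F.dom) : F.B 0 ψ = 0 := by
  simpa using F.smul_left 0 0 (zero_mem _) ψ hψ

theorem sum_left {ι : Type*} (s : Finset ι) {f : ι → H} (hf : ∀ i, f i ∈ F.dom) {ψ : H}
    (hψ : ψ ∈ F.dom) : F.B (∑ i ∈ s, f i) ψ = ∑ i ∈ s, F.B (f i) ψ := by
  classical
  induction s using Finset.induction_on with
  | empty => simp [zero_left hψ]
  | insert a s ha ih =>
    rw [Finset.sum_insert ha, Finset.sum_insert ha,
      F.add_left _ (hf a) _ (sum_mem fun i _ ↦ hf i) _ hψ, ih]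

theorem self_eq {φ : H} (hφ : φ ∈ F.dom) : F.B φ φ = (F.q φ : ℂ) :=
  (Complex.conj_eq_iff_re.mp (F.conj_symm φ hφ φ hφ)).symm

theorem q_add {φ ψ : H} (hφ : φ ∈ F.dom) (hψ : ψ ∈ F.dom) :
    F.q (φ + ψ) = F.q φ + F.q ψ + 2 * (F.B φ ψ).re := by
  rw [q, F.add_left _ hφ _ hψ _ (add_mem hφ hψ), add_right hφ hφ hψ, add_right hψ hφ hψ,
    ← F.conj_symm φ hφ ψ hψ]
  simp [q]; ring

theorem q_smul (c : ℂ) {φ : H} (hφ : φ ∈ F.dom) : F.q (c • φ) = ‖c‖ ^ 2 * F.q φ := by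
  rw [q, F.smul_left c _ hφ _ (F.dom.smul_mem c hφ), smul_right c hφ hφ, self_eq hφ, ← mul_assoc,
    Complex.mul_conj, Complex.normSq_eq_norm_sq]
  norm_cast

/-- A minimizer of the Rayleigh quotient satisfies the Euler-Lagrange equation. -/
theorem B_eq_of_minimal {φ r : H} {μ : ℝ} (hφ : φ ∈ F.dom) (hr : r ∈ F.dom)
    (h0 : F.q φ = μ * ‖φ‖ ^ 2)
    (hmin : ∀ t : ℂ, μ * ‖φ + t • r‖ ^ 2 ≤ F.q (φ + t • r)) :
    F.B φ r = μ * inner ℂ r φ := by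
  set z : ℂ := F.B φ r - μ * inner ℂ r φ with hz
  -- Here z is the defect in the Euler-Lagrange equation. If z ≠ 0, the choice t = -sz makes the
  -- linear term -2s‖z‖², which the term of order s² cannot compensate for small s.
  have key : ∀ t : ℂ, 0 ≤ 2 * (conj t * z).re + ‖t‖ ^ 2 * (F.q r - μ * ‖r‖ ^ 2) := by
    intro t
    have h1 := hmin t
    rw [q_add hφ (F.dom.smul_mem t hr), smul_right t hφ hr, q_smul t hr,
      @norm_add_sq ℂ, inner_smul_right, norm_smul] at h1
    have h2 : (t * inner ℂ φ r).re = (conj t * inner ℂ r φ).re := by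
      rw [← inner_conj_symm φ r, ← Complex.conj_re, map_mul, Complex.conj_conj]
    have h3 : (conj t * z).re = (conj t * F.B φ r).re - μ * (conj t * inner ℂ r φ).re := by
      rw [hz, mul_sub, Complex.sub_re, mul_left_comm, Complex.re_ofReal_mul]
    rw [h3]
    simp only [RCLike.re_eq_complex_re, h2] at h1
    nlinarith
  by_contra hne
  have hz0 : z ≠ 0 := fun h ↦ hne (sub_eq_zero.mp h)
  have hzp : 0 < ‖z‖ ^ 2 := by positivity
  have hs : ∀ s : ℝ, 0 < s → 2 ≤ s * (F.q r - μ * ‖r‖ ^ 2) := by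
    intro s hs
    have h1 := key (-(s : ℂ) * z)
    have h2 : (conj (-(s : ℂ) * z) * z) = ((-s * ‖z‖ ^ 2 : ℝ) : ℂ) := by
      rw [map_mul, mul_assoc, mul_comm (conj z), Complex.mul_conj, Complex.normSq_eq_norm_sq]
      simp
    rw [h2, Complex.ofReal_re, norm_mul, norm_neg, Complex.norm_real, Real.norm_eq_abs,
      abs_of_pos hs, mul_pow] at h1
    have h3 : 0 ≤ (s * ‖z‖ ^ 2) * (s * (F.q r - μ * ‖r‖ ^ 2) - 2) := by nlinarith
    have := nonneg_of_mul_nonneg_right h3 (by positivity)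
    linarith
  -- s = 1 shows that the quadratic coefficient is positive; taking its inverse for s then gives 2 ≤
  -- 1.
  have h1 := hs 1 one_pos
  rw [one_mul] at h1
  have h2 := hs (1 / (F.q r - μ * ‖r‖ ^ 2)) (by positivity)
  rw [one_div, inv_mul_cancel₀ (by linarith)] at h2
  linarith

/-- Dimension count: one more independent vector of the domain than there are orthogonality
conditions. -/
theorem exists_dom_orthogonal {s : Set H} (hs : s.Finite) :
    ∃ φ ∈ F.dom, ‖φ‖ = 1 ∧ ∀ v ∈ s, inner ℂ v φ = 0 := by
  classical
  have := hs.fintype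
  obtain ⟨f, hf, hli⟩ := F.infinite (Fintype.card s + 1)
  let T : (Fin (Fintype.card s + 1) → ℂ) →ₗ[ℂ] (s → ℂ) :=
    { toFun := fun c v ↦ inner ℂ (v : H) (∑ i, c i • f i)
      map_add' := fun c d ↦ by
        ext v; simp [add_smul, Finset.sum_add_distrib]
      map_smul' := fun a c ↦ by
        ext v; simp [mul_smul, ← Finset.smul_sum] }
  have hker : ¬ Function.Injective T := by
    intro hinj
    have := LinearMap.finrank_le_finrank_of_injective hinj
    simp at this
  rw [← LinearMap.ker_eq_bot, Submodule.eq_bot_iff] at hker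
  push Not at hker
  obtain ⟨c, hc, hc0⟩ := hker
  set g := ∑ i, c i • f i with hg
  have hg0 : g ≠ 0 := by
    intro h
    exact hc0 (funext (Fintype.linearIndependent_iff.mp hli c h))
  have hgd : g ∈ F.dom := sum_mem fun i _ ↦ F.dom.smul_mem _ (hf i)
  refine ⟨((‖g‖⁻¹ : ℝ) : ℂ) • g, F.dom.smul_mem _ hgd, ?_, fun v hv ↦ ?_⟩
  · rw [norm_smul, Complex.norm_real, norm_inv, norm_norm, inv_mul_cancel₀ (norm_ne_zero_iff.mpr hg0)]
  · rw [inner_smul_right]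
    have := congrFun (LinearMap.mem_ker.mp hc) ⟨v, hv⟩
    change inner ℂ v g = 0 at this
    rw [this, mul_zero]

variable (F) in
/-- `φ` minimizes the Rayleigh quotient over the orthogonal complement of `s`. -/
def IsMinimizer (s : Set H) (φ : H) : Prop :=
  φ ∈ F.dom ∧ ‖φ‖ = 1 ∧ (∀ v ∈ s, inner ℂ v φ = 0) ∧
    ∀ ψ ∈ F.dom, (∀ v ∈ s, inner ℂ v ψ = 0) → F.q φ * ‖ψ‖ ^ 2 ≤ F.q ψ

/-- Direct method: a minimizing sequence has a convergent subsequence, the constraints pass to the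
limit by continuity, and closedness plays the part of lower semicontinuity. -/
theorem exists_isMinimizer {s : Set H} (hs : s.Finite) : ∃ φ, F.IsMinimizer s φ := by
  set A : Set ℝ := F.q '' {φ | φ ∈ F.dom ∧ ‖φ‖ = 1 ∧ ∀ v ∈ s, inner ℂ v φ = 0} with hA
  have hne : A.Nonempty := by
    obtain ⟨φ, h1, h2, h3⟩ := exists_dom_orthogonal (F := F) hs
    exact ⟨_, φ, ⟨h1, h2, h3⟩, rfl⟩
  have hbdd : BddBelow A := by
    obtain ⟨c, hc⟩ := F.lower_bound
    refine ⟨-c, ?_⟩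
    rintro _ ⟨φ, ⟨h1, h2, -⟩, rfl⟩
    simpa [h2, q] using hc φ h1
  have hseq : ∀ m : ℕ, ∃ φ, (φ ∈ F.dom ∧ ‖φ‖ = 1 ∧ ∀ v ∈ s, inner ℂ v φ = 0) ∧
      F.q φ < sInf A + 1 / ((m : ℝ) + 1) := by
    intro m
    obtain ⟨_, ⟨φ, h, rfl⟩, h'⟩ := exists_lt_of_csInf_lt hne
      (show sInf A < sInf A + 1 / ((m : ℝ) + 1) by linarith [Nat.one_div_pos_of_nat (α := ℝ) (n := m)])
    exact ⟨φ, h, h'⟩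
  choose φ hφ hq using hseq
  have hle : ∀ m, F.q (φ m) ≤ max 1 (sInf A + 1) := fun m ↦ by
    refine (hq m).le.trans (le_trans ?_ (le_max_right _ _))
    have : 1 / ((m : ℝ) + 1) ≤ 1 := by
      rw [div_le_one (by positivity)]; linarith [(Nat.cast_nonneg m : (0 : ℝ) ≤ m)]
    linarith
  obtain ⟨ψ, σ, hσ, hlim⟩ := F.compact φ (max 1 (sInf A + 1)) (fun m ↦ (hφ m).1)
    (fun m ↦ (hφ m).2.1.le.trans (le_max_left _ _)) hle
  have hnorm : ‖ψ‖ = 1 := by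
    refine tendsto_nhds_unique hlim.norm ?_
    simp [(hφ _).2.1]
  have horth : ∀ v ∈ s, inner ℂ v ψ = 0 := by
    intro v hv
    refine tendsto_nhds_unique ((tendsto_const_nhds (x := v)).inner hlim) ?_
    simp [(hφ _).2.2 v hv]
  -- Closedness needs a bound along the whole sequence, so it is applied to a tail, on which the
  -- values are below `sInf A + ε`.
  have hclosed : ∀ ε > 0, ψ ∈ F.dom ∧ F.q ψ ≤ sInf A + ε := by
    intro ε hε
    obtain ⟨N, hN⟩ := exists_nat_one_div_lt hε
    refine F.closed (fun m ↦ φ (σ (m + N))) ψ _ (fun m ↦ (hφ _).1)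
      ((tendsto_add_atTop_iff_nat N).mpr hlim) fun m ↦ ?_
    refine (hq _).le.trans ?_
    have h1 : N ≤ σ (m + N) := (Nat.le_add_left N m).trans (hσ.le_apply)
    have h2 : 1 / ((σ (m + N) : ℝ) + 1) ≤ 1 / ((N : ℝ) + 1) := by
      gcongr
    linarith
  have hψ := (hclosed 1 one_pos).1
  have hqψ : F.q ψ ≤ sInf A := le_of_forall_pos_le_add fun ε hε ↦ (hclosed ε hε).2
  refine ⟨ψ, hψ, hnorm, horth, fun χ hχ hχs ↦ ?_⟩
  by_cases h0 : χ = 0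
  · simp [h0, q, zero_left (zero_mem F.dom)]
  have hn : 0 < ‖χ‖ := norm_pos_iff.mpr h0
  have hmem : F.q (((‖χ‖⁻¹ : ℝ) : ℂ) • χ) ∈ A := by
    refine ⟨_, ⟨F.dom.smul_mem _ hχ, ?_, fun v hv ↦ ?_⟩, rfl⟩
    · rw [norm_smul, Complex.norm_real, norm_inv, norm_norm, inv_mul_cancel₀ hn.ne']
    · rw [inner_smul_right, hχs v hv, mul_zero]
  have h1 := hqψ.trans (csInf_le hbdd hmem)
  rw [q_smul _ hχ, Complex.norm_real, norm_inv, norm_norm, inv_pow] at h1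
  calc F.q ψ * ‖χ‖ ^ 2 ≤ ((‖χ‖ ^ 2)⁻¹ * F.q χ) * ‖χ‖ ^ 2 := by gcongr
    _ = F.q χ := by field_simp

open Classical in
variable (F) in
/-- A minimizer of the Rayleigh quotient over the orthogonal complement of `s`. -/
def minimizer (s : Set H) : H := if h : ∃ φ, F.IsMinimizer s φ then h.choose else 0

theorem isMinimizer_minimizer {s : Set H} (hs : s.Finite) : F.IsMinimizer s (F.minimizer s) := by
  have h := exists_isMinimizer (F := F) hs
  rw [minimizer, dif_pos h]
  exact h.choose_spec

variable (F) in
/-- The successive minimizers of the Rayleigh quotient. -/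
def vec : ℕ → H
  | m => F.minimizer (Set.range fun i : Fin m ↦ vec i)
termination_by m => m
decreasing_by exact i.2

variable (F) in
/-- The successive minima of the Rayleigh quotient. -/
def val (m : ℕ) : ℝ := F.q (F.vec m)

theorem vec_spec (m : ℕ) : F.IsMinimizer (Set.range fun i : Fin m ↦ F.vec i) (F.vec m) := by
  rw [vec]
  exact isMinimizer_minimizer (Set.finite_range _)

theorem vec_mem (m : ℕ) : F.vec m ∈ F.dom := (vec_spec m).1

theorem inner_vec_of_lt {i m : ℕ} (h : i < m) : inner ℂ (F.vec i) (F.vec m) = 0 :=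
  (vec_spec m).2.2.1 _ ⟨⟨i, h⟩, rfl⟩

theorem orthonormal_vec : Orthonormal ℂ F.vec := by
  refine ⟨fun m ↦ (vec_spec m).2.1, fun i j hij ↦ ?_⟩
  rcases lt_or_gt_of_ne hij with h | h
  · exact inner_vec_of_lt h
  · exact inner_eq_zero_symm.mp (inner_vec_of_lt h)

theorem val_mul_le {m : ℕ} {ψ : H} (hψ : ψ ∈ F.dom)
    (h : ∀ i < m, inner ℂ (F.vec i) ψ = 0) : F.val m * ‖ψ‖ ^ 2 ≤ F.q ψ := by
  refine (vec_spec m).2.2.2 ψ hψ ?_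
  rintro _ ⟨i, rfl⟩
  exact h i i.2

theorem val_mono : Monotone F.val := by
  refine monotone_nat_of_le_succ fun m ↦ ?_
  have := val_mul_le (F := F) (m := m) (vec_mem (m + 1))
    fun i hi ↦ inner_vec_of_lt (hi.trans (Nat.lt_succ_self m))
  simpa [(vec_spec (F := F) (m + 1)).2.1, val] using this

variable (F) in
/-- The projection away from the vectors with indices in `s`. -/
def remainder (s : Finset ℕ) (φ : H) : H := φ - ∑ i ∈ s, inner ℂ (F.vec i) φ • F.vec i

theorem remainder_mem (s : Finset ℕ) {φ : H} (hφ : φ ∈ F.dom) : F.remainder s φ ∈ F.dom :=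
  sub_mem hφ (sum_mem fun i _ ↦ F.dom.smul_mem _ (vec_mem i))

open Classical in
theorem inner_vec_remainder (s : Finset ℕ) (φ : H) (j : ℕ) :
    inner ℂ (F.vec j) (F.remainder s φ) = if j ∈ s then 0 else inner ℂ (F.vec j) φ := by
  rw [remainder, inner_sub_right, inner_sum]
  simp only [inner_smul_right, orthonormal_iff_ite.mp orthonormal_vec]
  by_cases h : j ∈ s <;> simp [h]

theorem eq_sum_add_remainder (s : Finset ℕ) (φ : H) :
    φ = ∑ i ∈ s, inner ℂ (F.vec i) φ • F.vec i + F.remainder s φ := by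
  simp [remainder]

/-- Minimality gives the Euler-Lagrange equation only against vectors orthogonal to the earlier
minimizers. Against these, both sides vanish, by induction and hermitian symmetry. -/
theorem B_vec (m : ℕ) : ∀ ψ ∈ F.dom, F.B (F.vec m) ψ = F.val m * inner ℂ ψ (F.vec m) := by
  induction m using Nat.strong_induction_on with
  | _ m ih =>
  intro ψ hψ
  have hm := vec_mem (F := F) m
  have hlow : ∀ i < m, F.B (F.vec i) (F.vec m) = 0 := fun i hi ↦ by
    rw [ih i hi _ hm, inner_eq_zero_symm.mp (inner_vec_of_lt hi), mul_zero]
  set r := F.remainder (Finset.range m) ψ with hr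
  have hrd : r ∈ F.dom := remainder_mem _ hψ
  have hro : ∀ i < m, inner ℂ (F.vec i) r = 0 := fun i hi ↦ by
    rw [hr, inner_vec_remainder, if_pos (Finset.mem_range.mpr hi)]
  have h1 : F.B (F.vec m) r = F.val m * inner ℂ r (F.vec m) := by
    refine B_eq_of_minimal hm hrd (by simp [val, (vec_spec (F := F) m).2.1]) fun t ↦ ?_
    refine val_mul_le (add_mem hm (F.dom.smul_mem t hrd)) fun i hi ↦ ?_
    rw [inner_add_right, inner_smul_right, hro i hi, inner_vec_of_lt hi]
    simp
  have hsum : ∑ i ∈ Finset.range m, inner ℂ (F.vec i) ψ • F.vec i ∈ F.dom :=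
    sum_mem fun i _ ↦ F.dom.smul_mem _ (vec_mem i)
  have h2 : F.B (F.vec m) (∑ i ∈ Finset.range m, inner ℂ (F.vec i) ψ • F.vec i) = 0 := by
    rw [← F.conj_symm _ hsum _ hm, sum_left _ (fun i ↦ F.dom.smul_mem _ (vec_mem i)) hm,
      Finset.sum_eq_zero, map_zero]
    intro i hi
    rw [F.smul_left _ _ (vec_mem i) _ hm, hlow i (Finset.mem_range.mp hi), mul_zero]
  have h3 : inner ℂ (∑ i ∈ Finset.range m, inner ℂ (F.vec i) ψ • F.vec i) (F.vec m) = 0 := by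
    rw [sum_inner]
    refine Finset.sum_eq_zero fun i hi ↦ ?_
    rw [inner_smul_left, inner_vec_of_lt (Finset.mem_range.mp hi), mul_zero]
  conv_lhs => rw [eq_sum_add_remainder (F := F) (Finset.range m) ψ]
  conv_rhs => rw [eq_sum_add_remainder (F := F) (Finset.range m) ψ]
  rw [add_right hm hsum hrd, inner_add_left, h2, h3, h1]
  simp [hr]

/-- Bounded minima would give an orthonormal sequence with a convergent subsequence, although its
members have distance √2. -/
theorem exists_val_gt (C : ℝ) : ∃ m, C < F.val m := by
  by_contra! h
  obtain ⟨ψ, σ, hσ, hlim⟩ := F.compact F.vec (max 1 C) vec_mem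
    (fun m ↦ by rw [(vec_spec m).2.1]; exact le_max_left _ _) fun m ↦ (h m).trans (le_max_right _ _)
  have hc := hlim.cauchySeq
  rw [Metric.cauchySeq_iff'] at hc
  obtain ⟨N, hN⟩ := hc 1 one_pos
  have h1 := hN (N + 1) (Nat.le_succ N)
  have horth : inner ℂ (F.vec (σ (N + 1))) (F.vec (σ N)) = 0 :=
    orthonormal_vec.2 (hσ (Nat.lt_succ_self N)).ne'
  have h2 : ‖F.vec (σ (N + 1)) - F.vec (σ N)‖ ^ 2 = 2 := by
    rw [@norm_sub_sq ℂ, horth, (vec_spec _).2.1, (vec_spec _).2.1]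
    norm_num
  rw [Function.comp_apply, Function.comp_apply, dist_eq_norm] at h1
  have h3 : ‖F.vec (σ (N + 1)) - F.vec (σ N)‖ ^ 2 < 1 := by
    have := norm_nonneg (F.vec (σ (N + 1)) - F.vec (σ N))
    nlinarith
  linarith

/-- The minimizers are complete in the form domain. -/
theorem eq_zero_of_orthogonal {r : H} (hr : r ∈ F.dom) (h : ∀ i, inner ℂ (F.vec i) r = 0) :
    r = 0 := by
  by_contra hne
  have hp : 0 < ‖r‖ ^ 2 := by have := norm_pos_iff.mpr hne; positivity
  obtain ⟨m, hm⟩ := exists_val_gt (F := F) (F.q r / ‖r‖ ^ 2)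
  rw [div_lt_iff₀ hp] at hm
  exact absurd (val_mul_le hr fun i _ ↦ h i) (not_le.mpr hm)

theorem finite_setOf_val_le (ν : ℝ) : {i | F.val i ≤ ν}.Finite := by
  obtain ⟨m, hm⟩ := exists_val_gt (F := F) ν
  refine (Set.finite_lt_nat m).subset fun i hi ↦ ?_
  by_contra hcon
  exact absurd (val_mono (not_lt.mp hcon)) (not_le.mpr (lt_of_le_of_lt hi hm))

variable (F) in
/-- `φ` is in the domain of the operator of the form, which maps it to `f`. -/
def Maps (φ f : H) : Prop := φ ∈ F.dom ∧ ∀ ψ ∈ F.dom, F.B φ ψ = inner ℂ ψ f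

theorem maps_vec (m : ℕ) : F.Maps (F.vec m) ((F.val m : ℂ) • F.vec m) :=
  ⟨vec_mem m, fun ψ hψ ↦ by rw [B_vec m ψ hψ, inner_smul_right]⟩

theorem Maps.q_eq {φ : H} {ν : ℝ} (h : F.Maps φ ((ν : ℂ) • φ)) : F.q φ = ν * ‖φ‖ ^ 2 := by
  rw [q, h.2 φ h.1, inner_smul_right, inner_self_eq_norm_sq_to_K,
    Complex.re_ofReal_mul]
  norm_cast

/-- Evaluating the form on the pair in both orders gives `(val i - ν)⟨vec i, φ⟩ = 0`. -/
theorem Maps.inner_vec_eq_zero {φ : H} {ν : ℝ} (h : F.Maps φ ((ν : ℂ) • φ)) {i : ℕ}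
    (hi : F.val i ≠ ν) : inner ℂ (F.vec i) φ = 0 := by
  have h1 := h.2 _ (vec_mem i)
  rw [← F.conj_symm _ (vec_mem i) _ h.1, B_vec i φ h.1, map_mul, inner_conj_symm,
    Complex.conj_ofReal, inner_smul_right] at h1
  have h2 : ((F.val i - ν : ℝ) : ℂ) * inner ℂ (F.vec i) φ = 0 := by
    push_cast; linear_combination h1
  refine (mul_eq_zero.mp h2).resolve_left ?_
  exact_mod_cast sub_ne_zero.mpr hi

/-- Only finitely many minima equal ν. Removing the projection onto their vectors leaves a vector
orthogonal to all minimizers, hence zero by completeness. -/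
theorem mem_span_of_inner_eq_zero {φ : H} {ν : ℝ} (hφ : φ ∈ F.dom)
    (h : ∀ i, F.val i ≠ ν → inner ℂ (F.vec i) φ = 0) :
    φ ∈ Submodule.span ℂ (F.vec '' {i | F.val i = ν}) := by
  have hfin : {i | F.val i = ν}.Finite := (finite_setOf_val_le ν).subset fun i hi ↦ le_of_eq hi
  have hr : F.remainder hfin.toFinset φ = 0 := by
    refine eq_zero_of_orthogonal (remainder_mem _ hφ) fun i ↦ ?_
    rw [inner_vec_remainder]
    split_ifs with hi
    · rfl
    · exact h i fun h' ↦ hi (hfin.mem_toFinset.mpr h')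
  rw [eq_sum_add_remainder (F := F) hfin.toFinset φ, hr, add_zero]
  exact sum_mem fun i hi ↦ Submodule.smul_mem _ _
    (Submodule.subset_span ⟨i, hfin.mem_toFinset.mp hi, rfl⟩)

theorem maps_of_mem_span {φ : H} {ν : ℝ}
    (h : φ ∈ Submodule.span ℂ (F.vec '' {i | F.val i = ν})) : F.Maps φ ((ν : ℂ) • φ) := by
  induction h using Submodule.span_induction with
  | mem x hx =>
    obtain ⟨i, hi, rfl⟩ := hx
    rw [← show F.val i = ν from hi]
    exact maps_vec i
  | zero => exact ⟨zero_mem _, fun ψ hψ ↦ by simp [zero_left hψ]⟩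
  | add x y _ _ hx hy =>
    refine ⟨add_mem hx.1 hy.1, fun ψ hψ ↦ ?_⟩
    rw [F.add_left _ hx.1 _ hy.1 _ hψ, hx.2 ψ hψ, hy.2 ψ hψ, smul_add, inner_add_right]
  | smul c x _ hx =>
    refine ⟨F.dom.smul_mem c hx.1, fun ψ hψ ↦ ?_⟩
    rw [F.smul_left c _ hx.1 _ hψ, hx.2 ψ hψ, smul_comm, inner_smul_right _ _ c]

theorem maps_iff_mem_span {φ : H} {ν : ℝ} :
    F.Maps φ ((ν : ℂ) • φ) ↔ φ ∈ Submodule.span ℂ (F.vec '' {i | F.val i = ν}) :=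
  ⟨fun h ↦ mem_span_of_inner_eq_zero h.1 fun _ hi ↦ h.inner_vec_eq_zero hi, maps_of_mem_span⟩

theorem span_maps_eq (ν : ℝ) : Submodule.span ℂ {φ | F.Maps φ ((ν : ℂ) • φ)} =
    Submodule.span ℂ (F.vec '' {i | F.val i = ν}) := by
  refine le_antisymm (Submodule.span_le.mpr fun φ hφ ↦ maps_iff_mem_span.mp hφ)
    (Submodule.span_mono ?_)
  rintro _ ⟨i, hi, rfl⟩
  exact maps_of_mem_span (Submodule.subset_span ⟨i, hi, rfl⟩)

theorem iSup_span_maps_eq (μ : ℝ) :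
    (⨆ (ν : ℝ) (_ : ν ≤ μ), Submodule.span ℂ {φ | F.Maps φ ((ν : ℂ) • φ)}) =
      Submodule.span ℂ (F.vec '' {i | F.val i ≤ μ}) := by
  simp only [span_maps_eq, ← Submodule.span_iUnion]
  congr 1
  ext x
  simp only [mem_iUnion, mem_image, mem_ofPred_eq, exists_prop]
  constructor
  · rintro ⟨ν, hν, i, hi, rfl⟩
    exact ⟨i, hi ▸ hν, rfl⟩
  · rintro ⟨i, hi, rfl⟩
    exact ⟨_, hi, i, rfl, rfl⟩

theorem rank_span_vec (s : Set ℕ) (hs : s.Finite) :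
    Module.rank ℂ (Submodule.span ℂ (F.vec '' s)) = (s.ncard : Cardinal) := by
  have hinj : Function.Injective F.vec := orthonormal_vec.linearIndependent.injective
  rw [rank_span_set (orthonormal_vec.linearIndependent.linearIndepOn s).id_image,
    ← Set.cast_ncard (hs.image _), Set.ncard_image_of_injective s hinj]

/-- The rank counts the indices i with `val i ≤ μ`. By monotonicity these form an initial segment,
which has at least j + 1 members exactly if `val j ≤ μ`. -/
theorem sInf_rank_eq_val (j : ℕ) :
    sInf {μ : ℝ | ((j + 1 : ℕ) : Cardinal) ≤ Module.rank ℂ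
      ↥(⨆ (ν : ℝ) (_ : ν ≤ μ), Submodule.span ℂ {φ | F.Maps φ ((ν : ℂ) • φ)})} = F.val j := by
  have : {μ : ℝ | ((j + 1 : ℕ) : Cardinal) ≤ Module.rank ℂ
      ↥(⨆ (ν : ℝ) (_ : ν ≤ μ), Submodule.span ℂ {φ | F.Maps φ ((ν : ℂ) • φ)})} =
      Set.Ici (F.val j) := by
    ext μ
    rw [mem_ofPred_eq, iSup_span_maps_eq, rank_span_vec _ (finite_setOf_val_le μ), Nat.cast_le,
      mem_Ici]
    constructor
    · intro h
      by_contra! hlt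
      have hsub : {i | F.val i ≤ μ} ⊆ ↑(Finset.range j) := fun i hi ↦ by
        simp only [Finset.coe_range, mem_Iio]
        by_contra! hji
        exact absurd (val_mono hji) (not_le.mpr (lt_of_le_of_lt hi hlt))
      have := Set.ncard_le_ncard hsub (Finset.finite_toSet _)
      rw [Set.ncard_coe_finset, Finset.card_range] at this
      omega
    · intro h
      have hsub : ↑(Finset.range (j + 1)) ⊆ {i | F.val i ≤ μ} := fun i hi ↦ by
        simp only [Finset.coe_range, mem_Iio] at hi
        exact (val_mono (Nat.lt_succ_iff.mp hi)).trans h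
      have := Set.ncard_le_ncard hsub (finite_setOf_val_le μ)
      rwa [Set.ncard_coe_finset, Finset.card_range] at this
  rw [this, csInf_Ici]

/-- A lower bound of the quadratic form by the first `m` minima. -/
theorem val_mul_add_sum_le (m : ℕ) {φ : H} (hφ : φ ∈ F.dom) :
    F.val m * ‖φ‖ ^ 2 +
      ∑ i ∈ Finset.range m, (F.val i - F.val m) * ‖inner ℂ (F.vec i) φ‖ ^ 2 ≤ F.q φ := by
  set p := ∑ i ∈ Finset.range m, inner ℂ (F.vec i) φ • F.vec i with hp
  set r := F.remainder (Finset.range m) φ with hr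
  have hφp : φ = p + r := eq_sum_add_remainder _ _
  have hrd : r ∈ F.dom := remainder_mem _ hφ
  have hpd : p ∈ F.dom := sum_mem fun i _ ↦ F.dom.smul_mem _ (vec_mem i)
  have hro : ∀ i ∈ Finset.range m, inner ℂ (F.vec i) r = 0 := fun i hi ↦ by
    rw [hr, inner_vec_remainder, if_pos hi]
  have hip : ∀ i ∈ Finset.range m, inner ℂ (F.vec i) p = inner ℂ (F.vec i) φ := fun i hi ↦ by
    rw [hφp, inner_add_right, hro i hi, add_zero]
  have hpr : inner ℂ p r = 0 := by
    rw [hp, sum_inner]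
    exact Finset.sum_eq_zero fun i hi ↦ by rw [inner_smul_left, hro i hi, mul_zero]
  have hBpr : F.B p r = 0 := by
    rw [hp, sum_left _ (fun i ↦ F.dom.smul_mem _ (vec_mem i)) hrd]
    refine Finset.sum_eq_zero fun i hi ↦ ?_
    rw [F.smul_left _ _ (vec_mem i) _ hrd, B_vec i r hrd, inner_eq_zero_symm.mp (hro i hi)]
    simp
  have hnp : ‖p‖ ^ 2 = ∑ i ∈ Finset.range m, ‖inner ℂ (F.vec i) φ‖ ^ 2 := by
    have h1 : ((‖p‖ ^ 2 : ℝ) : ℂ) =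
        ((∑ i ∈ Finset.range m, ‖inner ℂ (F.vec i) φ‖ ^ 2 : ℝ) : ℂ) := by
      have h2 := inner_self_eq_norm_sq_to_K (𝕜 := ℂ) p
      simp only [Complex.coe_algebraMap] at h2
      push_cast
      rw [← h2]
      conv_lhs => rw [hp, sum_inner]
      refine Finset.sum_congr rfl fun i hi ↦ ?_
      rw [inner_smul_left, hip i hi, ← Complex.conj_mul']
    exact_mod_cast h1
  have hqp : F.q p = ∑ i ∈ Finset.range m, F.val i * ‖inner ℂ (F.vec i) φ‖ ^ 2 := by
    have h1 : (F.q p : ℂ) =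
        ((∑ i ∈ Finset.range m, F.val i * ‖inner ℂ (F.vec i) φ‖ ^ 2 : ℝ) : ℂ) := by
      rw [← self_eq hpd]
      conv_lhs => enter [2]; rw [hp]
      rw [sum_left _ (fun i ↦ F.dom.smul_mem _ (vec_mem i)) hpd]
      push_cast
      refine Finset.sum_congr rfl fun i hi ↦ ?_
      rw [F.smul_left _ _ (vec_mem i) _ hpd, B_vec i p hpd, ← inner_conj_symm p, hip i hi,
        mul_left_comm, ← Complex.mul_conj']
    exact_mod_cast h1
  have hnφ : ‖φ‖ ^ 2 = ‖p‖ ^ 2 + ‖r‖ ^ 2 := by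
    rw [hφp, @norm_add_sq ℂ, hpr]; simp
  have hqφ : F.q φ = F.q p + F.q r := by
    rw [hφp, q_add hpd hrd, hBpr]; simp
  have hqr : F.val m * ‖r‖ ^ 2 ≤ F.q r :=
    val_mul_le hrd fun i hi ↦ hro i (Finset.mem_range.mpr hi)
  rw [hqφ, hnφ, hqp, hnp, mul_add]
  have : ∑ i ∈ Finset.range m, (F.val i - F.val m) * ‖inner ℂ (F.vec i) φ‖ ^ 2 =
      ∑ i ∈ Finset.range m, F.val i * ‖inner ℂ (F.vec i) φ‖ ^ 2 -
        F.val m * ∑ i ∈ Finset.range m, ‖inner ℂ (F.vec i) φ‖ ^ 2 := by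
    rw [Finset.mul_sum, ← Finset.sum_sub_distrib]
    simp only [sub_mul]
  rw [this]
  linarith

/-- The Ky Fan inequality. -/
theorem sum_val_le_sum_q {ι : Type*} [Fintype ι] {f : ι → H} (hf : ∀ j, f j ∈ F.dom)
    (ho : Orthonormal ℂ f) :
    ∑ i ∈ Finset.range (Fintype.card ι), F.val i ≤ ∑ j, F.q (f j) := by
  set m := Fintype.card ι with hm
  -- The coefficient is nonpositive, so Bessel's inequality for `vec i` in the frame f, with bound
  -- 1, gives a lower bound.
  have h1 : ∀ i ∈ Finset.range m, (F.val i - F.val m) * 1 ≤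
      (F.val i - F.val m) * ∑ j, ‖inner ℂ (F.vec i) (f j)‖ ^ 2 := by
    intro i hi
    refine mul_le_mul_of_nonpos_left ?_
      (sub_nonpos.mpr (val_mono (Finset.mem_range.mp hi).le))
    have := ho.sum_inner_products_le (F.vec i) (s := Finset.univ)
    rw [(vec_spec i).2.1, one_pow] at this
    simpa only [norm_inner_symm] using this
  calc ∑ i ∈ Finset.range m, F.val i
      = m * F.val m + ∑ i ∈ Finset.range m, (F.val i - F.val m) * 1 := by
        simp [Finset.sum_sub_distrib]
    _ ≤ m * F.val m + ∑ i ∈ Finset.range m,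
          (F.val i - F.val m) * ∑ j, ‖inner ℂ (F.vec i) (f j)‖ ^ 2 := by
        exact add_le_add le_rfl (Finset.sum_le_sum h1)
    _ = ∑ j, (F.val m * ‖f j‖ ^ 2 +
          ∑ i ∈ Finset.range m, (F.val i - F.val m) * ‖inner ℂ (F.vec i) (f j)‖ ^ 2) := by
        rw [Finset.sum_add_distrib, Finset.sum_comm]
        simp [ho.1, Finset.mul_sum, hm]
    _ ≤ ∑ j, F.q (f j) := Finset.sum_le_sum fun j _ ↦ val_mul_add_sum_le m (hf j)

/-- Abel summation, run as an induction that keeps the last weight times the partial sum as a lower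
bound. -/
theorem sum_mul_nonneg_of_partialSums {b x : ℕ → ℝ} {k : ℕ} (hb : ∀ i j, i ≤ j → j < k → b j ≤ b i)
    (hb0 : ∀ i < k, 0 ≤ b i) (hx : ∀ m ≤ k, 0 ≤ ∑ i ∈ Finset.range m, x i) :
    0 ≤ ∑ i ∈ Finset.range k, b i * x i := by
  have key : ∀ m, m < k → b m * ∑ i ∈ Finset.range (m + 1), x i ≤
      ∑ i ∈ Finset.range (m + 1), b i * x i := by
    intro m
    induction m with
    | zero => intro _; simp
    | succ m ih =>
      intro hm
      have h1 := ih (Nat.lt_of_succ_lt hm)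
      have h2 : b (m + 1) * ∑ i ∈ Finset.range (m + 1), x i ≤
          b m * ∑ i ∈ Finset.range (m + 1), x i :=
        mul_le_mul_of_nonneg_right (hb _ _ (Nat.le_succ m) hm) (hx _ hm.le)
      rw [Finset.sum_range_succ, Finset.sum_range_succ _ (m + 1), mul_add]
      linarith
  rcases Nat.eq_zero_or_pos k with rfl | hk
  · simp
  · obtain ⟨m, rfl⟩ := Nat.exists_eq_succ_of_ne_zero hk.ne'
    exact (mul_nonneg (hb0 m (Nat.lt_succ_self m)) (hx _ le_rfl)).trans
      (key m (Nat.lt_succ_self m))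

/-- The weighted Ky Fan inequality. -/
theorem sum_mul_val_le {k : ℕ} {β : Fin k → ℝ} (hβ : Antitone β) (hβ0 : ∀ j, 0 ≤ β j)
    {f : Fin k → H} (hf : ∀ j, f j ∈ F.dom) (ho : Orthonormal ℂ f) :
    ∑ j, β j * F.val j ≤ ∑ j, β j * F.q (f j) := by
  set b : ℕ → ℝ := fun i ↦ if h : i < k then β ⟨i, h⟩ else 0 with hb
  set x : ℕ → ℝ := fun i ↦ if h : i < k then F.q (f ⟨i, h⟩) - F.val i else 0 with hx
  have h := sum_mul_nonneg_of_partialSums (b := b) (x := x) (k := k) ?_ ?_ ?_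
  · rw [Finset.sum_range] at h
    simp only [hb, hx, Fin.is_lt, dif_pos, mul_sub, Finset.sum_sub_distrib] at h
    linarith
  · intro i j hij hj
    simp only [hb, hj, hij.trans_lt hj, dif_pos]
    exact hβ hij
  · intro i hi
    simp only [hb, hi, dif_pos]
    exact hβ0 _
  -- The first m members of the frame are themselves an orthonormal m-frame, so the unweighted
  -- inequality applies to every partial sum.
  · intro m hm
    have h1 := sum_val_le_sum_q (F := F) (f := fun j : Fin m ↦ f (Fin.castLE hm j))
      (fun j ↦ hf _) (ho.comp _ (Fin.castLE_injective hm))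
    rw [Fintype.card_fin, Finset.sum_range] at h1
    rw [Finset.sum_range]
    have h2 : ∀ j : Fin m, x j = F.q (f (Fin.castLE hm j)) - F.val j := fun j ↦ by
      simp [hx, j.2.trans_le hm, Fin.castLE]
    simp only [h2, Finset.sum_sub_distrib]
    linarith

/-- The minima depend continuously on the form. -/
theorem abs_val_sub_val_le {F' : CompactForm H} (hdom : F'.dom = F.dom) {δ : ℝ}
    (h : ∀ φ ∈ F.dom, |F'.q φ - F.q φ| ≤ δ * ‖φ‖ ^ 2) (j : ℕ) :
    |F'.val j - F.val j| ≤ (2 * j + 1) * δ := by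
  -- Sums of the lowest minima are variational: the eigenvectors of either form compete for the
  -- other. A single minimum is the difference of the sums for j + 1 and j, whence the constant 2j +
  -- 1.
  have hS : ∀ m, |∑ i ∈ Finset.range m, F'.val i - ∑ i ∈ Finset.range m, F.val i| ≤ m * δ := by
    intro m
    have h1 := sum_val_le_sum_q (F := F) (f := fun i : Fin m ↦ F'.vec i)
      (fun i ↦ hdom ▸ vec_mem i.1) (orthonormal_vec.comp _ Fin.val_injective)
    have h2 := sum_val_le_sum_q (F := F') (f := fun i : Fin m ↦ F.vec i)
      (fun i ↦ hdom ▸ vec_mem i.1) (orthonormal_vec.comp _ Fin.val_injective)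
    have h3 : ∑ i : Fin m, F.q (F'.vec i) ≤ ∑ i : Fin m, (F'.val i + δ) := by
      refine Finset.sum_le_sum fun i _ ↦ ?_
      have h4 := h (F'.vec i) (hdom ▸ vec_mem i.1)
      rw [(vec_spec (F := F') i.1).2.1, one_pow, mul_one] at h4
      have h5 := (abs_le.mp h4).1
      simp only [val]; linarith
    have h6 : ∑ i : Fin m, F'.q (F.vec i) ≤ ∑ i : Fin m, (F.val i + δ) := by
      refine Finset.sum_le_sum fun i _ ↦ ?_
      have h4 := h (F.vec i) (vec_mem i.1)
      rw [(vec_spec (F := F) i.1).2.1, one_pow, mul_one] at h4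
      have h5 := (abs_le.mp h4).2
      simp only [val]; linarith
    simp only [Fintype.card_fin] at h1 h2
    simp only [Finset.sum_add_distrib, Finset.sum_const, Finset.card_univ, Fintype.card_fin,
      nsmul_eq_mul] at h3 h6
    rw [← Finset.sum_range (fun i ↦ F'.val i)] at h3
    rw [← Finset.sum_range (fun i ↦ F.val i)] at h6
    rw [abs_le]
    constructor <;> linarith
  have h1 := abs_le.mp (hS (j + 1))
  have h2 := abs_le.mp (hS j)
  rw [Finset.sum_range_succ, Finset.sum_range_succ] at h1
  push_cast at h1
  rw [abs_le]
  constructor <;> linarith [h1.1, h1.2, h2.1, h2.2]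

variable (F) in
/-- Orthonormal eigenvectors for the `k` lowest eigenvalues, in increasing order. -/
def IsFrame {k : ℕ} (f : Fin k → H) : Prop :=
  Orthonormal ℂ f ∧ ∀ j, F.Maps (f j) ((F.val j : ℂ) • f j)

theorem isFrame_vec (k : ℕ) : F.IsFrame (fun j : Fin k ↦ F.vec j) :=
  ⟨orthonormal_vec.comp _ Fin.val_injective, fun j ↦ maps_vec j⟩

theorem IsFrame.q_eq {k : ℕ} {f : Fin k → H} (h : F.IsFrame f) (j : Fin k) :
    F.q (f j) = F.val j := by
  rw [(h.2 j).q_eq, h.1.1 j, one_pow, mul_one]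

/-- Refines the subsequence one coordinate at a time, so that compactness is needed only for single
vectors. -/
theorem tendsto_subseq_of_fin {X : Type*} [TopologicalSpace X] {k : ℕ} {u : ℕ → Fin k → X}
    (h : ∀ j (σ : ℕ → ℕ), StrictMono σ → ∃ x, ∃ τ : ℕ → ℕ, StrictMono τ ∧
      Tendsto (fun m ↦ u (σ (τ m)) j) atTop (𝓝 x)) :
    ∃ x : Fin k → X, ∃ σ : ℕ → ℕ, StrictMono σ ∧
      ∀ j, Tendsto (fun m ↦ u (σ m) j) atTop (𝓝 (x j)) := by
  classical
  have key : ∀ s : Finset (Fin k), ∃ x : Fin k → X, ∃ σ : ℕ → ℕ, StrictMono σ ∧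
      ∀ j ∈ s, Tendsto (fun m ↦ u (σ m) j) atTop (𝓝 (x j)) := by
    intro s
    induction s using Finset.induction_on with
    | empty => exact ⟨u 0, id, strictMono_id, by simp⟩
    | insert a s ha ih =>
      obtain ⟨x, σ, hσ, hx⟩ := ih
      obtain ⟨y, τ, hτ, hy⟩ := h a σ hσ
      refine ⟨Function.update x a y, σ ∘ τ, hσ.comp hτ, fun j hj ↦ ?_⟩
      rcases Finset.mem_insert.mp hj with rfl | hj
      · simpa using hy
      · rw [Function.update_of_ne (fun hja : j = a ↦ ha (hja ▸ hj))]
        exact (hx j hj).comp hτ.tendsto_atTop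
  obtain ⟨x, σ, hσ, hx⟩ := key Finset.univ
  exact ⟨x, σ, hσ, fun j ↦ hx j (Finset.mem_univ j)⟩

/-- Frames of converging forms accumulate at frames of the limit form. -/
theorem exists_isFrame_of_tendsto {k : ℕ} {F' : ℕ → CompactForm H} (hdom : ∀ t, (F' t).dom = F.dom)
    {δ : ℕ → ℝ} (hδ : Tendsto δ atTop (𝓝 0))
    (h : ∀ t, ∀ φ ∈ F.dom, ∀ ψ ∈ F.dom, ‖(F' t).B φ ψ - F.B φ ψ‖ ≤ δ t * (‖φ‖ * ‖ψ‖))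
    {f : ℕ → Fin k → H} (hf : ∀ t, (F' t).IsFrame (f t)) :
    ∃ g : Fin k → H, F.IsFrame g ∧ ∃ σ : ℕ → ℕ, StrictMono σ ∧
      ∀ j, Tendsto (fun m ↦ f (σ m) j) atTop (𝓝 (g j)) := by
  have hfd : ∀ t j, f t j ∈ F.dom := fun t j ↦ hdom t ▸ ((hf t).2 j).1
  have hq : ∀ t, ∀ φ ∈ F.dom, |(F' t).q φ - F.q φ| ≤ δ t * ‖φ‖ ^ 2 := by
    intro t φ hφ
    have h1 := h t φ hφ φ hφ
    rw [← pow_two] at h1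
    refine le_trans ?_ h1
    rw [q, q, ← Complex.sub_re]
    exact Complex.abs_re_le_norm _
  have hval : ∀ j, Tendsto (fun t ↦ (F' t).val j) atTop (𝓝 (F.val j)) := by
    intro j
    rw [tendsto_iff_norm_sub_tendsto_zero]
    refine squeeze_zero (fun t ↦ norm_nonneg _) (fun t ↦ abs_val_sub_val_le (hdom t) (hq t) j) ?_
    simpa using hδ.const_mul (2 * (j : ℝ) + 1)
  -- The energies with respect to the limit form are bounded, as they exceed the convergent minima
  -- by at most `δ t`; this makes compactness available.
  have hqb : ∀ j, ∃ C, ∀ t, F.q (f t j) ≤ C := by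
    intro j
    have h1 : Tendsto (fun t ↦ (F' t).val j + δ t) atTop (𝓝 (F.val j + 0)) := (hval j).add hδ
    obtain ⟨C, hC⟩ := h1.bddAbove_range
    refine ⟨C, fun t ↦ le_trans ?_ (hC ⟨t, rfl⟩)⟩
    have h2 := (abs_le.mp (hq t (f t j) (hfd t j))).1
    rw [(hf t).1.1 j, (hf t).q_eq j] at h2
    linarith
  choose C hC using hqb
  obtain ⟨g, σ, hσ, hg⟩ := tendsto_subseq_of_fin (u := f) fun j σ hσ ↦ by
    obtain ⟨ψ, τ, hτ, hψ⟩ := F.compact (fun m ↦ f (σ m) j) (max 1 (C j)) (fun m ↦ hfd _ _)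
      (fun m ↦ by rw [(hf _).1.1 j]; exact le_max_left _ _) fun m ↦
        (hC j _).trans (le_max_right _ _)
    exact ⟨ψ, τ, hτ, hψ⟩
  have hgd : ∀ j, g j ∈ F.dom := fun j ↦
    (F.closed _ _ (C j) (fun m ↦ hfd (σ m) j) (hg j) fun m ↦ hC j _).1
  refine ⟨g, ⟨?_, fun j ↦ ?_⟩, σ, hσ, hg⟩
  · rw [orthonormal_iff_ite]
    intro i j
    refine tendsto_nhds_unique ((hg i).inner (hg j)) ?_
    simp only [orthonormal_iff_ite.mp (hf _).1]
    exact tendsto_const_nhds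
  · rw [maps_iff_mem_span]
    refine mem_span_of_inner_eq_zero (hgd j) fun i hi ↦ ?_
    -- The right side is at most `δ t` in norm. In the limit, `g j` is orthogonal to every `vec i`
    -- with `val i ≠ val j`, so completeness makes it an eigenvector without passing to the limit in
    -- the form.
    have h1 : ∀ t, ((F' t).val j - F.val i : ℂ) * inner ℂ (F.vec i) (f t j) =
        (F' t).B (f t j) (F.vec i) - F.B (f t j) (F.vec i) := by
      intro t
      have hv : F.vec i ∈ (F' t).dom := (hdom t).symm ▸ vec_mem i
      rw [((hf t).2 j).2 _ hv, inner_smul_right, ← F.conj_symm _ (vec_mem i) _ (hfd t j),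
        B_vec i _ (hfd t j), map_mul, inner_conj_symm, Complex.conj_ofReal]
      ring
    have h2 : Tendsto (fun m ↦ ((F' (σ m)).val j - F.val i : ℂ) *
        inner ℂ (F.vec i) (f (σ m) j)) atTop (𝓝 ((F.val j - F.val i : ℂ) *
          inner ℂ (F.vec i) (g j))) := by
      refine Tendsto.mul (Tendsto.sub ?_ tendsto_const_nhds) (tendsto_const_nhds.inner (hg j))
      exact (Complex.continuous_ofReal.tendsto _).comp ((hval j).comp hσ.tendsto_atTop)
    have h3 : Tendsto (fun m ↦ ((F' (σ m)).val j - F.val i : ℂ) *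
        inner ℂ (F.vec i) (f (σ m) j)) atTop (𝓝 0) := by
      rw [tendsto_zero_iff_norm_tendsto_zero]
      refine squeeze_zero (fun m ↦ norm_nonneg _) (fun m ↦ ?_) (hδ.comp hσ.tendsto_atTop)
      rw [h1]
      refine (h _ _ (hfd _ j) _ (vec_mem i)).trans ?_
      rw [(hf _).1.1 j, (vec_spec i).2.1]
      simp
    refine (mul_eq_zero.mp (tendsto_nhds_unique h2 h3)).resolve_left ?_
    rw [← Complex.ofReal_sub, Complex.ofReal_eq_zero, sub_eq_zero]
    exact fun h ↦ hi h.symm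

end CompactForm

end AbstractSpectrum

/-! ### The Schrödinger form: domain, continuity in V, lower semicontinuity -/

section ConcreteForm

variable {n : ℕ} {W : Rn n → ℝ}

theorem IsConfining.aestronglyMeasurable (hW : IsConfining W) : AEStronglyMeasurable W volume := by
  have h : AEStronglyMeasurable W (volume.restrict (⋃ k : ℕ, Metric.closedBall (0 : Rn n) k)) :=
    aestronglyMeasurable_iUnion_iff.mpr fun k ↦
      (hW.locallyBounded _ (isCompact_closedBall _ _)).aestronglyMeasurable
  rwa [Metric.iUnion_closedBall_nat, Measure.restrict_univ] at h

variable (W) in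
/-- The potential energy `∫ W|φ|²`. -/
def potential (φ : L2 n) : ℝ≥0∞ := ∫⁻ x, ENNReal.ofReal (W x) * ‖φ x‖ₑ ^ 2

theorem ofReal_mul_norm_sq {w : ℝ} (hw : 0 ≤ w) (z : ℂ) :
    ENNReal.ofReal (w * ‖z‖ ^ 2) = ENNReal.ofReal w * ‖z‖ₑ ^ 2 := by
  rw [ENNReal.ofReal_mul hw, ENNReal.ofReal_pow (norm_nonneg _), ofReal_norm]

theorem IsConfining.aestronglyMeasurable_mul (hW : IsConfining W) (φ : L2 n) :
    AEStronglyMeasurable (fun x ↦ W x * ‖φ x‖ ^ 2) volume :=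
  hW.aestronglyMeasurable.mul ((Lp.aestronglyMeasurable φ).norm.pow 2)

theorem IsConfining.integrable_iff (hW : IsConfining W) (φ : L2 n) :
    Integrable (fun x ↦ W x * ‖φ x‖ ^ 2) ↔ potential W φ ≠ ∞ := by
  rw [Integrable, and_iff_right (hW.aestronglyMeasurable_mul φ),
    hasFiniteIntegral_iff_ofReal (ae_of_all _ fun x ↦ mul_nonneg (hW.nonneg x) (by positivity)),
    ← lt_top_iff_ne_top, potential]
  simp only [ofReal_mul_norm_sq (hW.nonneg _)]

theorem IsConfining.integral_eq (hW : IsConfining W) (φ : L2 n) :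
    ∫ x, W x * ‖φ x‖ ^ 2 = (potential W φ).toReal := by
  rw [integral_eq_lintegral_of_nonneg_ae
    (ae_of_all _ fun x ↦ mul_nonneg (hW.nonneg x) (by positivity)) (hW.aestronglyMeasurable_mul φ)]
  simp only [ofReal_mul_norm_sq (hW.nonneg _)]
  rfl

variable (W) in
/-- The energy `∫ |∇φ|² + W|φ|²`, infinite outside of the form domain. -/
def freeEnergy (φ : L2 n) : ℝ≥0∞ := kinetic φ + potential W φ

/-- With extended-valued energies, membership becomes finiteness, so that estimates by Fatou's lemma
yield membership for limits. -/
theorem IsConfining.mem_formDomain_iff (hW : IsConfining W) {φ : L2 n} :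
    φ ∈ formDomain W ↔ freeEnergy W φ ≠ ∞ := by
  rw [formDomain, mem_ofPred_eq, exists_weakPartial_iff, hW.integrable_iff, freeEnergy,
    ENNReal.add_ne_top]

theorem TestFn.exists_bound (V : TestFn n) : ∃ M, 0 ≤ M ∧ ∀ x, |V x| ≤ M := by
  obtain ⟨C, hC⟩ := V.hasCompactSupport.exists_bound_of_continuous V.continuous
  exact ⟨C, (norm_nonneg _).trans (hC 0), hC⟩

theorem integrable_testFn_mul_norm_sq (V : TestFn n) (φ : L2 n) :
    Integrable (fun x ↦ V x * ‖φ x‖ ^ 2) := by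
  obtain ⟨M, -, hM⟩ := V.exists_bound
  exact (integrable_norm_sq φ).bdd_mul V.aestronglyMeasurable (ae_of_all _ hM)

theorem abs_integral_testFn_le {V : TestFn n} {M : ℝ} (hM : ∀ x, |V x| ≤ M) (φ : L2 n) :
    |∫ x, V x * ‖φ x‖ ^ 2| ≤ M * ‖φ‖ ^ 2 := by
  rw [norm_sq_eq_integral, ← integral_const_mul]
  refine (norm_integral_le_integral_norm (fun x ↦ V x * ‖φ x‖ ^ 2)).trans ?_
  refine integral_mono (integrable_testFn_mul_norm_sq V φ).norm
    ((integrable_norm_sq φ).const_mul M) fun x ↦ ?_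
  simp only [norm_mul, Real.norm_eq_abs, abs_pow, abs_norm]
  gcongr
  exact hM x

theorem IsConfining.energy_eq (hW : IsConfining W) (a : ℝ) (V : TestFn n) {φ : L2 n}
    (hφ : φ ∈ formDomain W) :
    energy W a V φ = (freeEnergy W φ).toReal - a * ∫ x, V x * ‖φ x‖ ^ 2 := by
  have h := hW.mem_formDomain_iff.mp hφ
  rw [freeEnergy, ENNReal.add_ne_top] at h
  rw [energy, sum_norm_weakPartial_sq h.1, freeEnergy, ENNReal.toReal_add h.1 h.2,
    ← hW.integral_eq, add_sub_assoc, ← integral_const_mul, ← integral_sub hφ.2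
      ((integrable_testFn_mul_norm_sq V φ).const_mul a)]
  congr 2
  ext x
  ring

theorem IsWeakPartial.add {i : Fin n} {φ ψ g h : L2 n} (hg : IsWeakPartial i φ g)
    (hh : IsWeakPartial i ψ h) : IsWeakPartial i (φ + ψ) (g + h) := by
  simp only [IsWeakPartial, ← Lp.toTemperedDistributionCLM_apply, map_add,
    LineDeriv.lineDerivOp_add] at *
  rw [hg, hh]

theorem IsWeakPartial.smul {i : Fin n} (c : ℂ) {φ g : L2 n} (hg : IsWeakPartial i φ g) :
    IsWeakPartial i (c • φ) (c • g) := by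
  simp only [IsWeakPartial, ← Lp.toTemperedDistributionCLM_apply, map_smul,
    LineDeriv.lineDerivOp_smul] at *
  rw [hg]

theorem weakPartial_eq {i : Fin n} {φ g : L2 n} (h : IsWeakPartial i φ g) :
    weakPartial i φ = g :=
  (isWeakPartial_weakPartial ⟨g, h⟩).unique h

theorem isWeakPartial_of_mem {φ : L2 n} (h : φ ∈ formDomain W) (i : Fin n) :
    IsWeakPartial i φ (weakPartial i φ) :=
  isWeakPartial_weakPartial (h.1 i)

theorem norm_add_sq_le_two (z w : ℂ) : ‖z + w‖ ^ 2 ≤ 2 * (‖z‖ ^ 2 + ‖w‖ ^ 2) := by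
  have h := pow_le_pow_left₀ (norm_nonneg _) (norm_add_le z w) 2
  nlinarith [sq_nonneg (‖z‖ - ‖w‖)]

/-- The form domain as a subspace. -/
def IsConfining.formSubmodule (hW : IsConfining W) : Submodule ℂ (L2 n) where
  carrier := formDomain W
  zero_mem' := by
    refine ⟨fun i ↦ ⟨0, ?_⟩, ?_⟩
    · simp only [IsWeakPartial, ← Lp.toTemperedDistributionCLM_apply, map_zero,
        LineDeriv.lineDerivOp_zero]
    · refine (integrable_zero (Rn n) ℝ volume).congr ?_
      filter_upwards [Lp.coeFn_zero ℂ 2 (volume : Measure (Rn n))] with x hx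
      rw [hx]; simp
  add_mem' := by
    intro φ ψ hφ hψ
    refine ⟨fun i ↦ ⟨_, (isWeakPartial_of_mem hφ i).add (isWeakPartial_of_mem hψ i)⟩, ?_⟩
    refine ((hφ.2.add hψ.2).const_mul 2).mono' (hW.aestronglyMeasurable_mul _) ?_
    filter_upwards [Lp.coeFn_add φ ψ] with x hx
    rw [hx, Real.norm_of_nonneg (mul_nonneg (hW.nonneg x) (by positivity)), Pi.add_apply]
    have := mul_le_mul_of_nonneg_left (norm_add_sq_le_two (φ x) (ψ x)) (hW.nonneg x)
    simp only [Pi.add_apply]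
    linarith
  smul_mem' := by
    intro c φ hφ
    refine ⟨fun i ↦ ⟨_, (isWeakPartial_of_mem hφ i).smul c⟩, ?_⟩
    refine (hφ.2.const_mul (‖c‖ ^ 2)).congr ?_
    filter_upwards [Lp.coeFn_smul c φ] with x hx
    rw [hx, Pi.smul_apply, norm_smul]
    ring

theorem IsConfining.integrable_form (hW : IsConfining W) (a : ℝ) (V : TestFn n) {φ ψ : L2 n}
    (hφ : φ ∈ formDomain W) (hψ : ψ ∈ formDomain W) :
    Integrable (fun x ↦ ((W x - a * V x : ℝ) : ℂ) * φ x * (starRingEnd ℂ) (ψ x)) := by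
  obtain ⟨M, hM0, hM⟩ := V.exists_bound
  have hm : AEStronglyMeasurable
      (fun x ↦ ((W x - a * V x : ℝ) : ℂ) * φ x * (starRingEnd ℂ) (ψ x)) volume := by
    refine ((Complex.continuous_ofReal.comp_aestronglyMeasurable
      (hW.aestronglyMeasurable.sub (V.aestronglyMeasurable.const_mul a))).mul
      (Lp.aestronglyMeasurable φ)).mul
      (Complex.continuous_conj.comp_aestronglyMeasurable (Lp.aestronglyMeasurable ψ))
  refine ((hφ.2.add hψ.2).add (((integrable_norm_sq φ).add (integrable_norm_sq ψ)).const_mul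
    (|a| * M))).mono' hm (ae_of_all _ fun x ↦ ?_)
  rw [norm_mul, norm_mul, Complex.norm_real, RCLike.norm_conj, Real.norm_eq_abs]
  simp only [Pi.add_apply]
  have h1 : |W x - a * V x| ≤ W x + |a| * M := by
    refine (abs_sub _ _).trans ?_
    rw [abs_of_nonneg (hW.nonneg x), abs_mul]
    gcongr
    exact hM x
  have h2 : ‖φ x‖ * ‖ψ x‖ ≤ ‖φ x‖ ^ 2 + ‖ψ x‖ ^ 2 := by
    nlinarith [sq_nonneg (‖φ x‖ - ‖ψ x‖), sq_nonneg ‖φ x‖, sq_nonneg ‖ψ x‖]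
  have h3 : 0 ≤ W x + |a| * M := add_nonneg (hW.nonneg x) (by positivity)
  calc _ = |W x - a * V x| * (‖φ x‖ * ‖ψ x‖) := by ring
    _ ≤ (W x + |a| * M) * (‖φ x‖ ^ 2 + ‖ψ x‖ ^ 2) := by gcongr
    _ = _ := by ring

theorem IsConfining.form_add_left (hW : IsConfining W) (a : ℝ) (V : TestFn n) {φ φ' ψ : L2 n}
    (hφ : φ ∈ formDomain W) (hφ' : φ' ∈ formDomain W) (hψ : ψ ∈ formDomain W) :
    form W a V (φ + φ') ψ = form W a V φ ψ + form W a V φ' ψ := by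
  simp only [form]
  have h1 : ∀ i, weakPartial i (φ + φ') = weakPartial i φ + weakPartial i φ' := fun i ↦
    weakPartial_eq ((isWeakPartial_of_mem hφ i).add (isWeakPartial_of_mem hφ' i))
  simp only [h1, inner_add_right, Finset.sum_add_distrib]
  have h2 : ∫ x, ((W x - a * V x : ℝ) : ℂ) * (φ + φ' : L2 n) x * (starRingEnd ℂ) (ψ x) =
      (∫ x, ((W x - a * V x : ℝ) : ℂ) * φ x * (starRingEnd ℂ) (ψ x)) +
        ∫ x, ((W x - a * V x : ℝ) : ℂ) * φ' x * (starRingEnd ℂ) (ψ x) := by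
    rw [← integral_add (hW.integrable_form a V hφ hψ) (hW.integrable_form a V hφ' hψ)]
    refine integral_congr_ae ?_
    filter_upwards [Lp.coeFn_add φ φ'] with x hx
    rw [hx, Pi.add_apply]
    ring
  rw [h2]
  ring

theorem IsConfining.form_smul_left (a : ℝ) (V : TestFn n) (c : ℂ) {φ ψ : L2 n}
    (hφ : φ ∈ formDomain W) : form W a V (c • φ) ψ = c * form W a V φ ψ := by
  simp only [form]
  have h1 : ∀ i, weakPartial i (c • φ) = c • weakPartial i φ := fun i ↦
    weakPartial_eq ((isWeakPartial_of_mem hφ i).smul c)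
  simp only [h1, inner_smul_right, ← Finset.mul_sum]
  rw [mul_add, ← integral_const_mul]
  congr 1
  refine integral_congr_ae ?_
  filter_upwards [Lp.coeFn_smul c φ] with x hx
  rw [hx, Pi.smul_apply, smul_eq_mul]
  ring

theorem form_conj_symm (a : ℝ) (V : TestFn n) (φ ψ : L2 n) :
    (starRingEnd ℂ) (form W a V φ ψ) = form W a V ψ φ := by
  simp only [form, map_add, map_sum, inner_conj_symm]
  rw [← integral_conj]
  congr 2
  ext x
  simp only [map_mul, Complex.conj_conj, Complex.conj_ofReal]
  ring

theorem re_form_self (a : ℝ) (V : TestFn n) (φ : L2 n) :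
    (form W a V φ φ).re = energy W a V φ := by
  have : form W a V φ φ = ((energy W a V φ : ℝ) : ℂ) := by
    simp only [form, energy]
    push_cast
    congr 1
    · refine Finset.sum_congr rfl fun i _ ↦ ?_
      rw [inner_self_eq_norm_sq_to_K]; rfl
    · rw [← integral_complex_ofReal]
      congr 1
      ext x
      rw [mul_assoc, Complex.mul_conj']
      push_cast
      ring
  rw [this, Complex.ofReal_re]

theorem integral_norm_mul_norm_le (φ ψ : L2 n) : ∫ x, ‖φ x‖ * ‖ψ x‖ ≤ ‖φ‖ * ‖ψ‖ := by
  have h := integral_mul_le_Lp_mul_Lq_of_nonneg (μ := (volume : Measure (Rn n)))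
    Real.HolderConjugate.two_two (f := fun x ↦ ‖φ x‖) (g := fun x ↦ ‖ψ x‖)
    (ae_of_all _ fun x ↦ norm_nonneg _) (ae_of_all _ fun x ↦ norm_nonneg _)
    (by simpa using (Lp.memLp φ).norm) (by simpa using (Lp.memLp ψ).norm)
  simp only [Real.rpow_two] at h
  rw [← norm_sq_eq_integral, ← norm_sq_eq_integral, ← Real.sqrt_eq_rpow,
    ← Real.sqrt_eq_rpow, Real.sqrt_sq (norm_nonneg _), Real.sqrt_sq (norm_nonneg _)] at h
  exact h

theorem integrable_norm_mul_norm (φ ψ : L2 n) : Integrable (fun x ↦ ‖φ x‖ * ‖ψ x‖) :=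
  (Lp.memLp φ).norm.integrable_mul (Lp.memLp ψ).norm

theorem abs_integral_testFn_sub_le {V : TestFn n} {M : ℝ} (hM : ∀ x, |V x| ≤ M) (φ ψ : L2 n) :
    |(∫ x, V x * ‖φ x‖ ^ 2) - ∫ x, V x * ‖ψ x‖ ^ 2| ≤ M * (‖φ - ψ‖ * (‖φ‖ + ‖ψ‖)) := by
  have h0 : 0 ≤ M := (abs_nonneg _).trans (hM 0)
  rw [← integral_sub (integrable_testFn_mul_norm_sq V φ) (integrable_testFn_mul_norm_sq V ψ)]
  calc _ ≤ ∫ x, M * (‖(φ - ψ : L2 n) x‖ * ‖φ x‖ + ‖(φ - ψ : L2 n) x‖ * ‖ψ x‖) := by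
        rw [← Real.norm_eq_abs]
        refine norm_integral_le_of_norm_le (((integrable_norm_mul_norm _ _).add
          (integrable_norm_mul_norm _ _)).const_mul M) ?_
        filter_upwards [Lp.coeFn_sub φ ψ] with x hx
        rw [hx, Pi.sub_apply, Real.norm_eq_abs, ← mul_sub, abs_mul, ← mul_add, sq_sub_sq, abs_mul,
          mul_comm |_ + _|, abs_of_nonneg (by positivity : 0 ≤ ‖φ x‖ + ‖ψ x‖)]
        gcongr
        · exact hM x
        · exact abs_norm_sub_norm_le _ _
    _ = M * ((∫ x, ‖(φ - ψ : L2 n) x‖ * ‖φ x‖) + ∫ x, ‖(φ - ψ : L2 n) x‖ * ‖ψ x‖) := by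
        rw [integral_const_mul, integral_add (integrable_norm_mul_norm _ _)
          (integrable_norm_mul_norm _ _)]
    _ ≤ M * (‖φ - ψ‖ * ‖φ‖ + ‖φ - ψ‖ * ‖ψ‖) := by
        gcongr <;> exact integral_norm_mul_norm_le _ _
    _ = _ := by ring

theorem tendsto_integral_testFn (V : TestFn n) {φ : ℕ → L2 n} {ψ : L2 n}
    (h : Tendsto φ atTop (𝓝 ψ)) :
    Tendsto (fun m ↦ ∫ x, V x * ‖φ m x‖ ^ 2) atTop (𝓝 (∫ x, V x * ‖ψ x‖ ^ 2)) := by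
  obtain ⟨M, -, hM⟩ := V.exists_bound
  rw [tendsto_iff_norm_sub_tendsto_zero]
  refine squeeze_zero (fun m ↦ norm_nonneg _) (fun m ↦ abs_integral_testFn_sub_le hM _ _) ?_
  have h1 := tendsto_iff_norm_sub_tendsto_zero.mp h
  simpa using (h1.mul (h.norm.add_const ‖ψ‖)).const_mul M

/-- The gradient and W cancel in the difference, and the rest is Cauchy-Schwarz. Eigenframes depend
on V only through this bound. -/
theorem IsConfining.norm_form_sub_le (hW : IsConfining W) (a : ℝ) {V V' : TestFn n} {M : ℝ}
    (hM : ∀ x, |V' x - V x| ≤ M) {φ ψ : L2 n}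
    (hφ : φ ∈ formDomain W) (hψ : ψ ∈ formDomain W) :
    ‖form W a V' φ ψ - form W a V φ ψ‖ ≤ |a| * M * (‖φ‖ * ‖ψ‖) := by
  simp only [form]
  rw [add_sub_add_left_eq_sub, ← integral_sub (hW.integrable_form a V' hφ hψ)
    (hW.integrable_form a V hφ hψ)]
  have h0 : 0 ≤ M := (abs_nonneg _).trans (hM 0)
  calc _ ≤ ∫ x, |a| * M * (‖φ x‖ * ‖ψ x‖) := by
        refine norm_integral_le_of_norm_le ((integrable_norm_mul_norm φ ψ).const_mul _) (ae_of_all _ fun x ↦ ?_)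
        have : ((W x - a * V' x : ℝ) : ℂ) * φ x * (starRingEnd ℂ) (ψ x) -
            ((W x - a * V x : ℝ) : ℂ) * φ x * (starRingEnd ℂ) (ψ x) =
            ((-a * (V' x - V x) : ℝ) : ℂ) * (φ x * (starRingEnd ℂ) (ψ x)) := by
          push_cast; ring
        rw [this, norm_mul, norm_mul, Complex.norm_real, RCLike.norm_conj, Real.norm_eq_abs,
          abs_mul, abs_neg]
        gcongr
        exact hM x
    _ = |a| * M * ∫ x, ‖φ x‖ * ‖ψ x‖ := integral_const_mul _ _
    _ ≤ |a| * M * (‖φ‖ * ‖ψ‖) := by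
        gcongr
        exact integral_norm_mul_norm_le φ ψ

theorem exists_subseq_tendsto_ae {φ : ℕ → L2 n} {ψ : L2 n} (h : Tendsto φ atTop (𝓝 ψ)) :
    ∃ σ : ℕ → ℕ, StrictMono σ ∧
      ∀ᵐ x, Tendsto (fun m ↦ φ (σ m) x) atTop (𝓝 (ψ x)) :=
  (tendstoInMeasure_of_tendsto_Lp h).exists_seq_tendsto_ae

/-- Fatou's lemma with a weight, used in x for the potential and in ξ for the kinetic energy. -/
theorem lintegral_weight_le_liminf {w : Rn n → ℝ≥0∞} (hw : AEMeasurable w)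
    (hw' : ∀ x, w x ≠ ∞) {φ : ℕ → L2 n} {ψ : L2 n}
    (h : ∀ᵐ x, Tendsto (fun m ↦ φ m x) atTop (𝓝 (ψ x))) :
    ∫⁻ x, w x * ‖ψ x‖ₑ ^ 2 ≤ liminf (fun m ↦ ∫⁻ x, w x * ‖φ m x‖ₑ ^ 2) atTop := by
  refine le_trans (le_of_eq ?_) (lintegral_liminf_le' fun m ↦
    hw.mul ((Lp.aestronglyMeasurable (φ m)).enorm.pow_const 2))
  refine lintegral_congr_ae ?_
  filter_upwards [h] with x hx
  refine (Tendsto.liminf_eq ?_).symm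
  exact ENNReal.Tendsto.const_mul (((ENNReal.continuous_pow 2).tendsto _).comp hx.enorm)
    (Or.inr (hw' x))

theorem kinetic_eq_lintegral (φ : L2 n) :
    kinetic φ = ∫⁻ ξ, (∑ i, ‖derivSymbol (EuclideanSpace.single i (1 : ℝ)) ξ‖ₑ ^ 2) *
      ‖((𝓕 φ : L2 n) : Rn n → ℂ) ξ‖ₑ ^ 2 := by
  simp only [Finset.sum_mul]
  rw [lintegral_finsetSum' _ fun i _ ↦
    aemeasurable_mul_fourier_enorm_sq (continuous_derivSymbol _) φ]
  rfl

theorem ennreal_liminf_add_le (u v : ℕ → ℝ≥0∞) :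
    liminf u atTop + liminf v atTop ≤ liminf (fun m ↦ u m + v m) atTop := by
  simp only [liminf_eq_iSup_iInf_of_nat]
  rw [ENNReal.iSup_add_iSup_of_monotone
    (fun i j hij ↦ le_iInf₂ fun m hm ↦ iInf₂_le m (hij.trans hm))
    (fun i j hij ↦ le_iInf₂ fun m hm ↦ iInf₂_le m (hij.trans hm))]
  exact iSup_mono fun i ↦ le_iInf₂ fun m hm ↦ add_le_add (iInf₂_le m hm) (iInf₂_le m hm)

/-- The free energy is lower semicontinuous. -/
theorem IsConfining.freeEnergy_le_of_tendsto (hW : IsConfining W) {φ : ℕ → L2 n} {ψ : L2 n}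
    (h : Tendsto φ atTop (𝓝 ψ)) {C : ℝ≥0∞} (hC : ∀ m, freeEnergy W (φ m) ≤ C) :
    freeEnergy W ψ ≤ C := by
  -- Two extractions: the potential needs a.e. convergence of the functions, the kinetic energy that
  -- of their Fourier transforms.
  obtain ⟨σ, hσ, h1⟩ := exists_subseq_tendsto_ae h
  have hF : Tendsto (fun m ↦ (𝓕 (φ (σ m)) : L2 n)) atTop (𝓝 (𝓕 ψ)) :=
    ((Lp.fourierTransformₗᵢ (Rn n) ℂ).continuous.tendsto ψ).comp (h.comp hσ.tendsto_atTop)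
  obtain ⟨τ, hτ, h2⟩ := exists_subseq_tendsto_ae hF
  have hk : kinetic ψ ≤ liminf (fun m ↦ kinetic (φ (σ (τ m)))) atTop := by
    simp only [kinetic_eq_lintegral]
    refine lintegral_weight_le_liminf ?_ (fun x ↦ by simp) h2
    refine (Finset.measurable_fun_sum _ fun i _ ↦ ?_).aemeasurable
    exact (continuous_derivSymbol _).enorm.measurable.pow_const 2
  have hp : potential W ψ ≤ liminf (fun m ↦ potential W (φ (σ (τ m)))) atTop := by
    refine lintegral_weight_le_liminf hW.aestronglyMeasurable.aemeasurable.ennreal_ofReal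
      (fun x ↦ by simp) ?_
    filter_upwards [h1] with x hx
    exact hx.comp hτ.tendsto_atTop
  calc freeEnergy W ψ ≤ _ := add_le_add hk hp
    _ ≤ liminf (fun m ↦ freeEnergy W (φ (σ (τ m)))) atTop :=
        ennreal_liminf_add_le _ _
    _ ≤ liminf (fun _ : ℕ ↦ C) atTop := liminf_le_liminf (Eventually.of_forall fun m ↦ hC _)
    _ = C := by simp

theorem kinetic_le_of_tendsto {φ : ℕ → L2 n} {ψ : L2 n}
    (h : Tendsto φ atTop (𝓝 ψ)) {C : ℝ≥0∞} (hC : ∀ m, kinetic (φ m) ≤ C) :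
    kinetic ψ ≤ C := by
  have hF : Tendsto (fun m ↦ (𝓕 (φ m) : L2 n)) atTop (𝓝 (𝓕 ψ)) :=
    ((Lp.fourierTransformₗᵢ (Rn n) ℂ).continuous.tendsto ψ).comp h
  obtain ⟨τ, hτ, h2⟩ := exists_subseq_tendsto_ae hF
  have hk : kinetic ψ ≤ liminf (fun m ↦ kinetic (φ (τ m))) atTop := by
    simp only [kinetic_eq_lintegral]
    refine lintegral_weight_le_liminf ?_ (fun x ↦ by simp) h2
    refine (Finset.measurable_fun_sum _ fun i _ ↦ ?_).aemeasurable
    exact (continuous_derivSymbol _).enorm.measurable.pow_const 2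
  calc kinetic ψ ≤ _ := hk
    _ ≤ liminf (fun _ : ℕ ↦ C) atTop := liminf_le_liminf (Eventually.of_forall fun m ↦ hC _)
    _ = C := by simp

end ConcreteForm

/-! ### Compactness of energy sublevel sets in L² -/

section Compactness

variable {n : ℕ} {W : Rn n → ℝ}

theorem measurable_coeFn (φ : L2 n) : Measurable (φ : Rn n → ℂ) :=
  (Lp.stronglyMeasurable φ).measurable

/-- z minus the average is the average of z - φ, to which Cauchy-Schwarz applies. -/
theorem enorm_sub_average_sq_le (φ : L2 n) (y : Rn n) {δ : ℝ} (hδ : 0 < δ) (z : ℂ) :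
    ‖z - ((volume (Metric.ball y δ)).toReal⁻¹ : ℂ) * ∫ x in Metric.ball y δ, φ x‖ₑ ^ 2 ≤
      (volume (Metric.ball y δ))⁻¹ * ∫⁻ x in Metric.ball y δ, ‖z - φ x‖ₑ ^ 2 := by
  set B := Metric.ball y δ
  have hB0 : volume B ≠ 0 := (Metric.measure_ball_pos _ _ hδ).ne'
  have hBt : volume B ≠ ∞ := measure_ball_lt_top.ne
  have hreal : (volume B).toReal ≠ 0 := ENNReal.toReal_ne_zero.mpr ⟨hB0, hBt⟩
  have hint : IntegrableOn φ B := integrableOn_Lp_of_measure_ne_top φ (by norm_num) hBt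
  have hc : IntegrableOn (fun _ : Rn n ↦ z) B := integrableOn_const hBt
  have h1 : z - ((volume B).toReal⁻¹ : ℂ) * ∫ x in B, φ x =
      ((volume B).toReal⁻¹ : ℂ) * ∫ x in B, (z - φ x) := by
    rw [integral_sub hc hint, setIntegral_const, mul_sub, Measure.real]
    simp only [Complex.real_smul]
    rw [inv_mul_cancel_left₀ (by exact_mod_cast hreal)]
  have h2 : ‖((volume B).toReal⁻¹ : ℂ)‖ₑ = (volume B)⁻¹ := by
    rw [← Complex.ofReal_inv, ← ofReal_norm, Complex.norm_real,
      Real.norm_of_nonneg (by positivity), ENNReal.ofReal_inv_of_pos (by positivity),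
      ENNReal.ofReal_toReal hBt]
  have h3 : (∫⁻ x in B, ‖z - φ x‖ₑ) ^ 2 ≤ volume B * ∫⁻ x in B, ‖z - φ x‖ₑ ^ 2 := by
    have hm : AEMeasurable (fun x ↦ ‖z - φ x‖ₑ) (volume.restrict B) :=
      ((measurable_coeFn φ).const_sub z).enorm.aemeasurable
    have h := ENNReal.lintegral_mul_le_Lp_mul_Lq (volume.restrict B) Real.HolderConjugate.two_two
      (aemeasurable_const (b := (1 : ℝ≥0∞))) hm
    simp only [Pi.mul_apply, one_mul, lintegral_const, Measure.restrict_apply_univ,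
      ENNReal.rpow_two, one_pow] at h
    calc _ ≤ (volume B ^ (1 / (2 : ℝ)) * (∫⁻ x in B, ‖z - φ x‖ₑ ^ 2) ^ (1 / (2 : ℝ))) ^ 2 := by
          gcongr
      _ = _ := by
          rw [mul_pow, ← ENNReal.rpow_natCast, ← ENNReal.rpow_natCast, ← ENNReal.rpow_mul,
            ← ENNReal.rpow_mul]
          simp
  calc _ = (volume B)⁻¹ ^ 2 * ‖∫ x in B, (z - φ x)‖ₑ ^ 2 := by
        rw [h1, enorm_mul, mul_pow, h2]
    _ ≤ (volume B)⁻¹ ^ 2 * (volume B * ∫⁻ x in B, ‖z - φ x‖ₑ ^ 2) := by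
        gcongr
        refine le_trans ?_ h3
        gcongr
        exact enorm_integral_le_lintegral_enorm _
    _ = _ := by
        rw [← mul_assoc, pow_two, mul_assoc (volume B)⁻¹, ENNReal.inv_mul_cancel hB0 hBt, mul_one]

/-- Tonelli's theorem turns the inner integral into the squared L² distance of φ to its translate by
z, with |z| < r. -/
theorem lintegral_translate_average_le (φ : L2 n) {r : ℝ} :
    ∫⁻ x, ∫⁻ z in Metric.ball (0 : Rn n) r, ‖φ x - φ (x + z)‖ₑ ^ 2 ≤
      volume (Metric.ball (0 : Rn n) r) * (ENNReal.ofReal r ^ 2 * kinetic φ) := by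
  have hm : Measurable (fun p : Rn n × Rn n ↦ ‖φ p.1 - φ (p.1 + p.2)‖ₑ ^ 2) :=
    (((measurable_coeFn φ).comp measurable_fst).sub
      ((measurable_coeFn φ).comp (measurable_fst.add measurable_snd))).enorm.pow_const 2
  rw [lintegral_lintegral_swap hm.aemeasurable]
  calc _ ≤ ∫⁻ z in Metric.ball (0 : Rn n) r, ENNReal.ofReal r ^ 2 * kinetic φ := by
        refine setLIntegral_mono' measurableSet_ball fun z hz ↦ ?_
        have h1 : ∫⁻ x, ‖φ x - φ (x + z)‖ₑ ^ 2 = ‖translate z φ - φ‖ₑ ^ 2 := by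
          rw [enorm_sq_eq_lintegral]
          refine lintegral_congr_ae ?_
          filter_upwards [Lp.coeFn_sub (translate z φ) φ, coeFn_translate z φ] with x h1 h2
          rw [h1, Pi.sub_apply, h2, ← enorm_neg, neg_sub]
        rw [h1]
        refine (enorm_translate_sub_sq_le_kinetic z φ).trans ?_
        gcongr
        rw [← ofReal_norm]
        exact ENNReal.ofReal_le_ofReal (mem_ball_zero_iff.mp hz).le
    _ = _ := by rw [setLIntegral_const, mul_comm]

/-- Approximation by step functions on a ball. -/
theorem exists_finiteRank_approx (R : ℝ) {δ : ℝ} (hδ : 0 < δ) :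
    ∃ (N : ℕ) (S : (Fin N → ℂ) →L[ℂ] L2 n) (T : L2 n →L[ℂ] (Fin N → ℂ)), ∀ φ : L2 n,
      ‖φ - S (T φ)‖ₑ ^ 2 ≤ (∫⁻ x in (Metric.closedBall 0 R)ᶜ, ‖φ x‖ₑ ^ 2) +
        ENNReal.ofReal (2 ^ n) * (ENNReal.ofReal (2 * δ) ^ 2 * kinetic φ) := by
  obtain ⟨t, -, htf, hcov⟩ := (isCompact_closedBall (0 : Rn n) R).finite_cover_balls hδ
  obtain ⟨N, y, -, hy⟩ := htf.fin_param
  set K := Metric.closedBall (0 : Rn n) R with hK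
  set b : Fin N → Set (Rn n) := fun j ↦ Metric.ball (y j) δ with hb
  -- Disjoint pieces make a single term of the step function active at each point of K. The averages
  -- in `T` are still over the full balls `b j`, whose common volume bounds the error.
  set c : Fin N → Set (Rn n) := fun j ↦ (b j \ ⋃ i < j, b i) ∩ K with hc
  have hbm : ∀ j, MeasurableSet (b j) := fun j ↦ measurableSet_ball
  have hcm : ∀ j, MeasurableSet (c j) := fun j ↦
    ((hbm j).diff (MeasurableSet.iUnion fun i ↦ MeasurableSet.iUnion fun _ ↦ hbm i)).inter
      measurableSet_closedBall
  have hbt : ∀ j, volume (b j) ≠ ∞ := fun j ↦ measure_ball_lt_top.ne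
  have hct : ∀ j, volume (c j) ≠ ∞ := fun j ↦
    ((measure_mono inter_subset_right).trans_lt measure_closedBall_lt_top).ne
  have hex : ∀ x ∈ K, ∃ j, x ∈ c j := by
    intro x hx
    obtain ⟨v, hv, hxv⟩ := mem_iUnion₂.mp (hcov hx)
    have hne : ∃ j, x ∈ b j := by
      rw [← hy] at hv
      obtain ⟨j, rfl⟩ := hv
      exact ⟨j, hxv⟩
    obtain ⟨j, hj, hmin⟩ := WellFounded.has_min (wellFounded_lt (α := Fin N)) {j | x ∈ b j} hne
    refine ⟨j, ⟨hj, ?_⟩, hx⟩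
    simp only [mem_iUnion, not_exists]
    exact fun i hi hxi ↦ hmin i hxi hi
  have huniq : ∀ x i j, x ∈ c i → x ∈ c j → i = j := by
    intro x i j hi hj
    rcases lt_trichotomy i j with h | h | h
    · exact absurd (mem_iUnion₂.mpr ⟨i, h, hi.1.1⟩) hj.1.2
    · exact h
    · exact absurd (mem_iUnion₂.mpr ⟨j, h, hj.1.1⟩) hi.1.2
  let S : (Fin N → ℂ) →L[ℂ] L2 n := ∑ j, (ContinuousLinearMap.proj j).smulRight
    (indicatorConstLp 2 (hcm j) (hct j) (1 : ℂ))
  let T : L2 n →L[ℂ] (Fin N → ℂ) := ContinuousLinearMap.pi fun j ↦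
    ((volume (b j)).toReal⁻¹ : ℂ) • innerSL ℂ (indicatorConstLp 2 (hbm j) (hbt j) (1 : ℂ))
  have hT : ∀ φ j, T φ j = ((volume (b j)).toReal⁻¹ : ℂ) * ∫ x in b j, φ x := by
    intro φ j
    simp only [T, ContinuousLinearMap.coe_pi', smul_apply, innerSL_apply_apply, smul_eq_mul]
    rw [L2.inner_indicatorConstLp_one]
  have hS : ∀ v, S v =ᵐ[volume] fun x ↦ ∑ j, v j * (c j).indicator 1 x := by
    intro v
    have h1 : S v = ∑ j, v j • indicatorConstLp 2 (hcm j) (hct j) (1 : ℂ) := by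
      simp [S]
    rw [h1]
    have h2 : ∀ᵐ x, ∀ j, (v j • indicatorConstLp 2 (hcm j) (hct j) (1 : ℂ) : L2 n) x =
        v j * (c j).indicator 1 x := by
      rw [ae_all_iff]
      intro j
      filter_upwards [Lp.coeFn_smul (v j) (indicatorConstLp 2 (hcm j) (hct j) (1 : ℂ)),
        indicatorConstLp_coeFn (p := 2) (hs := hcm j) (hμs := hct j) (c := (1 : ℂ))] with x h1 h2
      rw [h1, Pi.smul_apply, h2, smul_eq_mul]
      rfl
    filter_upwards [Lp.coeFn_fun_finsetSum Finset.univ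
      (fun j ↦ v j • indicatorConstLp 2 (hcm j) (hct j) (1 : ℂ)), h2] with x h1 h2
    rw [h1]
    exact Finset.sum_congr rfl fun j _ ↦ h2 j
  refine ⟨N, S, T, fun φ ↦ ?_⟩
  set D : Rn n → ℝ≥0∞ := fun x ↦
    ∫⁻ z in Metric.ball (0 : Rn n) (2 * δ), ‖φ x - φ (x + z)‖ₑ ^ 2 with hD
  set vol := volume (Metric.ball (0 : Rn n) δ) with hvol
  have hvb : ∀ j, volume (b j) = vol := fun j ↦ Measure.addHaar_ball_center _ _ _
  have hpt : ∀ᵐ x, ‖(φ - S (T φ) : L2 n) x‖ₑ ^ 2 ≤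
      Kᶜ.indicator (fun x ↦ ‖φ x‖ₑ ^ 2) x + vol⁻¹ * D x := by
    filter_upwards [Lp.coeFn_sub φ (S (T φ)), hS (T φ)] with x h1 h2
    rw [h1, Pi.sub_apply, h2]
    by_cases hx : x ∈ K
    · obtain ⟨j, hj⟩ := hex x hx
      have h3 : ∑ i, T φ i * (c i).indicator 1 x = T φ j := by
        rw [Finset.sum_eq_single j]
        · simp [hj]
        · intro i _ hij
          rw [indicator_of_notMem (fun hi ↦ hij (huniq x i j hi hj)), mul_zero]
        · simp
      rw [h3, hT]
      refine (enorm_sub_average_sq_le φ (y j) hδ (φ x)).trans (le_trans ?_ le_add_self)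
      change (volume (b j))⁻¹ * _ ≤ _
      rw [hvb]
      gcongr
      -- A ball of radius δ containing x lies in the ball of radius 2δ about x. The ratio of their
      -- volumes is the factor 2ⁿ of the statement.
      have h4 : ∫⁻ z in Metric.ball (0 : Rn n) (2 * δ), ‖φ x - φ (x + z)‖ₑ ^ 2 =
          ∫⁻ w in Metric.ball x (2 * δ), ‖φ x - φ w‖ₑ ^ 2 := by
        rw [← lintegral_indicator measurableSet_ball, ← lintegral_indicator measurableSet_ball,
          ← lintegral_add_left_eq_self
            (fun w ↦ (Metric.ball x (2 * δ)).indicator (fun w ↦ ‖φ x - φ w‖ₑ ^ 2) w) x]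
        refine lintegral_congr fun z ↦ ?_
        simp only [indicator, Metric.mem_ball, dist_zero_right, dist_self_add_left]
      rw [hD]
      simp only
      rw [h4]
      refine lintegral_mono_set fun w hw ↦ ?_
      have h5 : dist x (y j) < δ := hj.1.1
      rw [Metric.mem_ball] at hw ⊢
      calc dist w x ≤ dist w (y j) + dist (y j) x := dist_triangle _ _ _
        _ < 2 * δ := by rw [dist_comm (y j)]; linarith
    · have h3 : ∑ i, T φ i * (c i).indicator 1 x = 0 := by
        refine Finset.sum_eq_zero fun i _ ↦ ?_
        rw [indicator_of_notMem (fun hi ↦ hx hi.2), mul_zero]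
      rw [h3, sub_zero, indicator_of_mem (show x ∈ Kᶜ from hx)]
      exact le_self_add
  rw [enorm_sq_eq_lintegral]
  have hv0 : vol ≠ 0 := (Metric.measure_ball_pos _ _ hδ).ne'
  have hvt : vol ≠ ∞ := measure_ball_lt_top.ne
  calc _ ≤ ∫⁻ x, (Kᶜ.indicator (fun x ↦ ‖φ x‖ₑ ^ 2) x + vol⁻¹ * D x) := lintegral_mono_ae hpt
    _ = (∫⁻ x in Kᶜ, ‖φ x‖ₑ ^ 2) + vol⁻¹ * ∫⁻ x, D x := by
        rw [lintegral_add_left (((measurable_coeFn φ).enorm.pow_const 2).indicator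
          measurableSet_closedBall.compl), lintegral_indicator measurableSet_closedBall.compl,
          lintegral_const_mul' _ _ (ENNReal.inv_ne_top.mpr hv0)]
    _ ≤ (∫⁻ x in Kᶜ, ‖φ x‖ₑ ^ 2) + vol⁻¹ * (volume (Metric.ball (0 : Rn n) (2 * δ)) *
          (ENNReal.ofReal (2 * δ) ^ 2 * kinetic φ)) := by
        gcongr
        exact lintegral_translate_average_le φ
    _ = _ := by
        rw [Measure.addHaar_ball_mul_of_pos _ _ (by norm_num : (0 : ℝ) < 2), finrank_euclideanSpace,
          Fintype.card_fin, ← hvol, mul_assoc, mul_left_comm, ← mul_assoc vol⁻¹,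
          ENNReal.inv_mul_cancel hv0 hvt, one_mul]

/-- Chebyshev's argument: W ≥ M outside a large ball. The radius is uniform in φ. -/
theorem IsConfining.exists_tail_le (hW : IsConfining W) {M : ℝ} (hM : 0 < M) :
    ∃ R : ℝ, ∀ φ : L2 n, ∫⁻ x in (Metric.closedBall 0 R)ᶜ, ‖φ x‖ₑ ^ 2 ≤
      (ENNReal.ofReal M)⁻¹ * potential W φ := by
  obtain ⟨t, ht, hsub⟩ := mem_cocompact.mp (hW.tendsto_atTop.eventually_ge_atTop M)
  obtain ⟨R, hR⟩ := ht.isBounded.subset_closedBall 0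
  refine ⟨R, fun φ ↦ ?_⟩
  have hM0 : ENNReal.ofReal M ≠ 0 := by simpa using hM
  calc _ = ∫⁻ x in (Metric.closedBall 0 R)ᶜ,
        (ENNReal.ofReal M)⁻¹ * (ENNReal.ofReal M * ‖φ x‖ₑ ^ 2) := by
        refine lintegral_congr fun x ↦ ?_
        rw [← mul_assoc, ENNReal.inv_mul_cancel hM0 ENNReal.ofReal_ne_top, one_mul]
    _ ≤ ∫⁻ x in (Metric.closedBall 0 R)ᶜ,
        (ENNReal.ofReal M)⁻¹ * (ENNReal.ofReal (W x) * ‖φ x‖ₑ ^ 2) := by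
        refine setLIntegral_mono' measurableSet_closedBall.compl fun x hx ↦ ?_
        gcongr
        exact hsub fun hxt ↦ hx (hR hxt)
    _ ≤ ∫⁻ x, (ENNReal.ofReal M)⁻¹ * (ENNReal.ofReal (W x) * ‖φ x‖ₑ ^ 2) :=
        setLIntegral_le_lintegral _ _
    _ = _ := lintegral_const_mul' _ _ (ENNReal.inv_ne_top.mpr hM0)

/-- A set of bounded free energy is totally bounded in `L²`. -/
theorem IsConfining.totallyBounded (hW : IsConfining W) (C : ℝ) :
    TotallyBounded {φ : L2 n | ‖φ‖ ≤ C ∧ freeEnergy W φ ≤ ENNReal.ofReal C} := by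
  rw [Metric.totallyBounded_iff]
  intro ε hε
  set C' := |C| + 1 with hC'
  have hC'0 : 0 < C' := by positivity
  have hCC : C ≤ C' := (le_abs_self C).trans (by linarith)
  -- This level makes the tail at most ε²/16, and δ is chosen to make the step-function error at
  -- most ε²/16. The total ε²/8 is strictly below (ε/2)².
  obtain ⟨R, hR⟩ := hW.exists_tail_le (M := 16 * C' / ε ^ 2) (by positivity)
  obtain ⟨δ, hδ0, hδ⟩ : ∃ δ : ℝ, 0 < δ ∧ 2 ^ n * ((2 * δ) ^ 2 * C') ≤ ε ^ 2 / 16 := by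
    refine ⟨Real.sqrt (ε ^ 2 / (64 * 2 ^ n * C')), by positivity, le_of_eq ?_⟩
    rw [mul_pow, Real.sq_sqrt (by positivity)]
    field_simp
    norm_num
  obtain ⟨N, S, T, hST⟩ := exists_finiteRank_approx (n := n) R hδ0
  -- The approximations factor through a bounded set of a finite-dimensional space, so a finite
  -- ε/2-net for them is an ε-net for the set.
  have hcpt : IsCompact (S '' Metric.closedBall 0 (‖T‖ * C')) :=
    (isCompact_closedBall _ _).image S.continuous
  obtain ⟨t, htf, ht⟩ := Metric.totallyBounded_iff.mp hcpt.totallyBounded (ε / 2) (by positivity)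
  refine ⟨t, htf, ?_⟩
  rintro φ ⟨hφ1, hφ2⟩
  have h1 : S (T φ) ∈ S '' Metric.closedBall 0 (‖T‖ * C') := by
    refine ⟨T φ, mem_closedBall_zero_iff.mpr ?_, rfl⟩
    exact (T.le_opNorm φ).trans (by gcongr; exact hφ1.trans hCC)
  obtain ⟨v, hv, hvd⟩ := mem_iUnion₂.mp (ht h1)
  refine mem_iUnion₂.mpr ⟨v, hv, ?_⟩
  have hfe : freeEnergy W φ ≤ ENNReal.ofReal C' := hφ2.trans (ENNReal.ofReal_le_ofReal hCC)
  have hk : kinetic φ ≤ ENNReal.ofReal C' := le_self_add.trans hfe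
  have hp : potential W φ ≤ ENNReal.ofReal C' := le_add_self.trans hfe
  have h2 : ‖φ - S (T φ)‖ₑ ^ 2 ≤ ENNReal.ofReal ((ε / 2) ^ 2 / 2) := by
    calc _ ≤ _ := hST φ
      _ ≤ (ENNReal.ofReal (16 * C' / ε ^ 2))⁻¹ * ENNReal.ofReal C' +
          ENNReal.ofReal (2 ^ n) * (ENNReal.ofReal (2 * δ) ^ 2 * ENNReal.ofReal C') := by
          gcongr
          exact (hR φ).trans (by gcongr)
      _ = ENNReal.ofReal ((16 * C' / ε ^ 2)⁻¹ * C' + 2 ^ n * ((2 * δ) ^ 2 * C')) := by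
          rw [← ENNReal.ofReal_inv_of_pos (by positivity), ← ENNReal.ofReal_pow (by positivity),
            ← ENNReal.ofReal_mul (by positivity), ← ENNReal.ofReal_mul (by positivity),
            ← ENNReal.ofReal_mul (by positivity), ← ENNReal.ofReal_add (by positivity)
              (by positivity)]
      _ ≤ _ := by
          refine ENNReal.ofReal_le_ofReal ?_
          have : (16 * C' / ε ^ 2)⁻¹ * C' = ε ^ 2 / 16 := by field_simp
          rw [this]
          linarith
  have h3 : ‖φ - S (T φ)‖ ^ 2 ≤ (ε / 2) ^ 2 / 2 := by
    rw [← ofReal_norm, ← ENNReal.ofReal_pow (norm_nonneg _)] at h2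
    exact (ENNReal.ofReal_le_ofReal_iff (by positivity)).mp h2
  have h4 : ‖φ - S (T φ)‖ < ε / 2 := by
    refine lt_of_pow_lt_pow_left₀ 2 (by positivity) (h3.trans_lt ?_)
    have : 0 < (ε / 2) ^ 2 := by positivity
    linarith
  rw [Metric.mem_ball] at hvd ⊢
  calc dist φ v ≤ dist φ (S (T φ)) + dist (S (T φ)) v := dist_triangle _ _ _
    _ < ε / 2 + ε / 2 := add_lt_add (by rwa [dist_eq_norm]) hvd
    _ = ε := by ring

end Compactness

/-! ### Verification of the abstract hypotheses; eigenvalues and minimizing frames -/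

section Assembly

variable {n : ℕ} {W : Rn n → ℝ}

theorem kinetic_toLp_ne_top (f : 𝓢(Rn n, ℂ)) : kinetic (f.toLp 2 volume) ≠ ∞ := by
  rw [← exists_weakPartial_iff]
  intro i
  refine ⟨(∂_{EuclideanSpace.single i (1 : ℝ)} f : 𝓢(Rn n, ℂ)).toLp 2 volume, ?_⟩
  rw [IsWeakPartial, Lp.toTemperedDistribution_toLp_eq, Lp.toTemperedDistribution_toLp_eq,
    TemperedDistribution.lineDerivOp_toTemperedDistributionCLM_eq]

theorem IsConfining.toLp_mem_formDomain (hW : IsConfining W) {f : 𝓢(Rn n, ℂ)}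
    (hf : HasCompactSupport f) : f.toLp 2 volume ∈ formDomain W := by
  refine ⟨(exists_weakPartial_iff _).mpr (kinetic_toLp_ne_top f), ?_⟩
  have h1 : IntegrableOn (fun x ↦ W x * ‖f x‖ ^ 2) (tsupport f) := by
    have hfin : IsFiniteMeasure (volume.restrict (tsupport f)) :=
      ⟨by rw [Measure.restrict_apply_univ]; exact hf.measure_lt_top⟩
    obtain ⟨C, hC⟩ := hf.exists_bound_of_continuous f.continuous
    refine Integrable.mul_bdd (c := C ^ 2)
      ((hW.locallyBounded _ hf).integrable le_top)
      (f.continuous.norm.pow 2).aestronglyMeasurable (ae_of_all _ fun x ↦ ?_)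
    rw [norm_pow, norm_norm]
    exact pow_le_pow_left₀ (norm_nonneg _) (hC x) 2
  have h2 : Integrable (fun x ↦ W x * ‖f x‖ ^ 2) := by
    rwa [integrableOn_iff_integrable_of_support_subset] at h1
    intro x hx
    refine subset_tsupport _ fun h0 ↦ hx ?_
    simp [h0]
  refine h2.congr ?_
  filter_upwards [f.coeFn_toLp 2 volume] with x hx
  rw [hx]

/-- A smooth bump around `3je₀`. -/
def bump (hn : 1 ≤ n) (j : ℕ) : ContDiffBump (EuclideanSpace.single (⟨0, hn⟩ : Fin n) (3 * j : ℝ)) :=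
  ⟨1 / 2, 1, by norm_num, by norm_num⟩

theorem bump_mul_bump (hn : 1 ≤ n) {i j : ℕ} (hij : i ≠ j) (x : Rn n) :
    bump hn i x * bump hn j x = 0 := by
  by_contra h
  have hi : x ∈ Function.support (bump hn i) := left_ne_zero_of_mul h
  have hj : x ∈ Function.support (bump hn j) := right_ne_zero_of_mul h
  rw [ContDiffBump.support_eq] at hi hj
  have h1 : dist (EuclideanSpace.single (⟨0, hn⟩ : Fin n) (3 * i : ℝ))
      (EuclideanSpace.single (⟨0, hn⟩ : Fin n) (3 * j : ℝ)) < 2 := by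
    calc _ ≤ dist _ x + dist x _ := dist_triangle _ x _
      _ < 1 + 1 := add_lt_add (by rw [dist_comm]; exact hi) hj
      _ = 2 := by norm_num
  rw [PiLp.dist_single_same, Real.dist_eq, ← mul_sub, abs_mul] at h1
  have h2 : (1 : ℝ) ≤ |(i : ℝ) - j| := by
    have : (1 : ℤ) ≤ |(i : ℤ) - j| := Int.one_le_abs (by omega)
    exact_mod_cast this
  norm_num at h1
  linarith

/-- Bumps with disjoint supports are orthogonal. The dimension must be positive here: for n = 0 the
space L² is one-dimensional. -/
theorem IsConfining.exists_linearIndependent (hW : IsConfining W) (hn : 1 ≤ n) (N : ℕ) :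
    ∃ f : Fin N → L2 n, (∀ i, f i ∈ formDomain W) ∧ LinearIndependent ℂ f := by
  have hs : ∀ j : ℕ, HasCompactSupport (Complex.ofRealCLM ∘ bump hn j) := fun j ↦
    (bump hn j).hasCompactSupport.comp_left rfl
  have hd : ∀ j : ℕ, ContDiff ℝ ((⊤ : ℕ∞) : WithTop ℕ∞) (Complex.ofRealCLM ∘ bump hn j) := fun j ↦
    Complex.ofRealCLM.contDiff.comp (bump hn j).contDiff
  set g : ℕ → 𝓢(Rn n, ℂ) := fun j ↦ (hs j).toSchwartzMap (hd j) with hg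
  have hgx : ∀ j x, g j x = (bump hn j x : ℂ) := fun j x ↦ by simp [hg]
  refine ⟨fun i ↦ (g i).toLp 2 volume, fun i ↦ hW.toLp_mem_formDomain (hs i), ?_⟩
  refine linearIndependent_of_ne_zero_of_inner_eq_zero (fun i h0 ↦ ?_) fun i j hij ↦ ?_
  · have h1 : g i = 0 := by
      apply SchwartzMap.injective_toLp (E := Rn n) (F := ℂ) 2 volume
      exact h0.trans (map_zero (SchwartzMap.toLpCLM ℂ ℂ 2 volume)).symm
    have h2 := hgx i (EuclideanSpace.single (⟨0, hn⟩ : Fin n) (3 * (i : ℕ) : ℝ))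
    rw [h1, ContDiffBump.one_of_mem_closedBall _ (Metric.mem_closedBall_self
      (bump hn i).rIn_pos.le)] at h2
    simp at h2
  · beta_reduce
    rw [L2.inner_def, ← integral_zero (Rn n) ℂ]
    refine integral_congr_ae ?_
    filter_upwards [(g i).coeFn_toLp 2 volume, (g j).coeFn_toLp 2 volume] with x h1 h2
    rw [h1, h2, hgx, hgx]
    have h3 := bump_mul_bump hn (fun h ↦ hij (Fin.ext h)) x
    simp only [RCLike.inner_apply, Complex.conj_ofReal]
    rw [mul_comm]
    exact_mod_cast h3

theorem IsConfining.freeEnergy_le_ofReal (hW : IsConfining W) {a : ℝ} (ha : 0 < a) {V : TestFn n}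
    {M : ℝ} (hM : ∀ x, |V x| ≤ M) {φ : L2 n} (hφ : φ ∈ formDomain W) :
    (freeEnergy W φ).toReal ≤ energy W a V φ + a * (M * ‖φ‖ ^ 2) := by
  rw [hW.energy_eq a V hφ]
  have := (abs_le.mp (abs_integral_testFn_le hM φ)).2
  nlinarith

/-- The quadratic form of `-Δ + W - aV`. -/
def IsConfining.compactForm (hW : IsConfining W) (hn : 1 ≤ n) {a : ℝ} (ha : 0 < a)
    (V : TestFn n) : CompactForm (L2 n) where
  dom := hW.formSubmodule
  B := form W a V
  add_left φ hφ φ' hφ' ψ hψ := hW.form_add_left a V hφ hφ' hψ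
  smul_left c φ hφ ψ _ := IsConfining.form_smul_left a V c hφ
  conj_symm φ _ ψ _ := form_conj_symm a V φ ψ
  lower_bound := by
    obtain ⟨M, -, hM⟩ := V.exists_bound
    refine ⟨a * M, fun φ hφ ↦ ?_⟩
    rw [re_form_self]
    have h1 := hW.freeEnergy_le_ofReal ha hM hφ
    have h2 : 0 ≤ (freeEnergy W φ).toReal := ENNReal.toReal_nonneg
    linarith
  compact := by
    intro φ C hφ hC hq
    obtain ⟨M, hM0, hM⟩ := V.exists_bound
    have hC0 : 0 ≤ C := (norm_nonneg _).trans (hC 0)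
    set C' := C + a * (M * C ^ 2) with hC'
    have hCC' : C ≤ C' := le_add_of_nonneg_right (by positivity)
    have hmem : ∀ m, φ m ∈ {φ : L2 n | ‖φ‖ ≤ C' ∧ freeEnergy W φ ≤ ENNReal.ofReal C'} := by
      refine fun m ↦ ⟨(hC m).trans hCC', ?_⟩
      rw [← ENNReal.ofReal_toReal (hW.mem_formDomain_iff.mp (hφ m))]
      refine ENNReal.ofReal_le_ofReal ((hW.freeEnergy_le_ofReal ha hM (hφ m)).trans ?_)
      have h1 := hq m
      rw [re_form_self] at h1
      exact add_le_add h1 (by gcongr; exact hC m)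
    obtain ⟨ψ, -, σ, hσ, hlim⟩ := ((hW.totallyBounded C').closure.isCompact_of_isClosed
      isClosed_closure).tendsto_subseq fun m ↦
        subset_closure (hmem m)
    exact ⟨ψ, σ, hσ, hlim⟩
  closed := by
    intro φ ψ C hφ hlim hq
    have hV := tendsto_integral_testFn V hlim
    set I := ∫ x, V x * ‖ψ x‖ ^ 2 with hI
    -- The free energy is lower semicontinuous and the V-term is L²-continuous; ε absorbs the
    -- V-term's error on a tail.
    have key : ∀ ε > 0, freeEnergy W ψ ≤ ENNReal.ofReal (C + a * I + ε) := by
      intro ε hε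
      have hev : ∀ᶠ m in atTop, a * ∫ x, V x * ‖φ m x‖ ^ 2 < a * I + ε :=
        (hV.const_mul a).eventually_lt_const (by linarith)
      obtain ⟨m₀, hm₀⟩ := eventually_atTop.mp hev
      refine hW.freeEnergy_le_of_tendsto ((tendsto_add_atTop_iff_nat m₀).mpr hlim) fun m ↦ ?_
      rw [← ENNReal.ofReal_toReal (hW.mem_formDomain_iff.mp (hφ (m + m₀)))]
      refine ENNReal.ofReal_le_ofReal ?_
      have h1 := hq (m + m₀)
      rw [re_form_self, hW.energy_eq a V (hφ _)] at h1
      have h2 := hm₀ (m + m₀) (Nat.le_add_left _ _)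
      linarith
    have hψ : ψ ∈ formDomain W := by
      rw [hW.mem_formDomain_iff]
      exact ne_top_of_le_ne_top ENNReal.ofReal_ne_top (key 1 one_pos)
    refine ⟨hψ, ?_⟩
    rw [re_form_self, hW.energy_eq a V hψ]
    refine le_of_forall_pos_le_add fun ε hε ↦ ?_
    -- `ENNReal.ofReal` truncates at zero, so the sign is needed to read the bound back in ℝ. It
    -- holds as a limit of upper bounds for free energies.
    have h1 : 0 ≤ C + a * I := by
      by_contra! hneg
      have h2 : ∀ m, 0 ≤ C + a * ∫ x, V x * ‖φ m x‖ ^ 2 := fun m ↦ by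
        have h1 := hq m
        rw [re_form_self, hW.energy_eq a V (hφ _)] at h1
        have h3 : 0 ≤ (freeEnergy W (φ m)).toReal := ENNReal.toReal_nonneg
        linarith
      exact absurd (ge_of_tendsto' ((hV.const_mul a).const_add C) h2) (not_le.mpr hneg)
    have h2 := ENNReal.toReal_mono ENNReal.ofReal_ne_top (key ε hε)
    rw [ENNReal.toReal_ofReal (by linarith)] at h2
    linarith
  infinite := hW.exists_linearIndependent hn

theorem IsEigenframe.mem_frames {a : ℝ} {V : TestFn n} {k : ℕ} {φ : Fin k → L2 n} (h : IsEigenframe W a V φ) :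
    φ ∈ frames W k := ⟨fun j ↦ (h.2 j).1, h.1⟩

section

variable (hW : IsConfining W) (hn : 1 ≤ n) {a : ℝ} (ha : 0 < a) (V : TestFn n)

theorem compactForm_q (φ : L2 n) : (hW.compactForm hn ha V).q φ = energy W a V φ :=
  re_form_self a V φ

theorem compactForm_maps_iff (φ f : L2 n) :
    (hW.compactForm hn ha V).Maps φ f ↔ OperatorMaps W a V φ f := Iff.rfl

theorem eigenvalue_eq_val (j : ℕ) : eigenvalue W a V j = (hW.compactForm hn ha V).val j :=
  CompactForm.sInf_rank_eq_val (F := hW.compactForm hn ha V) j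

theorem isEigenframe_iff {k : ℕ} (φ : Fin k → L2 n) :
    IsEigenframe W a V φ ↔ (hW.compactForm hn ha V).IsFrame φ := by
  simp only [IsEigenframe, CompactForm.IsFrame, compactForm_maps_iff, eigenvalue_eq_val hW hn ha]

end

theorem frameEnergy_of_isEigenframe (hW : IsConfining W) (hn : 1 ≤ n) {a : ℝ} (ha : 0 < a) (V : TestFn n)
    {k : ℕ} (β : Fin k → ℝ) {φ : Fin k → L2 n}
    (h : IsEigenframe W a V φ) : frameEnergy W a β V φ = ∑ j, β j * eigenvalue W a V j := by
  rw [isEigenframe_iff hW hn ha] at h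
  refine Finset.sum_congr rfl fun j _ ↦ ?_
  rw [← compactForm_q hW hn ha, h.q_eq, eigenvalue_eq_val hW hn ha]

theorem exists_isEigenframe (hW : IsConfining W) (hn : 1 ≤ n) {a : ℝ} (ha : 0 < a) (V : TestFn n)
    (k : ℕ) : ∃ φ : Fin k → L2 n, IsEigenframe W a V φ :=
  ⟨_, (isEigenframe_iff hW hn ha V _).mpr (CompactForm.isFrame_vec k)⟩

theorem isLeast_frameEnergy (hW : IsConfining W) (hn : 1 ≤ n) {a : ℝ} (ha : 0 < a) (V : TestFn n)
    {k : ℕ} {β : Fin k → ℝ} (hβ : StrictAnti β) (hβ_pos : ∀ j, 0 < β j) :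
    IsLeast (frameEnergy W a β V '' frames W k) (∑ j, β j * eigenvalue W a V j) := by
  constructor
  · obtain ⟨φ, hφ⟩ := exists_isEigenframe hW hn ha V k
    exact ⟨φ, hφ.mem_frames, frameEnergy_of_isEigenframe hW hn ha V β hφ⟩
  · rintro _ ⟨φ, ⟨h1, h2⟩, rfl⟩
    have h := CompactForm.sum_mul_val_le (F := hW.compactForm hn ha V) hβ.antitone
      (fun j ↦ (hβ_pos j).le) h1 h2
    simpa only [frameEnergy, compactForm_q, ← eigenvalue_eq_val hW hn ha] using h

theorem G_eq (hW : IsConfining W) (hn : 1 ≤ n) {a : ℝ} (ha : 0 < a) (V : TestFn n)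
    {k : ℕ} {β : Fin k → ℝ} (hβ : StrictAnti β) (hβ_pos : ∀ j, 0 < β j) :
    G W a β V = ∑ j, β j * eigenvalue W a V j :=
  (isLeast_frameEnergy hW hn ha V hβ hβ_pos).csInf_eq

theorem monotone_eigenvalue (hW : IsConfining W) (hn : 1 ≤ n) {a : ℝ} (ha : 0 < a) (V : TestFn n) :
    Monotone (eigenvalue W a V) := by
  have : eigenvalue W a V = (hW.compactForm hn ha V).val :=
    funext (eigenvalue_eq_val hW hn ha V)
  rw [this]
  exact CompactForm.val_mono

end Assembly

/-! ### Pointwise contractions of ℂ² do not increase energy -/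

section PairContraction

variable {n : ℕ} {W : Rn n → ℝ}

theorem enorm_translate_sub_sq_of_ae {g : L2 n} {G : Rn n → ℂ} (hg : g =ᵐ[volume] G) (h : Rn n) :
    ‖translate h g - g‖ₑ ^ 2 = ∫⁻ x, ‖G (x + h) - G x‖ₑ ^ 2 := by
  rw [enorm_sq_eq_lintegral]
  refine lintegral_congr_ae ?_
  filter_upwards [Lp.coeFn_sub (translate h g) g, coeFn_translate h g, hg,
    (measurePreserving_add_right volume h).quasiMeasurePreserving.ae hg] with x h1 h2 h3 h4
  rw [h1, Pi.sub_apply, h2, h3, h4]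

theorem enorm_sq_add_enorm_sq (z w : ℂ) :
    ‖z‖ₑ ^ 2 + ‖w‖ₑ ^ 2 = ENNReal.ofReal (‖z‖ ^ 2 + ‖w‖ ^ 2) := by
  rw [ENNReal.ofReal_add (by positivity) (by positivity), ENNReal.ofReal_pow (norm_nonneg _),
    ENNReal.ofReal_pow (norm_nonneg _), ofReal_norm, ofReal_norm]

/-- A contraction of `ℂ²` which preserves the norm. -/
structure IsPairContraction (F₁ F₂ : ℂ → ℂ → ℂ) : Prop where
  contract : ∀ z w z' w', ‖F₁ z w - F₁ z' w'‖ ^ 2 + ‖F₂ z w - F₂ z' w'‖ ^ 2 ≤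
    ‖z - z'‖ ^ 2 + ‖w - w'‖ ^ 2
  norm_eq : ∀ z w, ‖F₁ z w‖ ^ 2 + ‖F₂ z w‖ ^ 2 = ‖z‖ ^ 2 + ‖w‖ ^ 2
  continuous_fst : Continuous (fun p : ℂ × ℂ ↦ F₁ p.1 p.2)
  continuous_snd : Continuous (fun p : ℂ × ℂ ↦ F₂ p.1 p.2)

variable {F₁ F₂ : ℂ → ℂ → ℂ}

/-- `(f₁, f₂)` is obtained from `(φ₁, φ₂)` by pointwise application of `(F₁, F₂)`. -/
structure IsPairImage (F₁ F₂ : ℂ → ℂ → ℂ) (φ₁ φ₂ f₁ f₂ : L2 n) : Prop where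
  fst : f₁ =ᵐ[volume] fun x ↦ F₁ (φ₁ x) (φ₂ x)
  snd : f₂ =ᵐ[volume] fun x ↦ F₂ (φ₁ x) (φ₂ x)

theorem IsPairContraction.exists_image (hF : IsPairContraction F₁ F₂) (φ₁ φ₂ : L2 n) :
    ∃ f₁ f₂ : L2 n, IsPairImage F₁ F₂ φ₁ φ₂ f₁ f₂ := by
  have hm := (Lp.aestronglyMeasurable φ₁).prodMk (Lp.aestronglyMeasurable φ₂)
  have hb : ∀ {r s t u : ℝ}, 0 ≤ t → 0 ≤ u → r ^ 2 + s ^ 2 = t ^ 2 + u ^ 2 → r ≤ t + u := by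
    intro r s t u ht hu h
    refine le_of_sq_le_sq ?_ (add_nonneg ht hu)
    nlinarith [sq_nonneg s, mul_nonneg ht hu]
  have hd := (Lp.memLp φ₁).norm.add (Lp.memLp φ₂).norm
  have h1 : MemLp (fun x ↦ F₁ (φ₁ x) (φ₂ x)) 2 volume :=
    hd.of_le (hF.continuous_fst.comp_aestronglyMeasurable hm) (ae_of_all _ fun x ↦ by
      rw [Pi.add_apply, Real.norm_of_nonneg (by positivity)]
      exact hb (norm_nonneg _) (norm_nonneg _) (hF.norm_eq _ _))
  have h2 : MemLp (fun x ↦ F₂ (φ₁ x) (φ₂ x)) 2 volume :=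
    hd.of_le (hF.continuous_snd.comp_aestronglyMeasurable hm) (ae_of_all _ fun x ↦ by
      rw [Pi.add_apply, Real.norm_of_nonneg (by positivity)]
      exact hb (norm_nonneg _) (norm_nonneg _) ((add_comm _ _).trans (hF.norm_eq _ _)))
  exact ⟨h1.toLp, h2.toLp, h1.coeFn_toLp, h2.coeFn_toLp⟩

variable {φ₁ φ₂ f₁ f₂ : L2 n}

theorem IsPairImage.norm_sq_ae (h : IsPairImage F₁ F₂ φ₁ φ₂ f₁ f₂) (hF : IsPairContraction F₁ F₂) :
    ∀ᵐ x, ‖f₁ x‖ ^ 2 + ‖f₂ x‖ ^ 2 = ‖φ₁ x‖ ^ 2 + ‖φ₂ x‖ ^ 2 := by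
  filter_upwards [h.fst, h.snd] with x h1 h2
  rw [h1, h2, hF.norm_eq]

theorem IsPairImage.norm_sq (h : IsPairImage F₁ F₂ φ₁ φ₂ f₁ f₂) (hF : IsPairContraction F₁ F₂) :
    ‖f₁‖ ^ 2 + ‖f₂‖ ^ 2 = ‖φ₁‖ ^ 2 + ‖φ₂‖ ^ 2 := by
  simp only [norm_sq_eq_integral]
  rw [← integral_add (integrable_norm_sq _) (integrable_norm_sq _),
    ← integral_add (integrable_norm_sq _) (integrable_norm_sq _)]
  exact integral_congr_ae (h.norm_sq_ae hF)

theorem IsPairImage.integral_testFn (h : IsPairImage F₁ F₂ φ₁ φ₂ f₁ f₂)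
    (hF : IsPairContraction F₁ F₂) (V : TestFn n) :
    (∫ x, V x * ‖f₁ x‖ ^ 2) + ∫ x, V x * ‖f₂ x‖ ^ 2 =
      (∫ x, V x * ‖φ₁ x‖ ^ 2) + ∫ x, V x * ‖φ₂ x‖ ^ 2 := by
  simp only [← integral_add (integrable_testFn_mul_norm_sq V _)
    (integrable_testFn_mul_norm_sq V _)]
  refine integral_congr_ae ?_
  filter_upwards [h.norm_sq_ae hF] with x hx
  rw [← mul_add, hx, mul_add]

/-- The contraction property bounds the difference quotients pointwise, and these determine the
kinetic energy; no chain rule for Lipschitz maps is needed. -/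
theorem IsPairImage.kinetic_add_le (h : IsPairImage F₁ F₂ φ₁ φ₂ f₁ f₂)
    (hF : IsPairContraction F₁ F₂) : kinetic f₁ + kinetic f₂ ≤ kinetic φ₁ + kinetic φ₂ := by
  refine kinetic_add_le_of_translate fun v ↦ ?_
  have hm : ∀ φ : L2 n, Measurable fun x ↦ ‖φ (x + v) - φ x‖ₑ ^ 2 := fun φ ↦
    ((((measurable_coeFn φ).comp (measurable_add_const v)).sub
      (measurable_coeFn φ)).enorm.pow_const 2)
  have hm2 : Measurable fun x ↦ ‖F₁ (φ₁ (x + v)) (φ₂ (x + v)) - F₁ (φ₁ x) (φ₂ x)‖ₑ ^ 2 := by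
    have h0 : Measurable fun x ↦ F₁ (φ₁ x) (φ₂ x) :=
      hF.continuous_fst.measurable.comp ((measurable_coeFn φ₁).prodMk (measurable_coeFn φ₂))
    exact (((h0.comp (measurable_add_const v)).sub h0).enorm.pow_const 2)
  rw [enorm_translate_sub_sq_of_ae h.fst, enorm_translate_sub_sq_of_ae h.snd,
    enorm_translate_sub_sq_of_ae (ae_eq_refl φ₁), enorm_translate_sub_sq_of_ae (ae_eq_refl φ₂),
    ← lintegral_add_left hm2, ← lintegral_add_left (hm φ₁)]
  refine lintegral_mono fun x ↦ ?_
  simp only [enorm_sq_add_enorm_sq]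
  exact ENNReal.ofReal_le_ofReal (hF.contract _ _ _ _)

theorem IsPairImage.potential_add (h : IsPairImage F₁ F₂ φ₁ φ₂ f₁ f₂)
    (hF : IsPairContraction F₁ F₂) (hW : IsConfining W) :
    potential W f₁ + potential W f₂ = potential W φ₁ + potential W φ₂ := by
  have hm : ∀ φ : L2 n, AEMeasurable fun x ↦ ENNReal.ofReal (W x) * ‖φ x‖ₑ ^ 2 := fun φ ↦
    hW.aestronglyMeasurable.aemeasurable.ennreal_ofReal.mul
      ((Lp.aestronglyMeasurable φ).enorm.pow_const 2)
  simp only [potential]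
  rw [← lintegral_add_left' (hm f₁), ← lintegral_add_left' (hm φ₁)]
  refine lintegral_congr_ae ?_
  filter_upwards [h.norm_sq_ae hF] with x hx
  rw [← mul_add, ← mul_add, enorm_sq_add_enorm_sq, enorm_sq_add_enorm_sq, hx]

theorem IsPairImage.freeEnergy_add_le (h : IsPairImage F₁ F₂ φ₁ φ₂ f₁ f₂)
    (hF : IsPairContraction F₁ F₂) (hW : IsConfining W) :
    freeEnergy W f₁ + freeEnergy W f₂ ≤ freeEnergy W φ₁ + freeEnergy W φ₂ := by
  simp only [freeEnergy]
  rw [add_add_add_comm, add_add_add_comm (kinetic φ₁), h.potential_add hF hW]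
  exact add_le_add_left (h.kinetic_add_le hF) _

theorem IsPairImage.mem_formDomain (h : IsPairImage F₁ F₂ φ₁ φ₂ f₁ f₂)
    (hF : IsPairContraction F₁ F₂) (hW : IsConfining W) (h₁ : φ₁ ∈ formDomain W)
    (h₂ : φ₂ ∈ formDomain W) : f₁ ∈ formDomain W ∧ f₂ ∈ formDomain W := by
  simp only [hW.mem_formDomain_iff] at *
  rw [← ENNReal.add_ne_top]
  exact ne_top_of_le_ne_top (ENNReal.add_ne_top.mpr ⟨h₁, h₂⟩) (h.freeEnergy_add_le hF hW)

theorem IsPairImage.energy_add_le (h : IsPairImage F₁ F₂ φ₁ φ₂ f₁ f₂)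
    (hF : IsPairContraction F₁ F₂) (hW : IsConfining W) (h₁ : φ₁ ∈ formDomain W)
    (h₂ : φ₂ ∈ formDomain W) (a : ℝ) (V : TestFn n) :
    energy W a V f₁ + energy W a V f₂ ≤ energy W a V φ₁ + energy W a V φ₂ := by
  obtain ⟨h₃, h₄⟩ := h.mem_formDomain hF hW h₁ h₂
  rw [hW.energy_eq a V h₁, hW.energy_eq a V h₂, hW.energy_eq a V h₃, hW.energy_eq a V h₄]
  have h5 := h.freeEnergy_add_le hF hW
  rw [hW.mem_formDomain_iff] at h₁ h₂ h₃ h₄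
  have h6 := ENNReal.toReal_mono (ENNReal.add_ne_top.mpr ⟨h₁, h₂⟩) h5
  rw [ENNReal.toReal_add h₁ h₂, ENNReal.toReal_add h₃ h₄] at h6
  have h7 := h.integral_testFn hF V
  linear_combination h6 - a * h7

/-- Separation of the real and the imaginary part. -/
theorem isPairContraction_re_im : IsPairContraction
    (fun z w ↦ (z.re : ℂ) + w.re * Complex.I) (fun z w ↦ (z.im : ℂ) + w.im * Complex.I) where
  contract z w z' w' := by
    simp only [← Complex.normSq_eq_norm_sq, Complex.normSq_apply]
    simp
    linarith
  norm_eq z w := by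
    simp only [← Complex.normSq_eq_norm_sq, Complex.normSq_apply]
    simp
    ring
  continuous_fst := by fun_prop
  continuous_snd := by fun_prop

/-- Two pairs of numbers are closest when both are sorted. -/
theorem min_sub_sq_add_max_sub_sq_le (x y x' y' : ℝ) :
    (min x y - min x' y') ^ 2 + (max x y - max x' y') ^ 2 ≤ (x - x') ^ 2 + (y - y') ^ 2 := by
  rcases le_total x y with h | h <;> rcases le_total x' y' with h' | h' <;>
    simp only [min_eq_left, min_eq_right, max_eq_left, max_eq_right, h, h'] <;>
    nlinarith [mul_nonneg (sub_nonneg.mpr h) (sub_nonneg.mpr h')]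

/-- Sorting of the real parts. -/
theorem isPairContraction_min_max : IsPairContraction
    (fun z w ↦ ((min z.re w.re : ℝ) : ℂ) + z.im * Complex.I)
    (fun z w ↦ ((max z.re w.re : ℝ) : ℂ) + w.im * Complex.I) where
  contract z w z' w' := by
    have := min_sub_sq_add_max_sub_sq_le z.re w.re z'.re w'.re
    simp only [← Complex.normSq_eq_norm_sq, Complex.normSq_apply]
    simp
    linarith
  norm_eq z w := by
    simp only [← Complex.normSq_eq_norm_sq, Complex.normSq_apply]
    simp
    rcases le_total z.re w.re with h | h
    · simp [h]
    · simp [h]; ring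
  continuous_fst := by fun_prop
  continuous_snd := by fun_prop

end PairContraction

/-! ### Ground states, and sets of locally finite Dirichlet energy -/

section GroundState

variable {n : ℕ} {W : Rn n → ℝ}

/-- `φ` attains the infimum `μ` of the quotient `energy φ / ‖φ‖²`. -/
def IsGround (W : Rn n → ℝ) (a : ℝ) (V : TestFn n) (μ : ℝ) (φ : L2 n) : Prop :=
  φ ∈ formDomain W ∧ energy W a V φ ≤ μ * ‖φ‖ ^ 2

variable {a μ : ℝ} {V : TestFn n}

theorem IsConfining.energy_smul (c : ℂ) {φ : L2 n} (hφ : φ ∈ formDomain W) :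
    energy W a V (c • φ) = ‖c‖ ^ 2 * energy W a V φ := by
  rw [← re_form_self, IsConfining.form_smul_left a V c hφ, ← form_conj_symm,
    IsConfining.form_smul_left a V c hφ, map_mul, form_conj_symm, ← mul_assoc, Complex.mul_conj,
    Complex.normSq_eq_norm_sq, Complex.re_ofReal_mul, re_form_self]

theorem IsGround.smul (hW : IsConfining W) (c : ℂ) {φ : L2 n} (h : IsGround W a V μ φ) :
    IsGround W a V μ (c • φ) := by
  refine ⟨hW.formSubmodule.smul_mem c h.1, ?_⟩
  rw [IsConfining.energy_smul c h.1, norm_smul, mul_pow]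
  have := mul_le_mul_of_nonneg_left h.2 (sq_nonneg ‖c‖)
  linarith

theorem isGround_zero (hW : IsConfining W) : IsGround W a V μ (0 : L2 n) := by
  refine ⟨hW.formSubmodule.zero_mem, ?_⟩
  rw [← zero_smul ℂ (0 : L2 n), IsConfining.energy_smul 0 hW.formSubmodule.zero_mem]
  simp

variable {F₁ F₂ : ℂ → ℂ → ℂ} {φ₁ φ₂ f₁ f₂ : L2 n}

/-- The total energy does not grow and the total norm is kept, while each image has energy at least
μ times its squared norm. So both bounds are equalities. -/
theorem IsPairImage.isGround (h : IsPairImage F₁ F₂ φ₁ φ₂ f₁ f₂)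
    (hF : IsPairContraction F₁ F₂) (hW : IsConfining W)
    (hμ : ∀ φ ∈ formDomain W, μ * ‖φ‖ ^ 2 ≤ energy W a V φ) (h₁ : IsGround W a V μ φ₁)
    (h₂ : IsGround W a V μ φ₂) : IsGround W a V μ f₁ ∧ IsGround W a V μ f₂ := by
  obtain ⟨h₃, h₄⟩ := h.mem_formDomain hF hW h₁.1 h₂.1
  have h5 := h.energy_add_le hF hW h₁.1 h₂.1 a V
  have h6 := h.norm_sq hF
  have h7 := hμ _ h₃
  have h8 := hμ _ h₄
  have h9 := h₁.2
  have h10 := h₂.2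
  have h11 : μ * ‖f₁‖ ^ 2 + μ * ‖f₂‖ ^ 2 = μ * ‖φ₁‖ ^ 2 + μ * ‖φ₂‖ ^ 2 := by
    rw [← mul_add, h6, mul_add]
  exact ⟨⟨h₃, by linarith⟩, ⟨h₄, by linarith⟩⟩

/-- The difference of G has modulus 1 where membership in A changes, so the volume is at most the
squared L² norm of a difference of translates, which is quadratic in v. The base shift w lets a long
translation be cut into short ones. -/
theorem volume_symmDiff_translate_le {A : Set (Rn n)} {g : L2 n} {ρ : ℝ} {G : Rn n → ℂ}
    (hg : g =ᵐ[volume] G) (hG : ∀ x ∈ Metric.closedBall (0 : Rn n) ρ, G x = A.indicator 1 x)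
    (v : Rn n) {S : Set (Rn n)} {w : Rn n} (hS : ∀ x ∈ S, ‖x + w‖ ≤ ρ ∧ ‖x + w + v‖ ≤ ρ) :
    volume {x ∈ S | ¬ (x + w + v ∈ A ↔ x + w ∈ A)} ≤ ‖v‖ₑ ^ 2 * kinetic g := by
  refine le_trans ?_ (enorm_translate_sub_sq_le_kinetic v g)
  have hmeas : AEMeasurable fun x ↦ ‖(g : Rn n → ℂ) (x + w + v) - g (x + w)‖ₑ ^ 2 := by
    have := measurable_coeFn g
    fun_prop
  rw [enorm_translate_sub_sq_of_ae hg, ← lintegral_add_right_eq_self _ w]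
  have hle : ∀ x ∈ {x ∈ S | ¬ (x + w + v ∈ A ↔ x + w ∈ A)},
      (1 : ℝ≥0∞) ≤ ‖G (x + w + v) - G (x + w)‖ₑ ^ 2 := by
    rintro x ⟨hxS, hx⟩
    obtain ⟨h1, h2⟩ := hS x hxS
    rw [hG _ (by simpa using h2), hG _ (by simpa using h1)]
    by_cases hA : x + w ∈ A <;> by_cases hB : x + w + v ∈ A <;> simp_all
  calc volume {x ∈ S | ¬ (x + w + v ∈ A ↔ x + w ∈ A)}
      ≤ volume {x | (1 : ℝ≥0∞) ≤ ‖G (x + w + v) - G (x + w)‖ₑ ^ 2} := measure_mono hle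
    _ = volume {x | (1 : ℝ≥0∞) ≤ ‖(g : Rn n → ℂ) (x + w + v) - g (x + w)‖ₑ ^ 2} := by
        refine measure_congr ?_
        filter_upwards [(measurePreserving_add_right volume w).quasiMeasurePreserving.ae hg,
          (measurePreserving_add_right volume (w + v)).quasiMeasurePreserving.ae hg] with x h1 h2
        rw [← add_assoc] at h2
        exact congrArg (fun t : ℝ≥0∞ ↦ 1 ≤ t) (by rw [h1, h2])
    _ ≤ ∫⁻ x, ‖(g : Rn n → ℂ) (x + w + v) - g (x + w)‖ₑ ^ 2 := by
        simpa using mul_meas_ge_le_lintegral₀ hmeas 1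
    _ = _ := by
        refine lintegral_congr_ae ?_
        filter_upwards [(measurePreserving_add_right volume w).quasiMeasurePreserving.ae hg,
          (measurePreserving_add_right volume (w + v)).quasiMeasurePreserving.ae hg] with x h1 h2
        rw [← add_assoc] at h2
        rw [h1, h2]

/-- A set whose indicator function locally has finite kinetic energy is null or conull. -/
theorem eventuallyConst_of_kinetic_ne_top {A : Set (Rn n)} (hA : MeasurableSet A)
    (h : ∀ ρ : ℝ, 0 < ρ → ∃ g : L2 n, kinetic g ≠ ∞ ∧ ∃ G : Rn n → ℂ, g =ᵐ[volume] G ∧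
      ∀ x ∈ Metric.closedBall (0 : Rn n) ρ, G x = A.indicator 1 x) :
    EventuallyConst A (ae (volume : Measure (Rn n))) := by
  -- By ergodicity of the translations, it is enough that A is invariant under each of them up to
  -- null sets.
  refine aeconst_of_forall_preimage_vadd_ae_eq (Rn n) hA.nullMeasurableSet fun v ↦ ?_
  have hR : ∀ R : ℕ, volume {x ∈ Metric.closedBall (0 : Rn n) R | ¬ (x + v ∈ A ↔ x ∈ A)} = 0 := by
    intro R
    -- All intermediate points x + iu stay in this ball; the 1 keeps its radius positive.
    obtain ⟨g, hg, G, hgG, hG⟩ := h (R + ‖v‖ + 1) (by positivity)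
    have hb : ∀ N : ℕ, volume {x ∈ Metric.closedBall (0 : Rn n) R | ¬ (x + v ∈ A ↔ x ∈ A)} ≤
        ENNReal.ofReal (‖v‖ ^ 2 * (kinetic g).toReal / (N + 1)) := by
      intro N
      -- If membership changes from x to x + v, it changes in one of the N + 1 steps of length
      -- ‖v‖/(N+1). Each step costs a multiple of its squared length, so the sum is of order 1/N.
      set u : Rn n := ((N : ℝ) + 1)⁻¹ • v with hu
      have hsub : {x ∈ Metric.closedBall (0 : Rn n) R | ¬ (x + v ∈ A ↔ x ∈ A)} ⊆
          ⋃ j ∈ Finset.range (N + 1), {x ∈ Metric.closedBall (0 : Rn n) R |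
            ¬ (x + (j : ℝ) • u + u ∈ A ↔ x + (j : ℝ) • u ∈ A)} := by
        rintro x ⟨hxR, hx⟩
        by_contra hcon
        simp only [mem_iUnion, not_exists, mem_ofPred_eq, not_and, not_not] at hcon
        refine hx ?_
        have hj : ∀ j ≤ N + 1, (x + (j : ℝ) • u ∈ A ↔ x ∈ A) := by
          intro j
          induction j with
          | zero => simp
          | succ j ih =>
            intro hjN
            rw [← ih (by omega), ← hcon j (Finset.mem_range.mpr (by omega)) hxR, add_assoc]
            push_cast
            rw [add_smul, one_smul]
        have h1 := hj (N + 1) le_rfl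
        have h2 : ((N + 1 : ℕ) : ℝ) • u = v := by
          rw [hu, smul_smul]
          push_cast
          rw [mul_inv_cancel₀ (by positivity), one_smul]
        rwa [h2] at h1
      have hterm : ∀ j ∈ Finset.range (N + 1),
          volume {x ∈ Metric.closedBall (0 : Rn n) R |
            ¬ (x + (j : ℝ) • u + u ∈ A ↔ x + (j : ℝ) • u ∈ A)} ≤ ‖u‖ₑ ^ 2 * kinetic g := by
        intro j hj
        refine volume_symmDiff_translate_le hgG hG u fun x hx ↦ ?_
        have hx' : ‖x‖ ≤ R := by simpa using hx
        have hs : ∀ i : ℕ, i ≤ N + 1 → ‖x + (i : ℝ) • u‖ ≤ R + ‖v‖ + 1 := by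
          intro i hi
          refine (norm_add_le _ _).trans ?_
          have : ‖(i : ℝ) • u‖ ≤ ‖v‖ := by
            rw [hu, smul_smul, norm_smul, ← div_eq_mul_inv, Real.norm_of_nonneg (by positivity)]
            refine mul_le_of_le_one_left (norm_nonneg _) ?_
            rw [div_le_one (by positivity)]
            exact_mod_cast hi
          linarith
        rw [Finset.mem_range] at hj
        refine ⟨hs j hj.le, ?_⟩
        have := hs (j + 1) hj
        push_cast at this
        rwa [add_smul, one_smul, ← add_assoc] at this
      refine (measure_mono hsub).trans ((measure_biUnion_finset_le _ _).trans
        ((Finset.sum_le_sum hterm).trans (le_of_eq ?_)))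
      rw [Finset.sum_const, Finset.card_range, nsmul_eq_mul, ← ENNReal.ofReal_toReal hg,
        ← ofReal_norm u, ← ENNReal.ofReal_pow (norm_nonneg _),
        ← ENNReal.ofReal_mul (by positivity), ← ENNReal.ofReal_natCast,
        ← ENNReal.ofReal_mul (by positivity), ENNReal.toReal_ofReal ENNReal.toReal_nonneg]
      congr 1
      rw [hu, norm_smul, norm_inv, Real.norm_of_nonneg (by positivity : (0 : ℝ) ≤ N + 1)]
      push_cast
      field_simp
    refine le_antisymm (ge_of_tendsto' (x := atTop) ?_ hb) zero_le
    rw [← ENNReal.ofReal_zero]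
    refine ENNReal.tendsto_ofReal ?_
    exact tendsto_const_nhds.div_atTop (tendsto_natCast_atTop_atTop.atTop_add tendsto_const_nhds)
  have hnull : volume (⋃ R : ℕ, {x ∈ Metric.closedBall (0 : Rn n) R | ¬ (x + v ∈ A ↔ x ∈ A)}) = 0 :=
    measure_iUnion_null hR
  refine eventuallyEq_set.mpr ?_
  rw [ae_iff]
  refine measure_mono_null (fun x hx ↦ ?_) hnull
  obtain ⟨R, hR⟩ := exists_nat_ge ‖x‖
  refine mem_iUnion.mpr ⟨R, by simpa using hR, ?_⟩
  simpa [add_comm] using hx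

end GroundState

/-! ### Strict sign of real ground states; simplicity of the lowest eigenvalue -/

section Positivity

variable {n : ℕ} {W : Rn n → ℝ} {a μ : ℝ} {V : TestFn n}

theorem IsConfining.kinetic_le_of_energy_le (hW : IsConfining W) (ha : 0 < a) {M C : ℝ}
    (hM : ∀ x, |V x| ≤ M) {φ : L2 n} (hφ : φ ∈ formDomain W) (hC : energy W a V φ ≤ C) :
    kinetic φ ≤ ENNReal.ofReal (C + a * (M * ‖φ‖ ^ 2)) := by
  have h1 := hW.freeEnergy_le_ofReal ha hM hφ
  have h2 : kinetic φ ≤ freeEnergy W φ := le_self_add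
  refine h2.trans ?_
  rw [← ENNReal.ofReal_toReal (hW.mem_formDomain_iff.mp hφ)]
  exact ENNReal.ofReal_le_ofReal (by linarith)

theorem exists_cutoff (hW : IsConfining W) {ρ : ℝ} (hρ : 0 < ρ) :
    ∃ (η : Rn n → ℝ) (φ : L2 n), φ ∈ formDomain W ∧ (∀ᵐ x, φ x = η x) ∧ (∀ x, 0 ≤ η x) ∧
      ∀ x ∈ Metric.closedBall (0 : Rn n) ρ, η x = 1 := by
  set f : ContDiffBump (0 : Rn n) := ⟨ρ, ρ + 1, hρ, by linarith⟩ with hf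
  have hs : HasCompactSupport (Complex.ofRealCLM ∘ f) := f.hasCompactSupport.comp_left rfl
  have hd : ContDiff ℝ ((⊤ : ℕ∞) : WithTop ℕ∞) (Complex.ofRealCLM ∘ f) :=
    Complex.ofRealCLM.contDiff.comp f.contDiff
  refine ⟨f, (hs.toSchwartzMap hd).toLp 2 volume, hW.toLp_mem_formDomain hs, ?_,
    fun x ↦ f.nonneg, fun x hx ↦ f.one_of_mem_closedBall hx⟩
  filter_upwards [(hs.toSchwartzMap hd).coeFn_toLp 2 volume] with x hx
  rw [hx]
  simp

theorem tendsto_min_natCast_mul {s t : ℝ} (ht : 0 < t) :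
    Tendsto (fun m : ℕ ↦ min s (m * t)) atTop (𝓝 s) := by
  refine tendsto_const_nhds.congr' ?_
  filter_upwards [(tendsto_natCast_atTop_atTop.atTop_mul_const ht).eventually_ge_atTop s] with m hm
  rw [min_eq_left hm]

/-- Truncating a function at the multiples of a nonnegative ground state `u` shows that its
restriction to the set `{u > 0}` has finite kinetic energy. -/
theorem IsGround.kinetic_indicator_ne_top (hW : IsConfining W) (ha : 0 < a)
    (hμ : ∀ φ ∈ formDomain W, μ * ‖φ‖ ^ 2 ≤ energy W a V φ) {u : L2 n} (hu : IsGround W a V μ u)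
    (hre : ∀ᵐ x, u x = ((u x).re : ℂ)) (h0 : ∀ᵐ x, 0 ≤ (u x).re) {η : Rn n → ℝ} {φ g : L2 n}
    (hφ : φ ∈ formDomain W) (hη : ∀ᵐ x, φ x = η x) (hη0 : ∀ x, 0 ≤ η x)
    (hg : g =ᵐ[volume] {x | 0 < (u x).re}.indicator φ) : kinetic g ≠ ∞ := by
  obtain ⟨M, hM0, hM⟩ := V.exists_bound
  -- Here `f m` is min(η, mu) and `f' m` is max(η, mu). As mu is a ground state, replacing it by the
  -- max gains nothing beyond the change of norm, so the energy of the min is bounded uniformly in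
  -- m.
  choose f f' hf using fun m : ℕ ↦ isPairContraction_min_max.exists_image φ ((m : ℂ) • u)
  have hfx : ∀ᵐ x, ∀ m, f m x = ((min (η x) (m * (u x).re) : ℝ) : ℂ) := by
    rw [ae_all_iff]
    intro m
    filter_upwards [(hf m).fst, Lp.coeFn_smul (m : ℂ) u, hre, hη] with x h1 h2 h3 h4
    rw [h1, h2, h4, Pi.smul_apply, h3]
    simp
  have hn : ∀ m, ‖f m‖ ≤ ‖φ‖ := by
    intro m
    refine Lp.norm_le_norm_of_ae_le ?_
    filter_upwards [hfx, h0, hη] with x h1 h2 h3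
    rw [h1, h3, Complex.norm_real, Complex.norm_real, Real.norm_of_nonneg (hη0 x),
      Real.norm_of_nonneg (le_min (hη0 x) (by positivity))]
    exact min_le_left _ _
  have hmem : ∀ m, f m ∈ formDomain W ∧ f' m ∈ formDomain W := fun m ↦
    (hf m).mem_formDomain isPairContraction_min_max hW hφ (hu.smul hW _).1
  have hE : ∀ m, energy W a V (f m) ≤ energy W a V φ + 2 * |μ| * ‖φ‖ ^ 2 := by
    intro m
    have h1 := (hf m).energy_add_le isPairContraction_min_max hW hφ (hu.smul hW (m : ℂ)).1 a V
    have h2 := (hf m).norm_sq isPairContraction_min_max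
    have h3 := hμ _ (hmem m).2
    have h4 := (hu.smul hW (m : ℂ)).2
    have h5 : energy W a V (f m) ≤ energy W a V φ + μ * (‖f m‖ ^ 2 - ‖φ‖ ^ 2) := by
      linear_combination h1 + h3 + h4 - μ * h2
    have h6 : |‖f m‖ ^ 2 - ‖φ‖ ^ 2| ≤ 2 * ‖φ‖ ^ 2 := by
      have h7 := pow_le_pow_left₀ (norm_nonneg _) (hn m) 2
      rw [abs_le]
      constructor <;> nlinarith [sq_nonneg ‖f m‖]
    have h8 : μ * (‖f m‖ ^ 2 - ‖φ‖ ^ 2) ≤ |μ| * (2 * ‖φ‖ ^ 2) := by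
      refine (le_abs_self _).trans ?_
      rw [abs_mul]
      gcongr
    linarith
  have hlim : Tendsto f atTop (𝓝 g) := by
    have h1 : Tendsto (fun m ↦ ‖f m - g‖ ^ 2) atTop (𝓝 0) := by
      simp only [norm_sq_eq_integral]
      rw [← integral_zero (Rn n) ℝ]
      refine tendsto_integral_of_dominated_convergence (fun x ↦ ‖φ x‖ ^ 2)
        (fun m ↦ (Lp.aestronglyMeasurable _).norm.pow 2) (integrable_norm_sq φ) (fun m ↦ ?_) ?_
      · filter_upwards [Lp.coeFn_sub (f m) g, hfx, hη, hg, h0] with x h1 h2 h3 h4 h5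
        have hmin : 0 ≤ min (η x) (m * (u x).re) := le_min (hη0 x) (by positivity)
        rw [h1, Pi.sub_apply, h2, h4, norm_pow, norm_norm]
        refine pow_le_pow_left₀ (norm_nonneg _) ?_ 2
        by_cases hx : x ∈ {x | 0 < (u x).re}
        · rw [indicator_of_mem hx, h3, ← Complex.ofReal_sub, Complex.norm_real, Complex.norm_real,
            Real.norm_eq_abs, Real.norm_of_nonneg (hη0 x), abs_le]
          have := min_le_left (η x) (m * (u x).re)
          constructor <;> linarith
        · rw [indicator_of_notMem hx, h3, sub_zero, Complex.norm_real, Complex.norm_real,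
            Real.norm_of_nonneg (hη0 x), Real.norm_of_nonneg hmin]
          exact min_le_left _ _
      · filter_upwards [ae_all_iff.mpr fun m ↦ Lp.coeFn_sub (f m) g, hfx, hη, hg, h0]
          with x h1 h2 h3 h4 h5
        simp only [h1, Pi.sub_apply, h2, h4]
        by_cases hx : x ∈ {x | 0 < (u x).re}
        · rw [indicator_of_mem hx, h3]
          have h6 := ((((Complex.continuous_ofReal.tendsto _).comp
            (tendsto_min_natCast_mul (s := η x) hx)).sub_const (η x : ℂ)).norm).pow 2
          simpa using h6
        · have h6 : (u x).re = 0 := le_antisymm (not_lt.mp hx) h5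
          rw [indicator_of_notMem hx, h6]
          simp [hη0 x]
    rw [tendsto_iff_norm_sub_tendsto_zero]
    have h2 := (Real.continuous_sqrt.tendsto _).comp h1
    simpa [Function.comp_def, Real.sqrt_sq] using h2
  refine ne_top_of_le_ne_top ENNReal.ofReal_ne_top (kinetic_le_of_tendsto hlim (C := ENNReal.ofReal
    (energy W a V φ + 2 * |μ| * ‖φ‖ ^ 2 + a * (M * ‖φ‖ ^ 2))) fun m ↦ ?_)
  refine (hW.kinetic_le_of_energy_le ha hM (hmem m).1 (hE m)).trans ?_
  refine ENNReal.ofReal_le_ofReal ?_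
  have := hn m
  gcongr

/-- On each ball the cutoff is 1, so the truncation lemma makes the indicator of {u > 0} locally of
finite kinetic energy. This is a strong maximum principle without regularity theory. -/
theorem IsGround.pos_or_zero (hW : IsConfining W) (ha : 0 < a)
    (hμ : ∀ φ ∈ formDomain W, μ * ‖φ‖ ^ 2 ≤ energy W a V φ) {u : L2 n} (hu : IsGround W a V μ u)
    (hre : ∀ᵐ x, u x = ((u x).re : ℂ)) (h0 : ∀ᵐ x, 0 ≤ (u x).re) :
    (∀ᵐ x, 0 < (u x).re) ∨ ∀ᵐ x, (u x).re = 0 := by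
  have hA : MeasurableSet {x | 0 < (u x).re} :=
    measurableSet_lt measurable_const (Complex.measurable_re.comp (measurable_coeFn u))
  have h := eventuallyConst_of_kinetic_ne_top hA fun ρ hρ ↦ by
    obtain ⟨η, φ, hφ, hη, hη0, hη1⟩ := exists_cutoff hW hρ
    have hmem : MemLp ({x | 0 < (u x).re}.indicator φ) 2 volume := (Lp.memLp φ).indicator hA
    refine ⟨hmem.toLp, hu.kinetic_indicator_ne_top hW ha hμ hre h0 hφ hη hη0 hmem.coeFn_toLp,
      {x | 0 < (u x).re}.indicator fun x ↦ (η x : ℂ), ?_, fun x hx ↦ ?_⟩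
    · filter_upwards [hmem.coeFn_toLp, hη] with x h1 h2
      rw [h1]
      simp only [indicator, h2]
    · simp only [indicator, hη1 x hx, Complex.ofReal_one, Pi.one_apply]
  rw [eventuallyConst_set] at h
  refine h.imp id fun h ↦ ?_
  filter_upwards [h, h0] with x h1 h2
  exact le_antisymm (not_lt.mp h1) h2

/-- The positive and negative parts of Re u are again ground states, so each of them is positive
a.e. or zero a.e. -/
theorem IsGround.sign (hW : IsConfining W) (ha : 0 < a)
    (hμ : ∀ φ ∈ formDomain W, μ * ‖φ‖ ^ 2 ≤ energy W a V φ) {u : L2 n} (hu : IsGround W a V μ u) :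
    (∀ᵐ x, 0 < (u x).re) ∨ (∀ᵐ x, (u x).re < 0) ∨ ∀ᵐ x, (u x).re = 0 := by
  obtain ⟨v, v', hv⟩ := isPairContraction_re_im.exists_image u 0
  have hvg := (hv.isGround isPairContraction_re_im hW hμ hu (isGround_zero hW)).1
  have hvx : ∀ᵐ x, v x = ((u x).re : ℂ) := by
    filter_upwards [hv.fst, Lp.coeFn_zero ℂ 2 (volume : Measure (Rn n))] with x h1 h2
    rw [h1, h2]
    simp
  obtain ⟨p, q, hpq⟩ := isPairContraction_min_max.exists_image v 0
  obtain ⟨hp, hq⟩ := hpq.isGround isPairContraction_min_max hW hμ hvg (isGround_zero hW)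
  have hpx : ∀ᵐ x, p x = ((min (u x).re 0 : ℝ) : ℂ) := by
    filter_upwards [hpq.fst, hvx, Lp.coeFn_zero ℂ 2 (volume : Measure (Rn n))] with x h1 h2 h3
    rw [h1, h2, h3]
    simp
  have hqx : ∀ᵐ x, q x = ((max (u x).re 0 : ℝ) : ℂ) := by
    filter_upwards [hpq.snd, hvx, Lp.coeFn_zero ℂ 2 (volume : Measure (Rn n))] with x h1 h2 h3
    rw [h1, h2, h3]
    simp
  have hq' := hq.pos_or_zero hW ha hμ (by filter_upwards [hqx] with x hx; simp [hx])
    (by filter_upwards [hqx] with x hx; simp [hx])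
  rcases hq' with hq' | hq'
  · left
    filter_upwards [hqx, hq'] with x h1 h2
    rw [h1, Complex.ofReal_re] at h2
    simpa using h2
  right
  have hpx' : ∀ᵐ x, ((-1 : ℂ) • p) x = ((-min (u x).re 0 : ℝ) : ℂ) := by
    filter_upwards [hpx, Lp.coeFn_smul (-1 : ℂ) p] with x h1 h2
    rw [h2, Pi.smul_apply, h1]
    simp
  have hp' := (hp.smul hW (-1)).pos_or_zero hW ha hμ
    (by filter_upwards [hpx'] with x hx; rw [hx, Complex.ofReal_re])
    (by filter_upwards [hpx'] with x hx; rw [hx, Complex.ofReal_re]; simp)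
  refine hp'.imp (fun hp' ↦ ?_) fun hp' ↦ ?_
  · filter_upwards [hpx', hp'] with x h1 h2
    rw [h1, Complex.ofReal_re] at h2
    simpa using h2
  · filter_upwards [hpx', hp', hqx, hq'] with x h1 h2 h3 h4
    rw [h1, Complex.ofReal_re] at h2
    rw [h3, Complex.ofReal_re] at h4
    have h5 : (u x).re ≤ 0 := h4 ▸ le_max_left _ _
    rwa [min_eq_left h5, neg_eq_zero] at h2

theorem L2.eq_zero_of_re_im {ψ : L2 n} (h1 : ∀ᵐ x, (ψ x).re = 0) (h2 : ∀ᵐ x, (ψ x).im = 0) :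
    ψ = 0 := by
  rw [Lp.eq_zero_iff_ae_eq_zero]
  filter_upwards [h1, h2] with x h1 h2
  exact Complex.ext h1 h2

/-- Two functions of strict sign are not orthogonal. -/
theorem ae_eq_zero_of_integral_mul_eq_zero {f g : Rn n → ℝ} (hfg : Integrable fun x ↦ f x * g x)
    (h : ∫ x, f x * g x = 0) (hf : (∀ᵐ x, 0 < f x) ∨ ∀ᵐ x, f x < 0)
    (hg : (∀ᵐ x, 0 < g x) ∨ (∀ᵐ x, g x < 0) ∨ ∀ᵐ x, g x = 0) : ∀ᵐ x, g x = 0 := by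
  have key : ∀ᵐ x, f x * g x = 0 := by
    have hpos : (0 ≤ᵐ[volume] fun x ↦ f x * g x) ∨ 0 ≤ᵐ[volume] fun x ↦ -(f x * g x) := by
      rcases hf with hf | hf <;> rcases hg with hg | hg | hg
      · left; filter_upwards [hf, hg] with x h1 h2; exact (mul_pos h1 h2).le
      · right; filter_upwards [hf, hg] with x h1 h2
        exact neg_nonneg.mpr (mul_neg_of_pos_of_neg h1 h2).le
      · left; filter_upwards [hg] with x h2; simp [h2]
      · right; filter_upwards [hf, hg] with x h1 h2
        exact neg_nonneg.mpr (mul_neg_of_neg_of_pos h1 h2).le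
      · left; filter_upwards [hf, hg] with x h1 h2; exact (mul_pos_of_neg_of_neg h1 h2).le
      · left; filter_upwards [hg] with x h2; simp [h2]
    rcases hpos with hpos | hpos
    · exact (integral_eq_zero_iff_of_nonneg_ae hpos hfg).mp h
    · have h1 := (integral_eq_zero_iff_of_nonneg_ae hpos hfg.neg).mp
        (by rw [integral_neg, h, neg_zero])
      filter_upwards [h1] with x hx
      simpa using hx
  have hne : ∀ᵐ x, f x ≠ 0 := by
    rcases hf with hf | hf <;> filter_upwards [hf] with x hx
    exacts [hx.ne', hx.ne]
  filter_upwards [key, hne] with x h1 h2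
  exact (mul_eq_zero.mp h1).resolve_left h2

theorem IsGround.exists_strict_sign (hW : IsConfining W) (ha : 0 < a)
    (hμ : ∀ φ ∈ formDomain W, μ * ‖φ‖ ^ 2 ≤ energy W a V φ) {φ : L2 n} (hφ : IsGround W a V μ φ)
    (hne : φ ≠ 0) :
    ∃ r : L2 n, (∀ᵐ x, r x = ((r x).re : ℂ)) ∧ ((∀ᵐ x, 0 < (r x).re) ∨ ∀ᵐ x, (r x).re < 0) := by
  obtain ⟨v, v', hv⟩ := isPairContraction_re_im.exists_image φ 0
  obtain ⟨hvg, hvg'⟩ := hv.isGround isPairContraction_re_im hW hμ hφ (isGround_zero hW)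
  have hvx : ∀ᵐ x, v x = ((φ x).re : ℂ) := by
    filter_upwards [hv.fst, Lp.coeFn_zero ℂ 2 (volume : Measure (Rn n))] with x h1 h2
    rw [h1, h2]
    simp
  have hvx' : ∀ᵐ x, v' x = ((φ x).im : ℂ) := by
    filter_upwards [hv.snd, Lp.coeFn_zero ℂ 2 (volume : Measure (Rn n))] with x h1 h2
    rw [h1, h2]
    simp
  by_contra hcon
  refine hne (L2.eq_zero_of_re_im ?_ ?_)
  · have h1 := fun h ↦ hcon ⟨v, by filter_upwards [hvx] with x hx; simp [hx], h⟩
    have h2 : ∀ᵐ x, (v x).re = 0 := by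
      have := hvg.sign hW ha hμ
      tauto
    filter_upwards [hvx, h2] with x h3 h4
    rwa [h3, Complex.ofReal_re] at h4
  · have h1 := fun h ↦ hcon ⟨v', by filter_upwards [hvx'] with x hx; simp [hx], h⟩
    have h2 : ∀ᵐ x, (v' x).re = 0 := by
      have := hvg'.sign hW ha hμ
      tauto
    filter_upwards [hvx', h2] with x h3 h4
    rwa [h3, Complex.ofReal_re] at h4

/-- As r is real, orthogonality separates into real and imaginary parts of ψ. Each has a strict sign
or vanishes, Im ψ being the real part of the ground state -iψ; a strict sign contradicts
orthogonality to r. -/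
theorem IsGround.eq_zero_of_inner_eq_zero (hW : IsConfining W) (ha : 0 < a)
    (hμ : ∀ φ ∈ formDomain W, μ * ‖φ‖ ^ 2 ≤ energy W a V φ) {r ψ : L2 n}
    (hr : ∀ᵐ x, r x = ((r x).re : ℂ)) (hr' : (∀ᵐ x, 0 < (r x).re) ∨ ∀ᵐ x, (r x).re < 0)
    (hψ : IsGround W a V μ ψ) (h : inner ℂ r ψ = 0) : ψ = 0 := by
  have hint : Integrable fun x ↦ inner ℂ (r x) (ψ x) := L2.integrable_inner r ψ
  have hx : ∀ᵐ x, inner ℂ (r x) (ψ x) = ((r x).re : ℂ) * ψ x := by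
    filter_upwards [hr] with x hx
    rw [hx, RCLike.inner_apply, Complex.conj_ofReal, Complex.ofReal_re, mul_comm]
  have hint' : Integrable fun x ↦ ((r x).re : ℂ) * ψ x := hint.congr hx
  have h0 : ∫ x, ((r x).re : ℂ) * ψ x = 0 := by
    rw [← h, L2.inner_def]
    exact (integral_congr_ae hx).symm
  have hre : ∫ x, (r x).re * (ψ x).re = 0 := by
    have := integral_re hint'
    simp only [RCLike.re_to_complex, Complex.re_ofReal_mul] at this
    rw [this, h0, Complex.zero_re]
  have him : ∫ x, (r x).re * (ψ x).im = 0 := by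
    have := integral_im hint'
    simp only [RCLike.im_to_complex, Complex.im_ofReal_mul] at this
    rw [this, h0, Complex.zero_im]
  refine L2.eq_zero_of_re_im (ae_eq_zero_of_integral_mul_eq_zero ?_ hre hr' (hψ.sign hW ha hμ))
    (ae_eq_zero_of_integral_mul_eq_zero ?_ him hr' ?_)
  · simpa only [RCLike.re_to_complex, Complex.re_ofReal_mul] using hint'.re
  · simpa only [RCLike.im_to_complex, Complex.im_ofReal_mul] using hint'.im
  · have h1 : ∀ᵐ x, (((-Complex.I) • ψ) x).re = (ψ x).im := by
      filter_upwards [Lp.coeFn_smul (-Complex.I) ψ] with x hx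
      rw [hx, Pi.smul_apply]
      simp
    refine ((hψ.smul hW (-Complex.I)).sign hW ha hμ).imp (fun h2 ↦ ?_) fun h2 ↦
      h2.imp (fun h2 ↦ ?_) fun h2 ↦ ?_ <;>
    · filter_upwards [h1, h2] with x h3 h4
      rwa [h3] at h4

/-- The lowest eigenvalue is simple. -/
theorem eigenvalue_zero_lt_one (hW : IsConfining W) (hn : 1 ≤ n) (ha : 0 < a) (V : TestFn n) :
    eigenvalue W a V 0 < eigenvalue W a V 1 := by
  set F := hW.compactForm hn ha V with hF
  refine lt_of_le_of_ne (monotone_eigenvalue hW hn ha V zero_le_one) fun heq ↦ ?_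
  rw [eigenvalue_eq_val hW hn ha, eigenvalue_eq_val hW hn ha, ← hF] at heq
  have hμ : ∀ φ ∈ formDomain W, F.val 0 * ‖φ‖ ^ 2 ≤ energy W a V φ := by
    intro φ hφ
    rw [← compactForm_q hW hn ha]
    exact CompactForm.val_mul_le hφ (by simp)
  have hground : ∀ c d : ℂ, IsGround W a V (F.val 0) (c • F.vec 0 + d • F.vec 1) := by
    intro c d
    have hmem : c • F.vec 0 + d • F.vec 1 ∈
        Submodule.span ℂ (F.vec '' {i | F.val i = F.val 0}) :=
      add_mem (Submodule.smul_mem _ _ (Submodule.subset_span ⟨0, rfl, rfl⟩))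
        (Submodule.smul_mem _ _ (Submodule.subset_span ⟨1, heq.symm, rfl⟩))
    have h := CompactForm.maps_iff_mem_span.mpr hmem
    exact ⟨h.1, by rw [← compactForm_q hW hn ha, h.q_eq]⟩
  have hne : F.vec 0 ≠ 0 := (CompactForm.orthonormal_vec (F := F)).ne_zero 0
  obtain ⟨r, hr, hr'⟩ := (show IsGround W a V (F.val 0) (F.vec 0) by
    simpa using hground 1 0).exists_strict_sign hW ha hμ hne
  -- The coefficients make the combination orthogonal to r, so it vanishes. By independence `vec 0`
  -- is then itself orthogonal to r, hence zero.
  have h1 := (hground (inner ℂ r (F.vec 1)) (-inner ℂ r (F.vec 0))).eq_zero_of_inner_eq_zero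
    hW ha hμ hr hr' (by
      rw [inner_add_right, inner_smul_right, inner_smul_right]
      ring)
  have h2 := congrArg (inner ℂ (F.vec 1)) h1
  rw [inner_add_right, inner_smul_right, inner_smul_right, (CompactForm.orthonormal_vec (F := F)).2 one_ne_zero,
    inner_self_eq_norm_sq_to_K, (CompactForm.orthonormal_vec (F := F)).1 1, inner_zero_right] at h2
  replace h2 : inner ℂ r (F.vec 0) = 0 := by simpa using h2
  exact hne ((show IsGround W a V (F.val 0) (F.vec 0) by
    simpa using hground 1 0).eq_zero_of_inner_eq_zero hW ha hμ hr hr' h2)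

end Positivity

/-! ### Convex hulls of compact sets and separation -/

section ConvexHull

theorem sum_eq_sum_comp_embedding {ι κ N : Type*} [Fintype ι] [Fintype κ] [AddCommMonoid N]
    (e : ι ↪ κ) (g : κ → N) (hg : ∀ i, (¬ ∃ j, e j = i) → g i = 0) :
    ∑ i, g i = ∑ j, g (e j) := by
  rw [← Finset.sum_map Finset.univ e g]
  refine (Finset.sum_subset (Finset.subset_univ _) fun i _ hi ↦ hg i ?_).symm
  simpa using hi

/-- In finite dimensions the convex hull of a compact set is compact. -/
theorem isCompact_convexHull {M : Type*} [NormedAddCommGroup M] [NormedSpace ℝ M]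
    [FiniteDimensional ℝ M] {K : Set M} (hK : IsCompact K) : IsCompact (convexHull ℝ K) := by
  rcases K.eq_empty_or_nonempty with rfl | ⟨y, hy⟩
  · simp
  set d := Module.finrank ℝ M + 1 with hd
  -- Carathéodory: dim + 1 points suffice. Shorter combinations are padded with the point y at
  -- weight zero.
  have himage : convexHull ℝ K = (fun p : (Fin d → ℝ) × (Fin d → M) ↦ ∑ i, p.1 i • p.2 i) ''
      (stdSimplex ℝ (Fin d) ×ˢ Set.pi univ fun _ ↦ K) := by
    ext x
    constructor
    · intro hx
      obtain ⟨ι, hι, z, w, hz, hzi, hw, hw1, hx⟩ := eq_pos_convex_span_of_mem_convexHull hx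
      have hcard : Fintype.card ι ≤ Fintype.card (Fin d) := by
        rw [Fintype.card_fin]
        exact hzi.card_le_finrank_succ.trans (Nat.succ_le_succ (Submodule.finrank_le _))
      obtain ⟨e⟩ := Function.Embedding.nonempty_of_card_le hcard
      refine ⟨(Function.extend e w 0, Function.extend e z fun _ ↦ y), ⟨⟨fun i ↦ ?_, ?_⟩, ?_⟩, ?_⟩
      · by_cases hi : ∃ j, e j = i
        · obtain ⟨j, rfl⟩ := hi
          simpa only [e.injective.extend_apply] using (hw j).le
        · simp [Function.extend_apply' _ _ _ hi]
      · rw [sum_eq_sum_comp_embedding e _ fun i hi ↦ Function.extend_apply' w (0 : Fin d → ℝ) i hi]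
        simpa only [e.injective.extend_apply] using hw1
      · intro i _
        by_cases hi : ∃ j, e j = i
        · obtain ⟨j, rfl⟩ := hi
          simpa only [e.injective.extend_apply] using hz ⟨j, rfl⟩
        · simpa only [Function.extend_apply' _ _ _ hi] using hy
      · simp only
        rw [sum_eq_sum_comp_embedding e]
        · simpa only [e.injective.extend_apply] using hx
        · intro i hi
          rw [Function.extend_apply' w (0 : Fin d → ℝ) i hi, Pi.zero_apply, zero_smul]
    · rintro ⟨⟨w, z⟩, ⟨⟨hw0, hw1⟩, hz⟩, rfl⟩
      exact (convex_convexHull ℝ K).sum_mem (fun i _ ↦ hw0 i) hw1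
        fun i _ ↦ subset_convexHull ℝ K (hz i (mem_univ i))
  rw [himage]
  refine ((isCompact_stdSimplex ℝ (Fin d)).prod (isCompact_univ_pi fun _ ↦ hK)).image ?_
  fun_prop

open Classical in
/-- If a functional dominates at each point some element of a compact set spanning a
finite-dimensional space, then it lies in the convex hull of this set. -/
theorem mem_convexHull_of_forall_exists_le {D E : Type*} [AddCommGroup D] [Module ℝ D]
    [AddCommGroup E] [Module ℝ E] (ev : D →ₗ[ℝ] E →ₗ[ℝ] ℝ) (hev : Function.Injective ev)
    {S : Set D} (hfin : FiniteDimensional ℝ (Submodule.span ℝ S))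
    (hc : ∀ s : Finset E, IsCompact ((fun ξ (Z : s) ↦ ev ξ Z) '' S)) {ζ : D}
    (h : ∀ Z, ∃ ξ ∈ S, ev ξ Z ≤ ev ζ Z) : ζ ∈ convexHull ℝ S := by
  set M : Submodule ℝ D := Submodule.span ℝ S ⊔ Submodule.span ℝ {ζ} with hM
  have hMfin : FiniteDimensional ℝ M := Submodule.finiteDimensional_sup _ _
  -- By finite dimension of M, finitely many evaluations already have the joint kernel of all of
  -- them, so they separate the points of M. The problem moves to the space of functions on s.
  obtain ⟨s, hs⟩ := Finset.exists_inf_le fun Z : E ↦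
    LinearMap.ker ((ev.flip Z).comp M.subtype)
  set P : D →ₗ[ℝ] (s → ℝ) := LinearMap.pi fun Z ↦ ev.flip (Z : E) with hP
  have hPx : ∀ ξ, P ξ = fun Z : s ↦ ev ξ Z := fun ξ ↦ rfl
  have hinj : ∀ ξ ∈ M, P ξ = 0 → ξ = 0 := by
    intro ξ hξ h0
    have h1 : (⟨ξ, hξ⟩ : M) ∈ s.inf fun Z : E ↦ LinearMap.ker ((ev.flip Z).comp M.subtype) := by
      rw [Submodule.mem_finsetInf]
      exact fun Z hZ ↦ congrFun h0 ⟨Z, hZ⟩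
    refine hev ?_
    rw [map_zero]
    exact LinearMap.ext fun Z ↦ hs Z h1
  have hmem : P ζ ∈ convexHull ℝ (P '' S) := by
    by_contra hnot
    have hcpt : IsCompact (convexHull ℝ (P '' S)) := isCompact_convexHull (hc s)
    obtain ⟨f, u, h1, h2⟩ := geometric_hahn_banach_point_closed (convex_convexHull ℝ _)
      hcpt.isClosed hnot
    -- The separating functional is itself evaluation at one element Z of E, to which the hypothesis
    -- applies.
    set Z : E := ∑ i : s, f (Pi.single i 1) • (i : E) with hZ
    have hfZ : ∀ ξ, f (P ξ) = ev ξ Z := by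
      intro ξ
      have h3 : P ξ = ∑ i : s, ev ξ i • Pi.single i (1 : ℝ) := by
        ext j
        simp [hPx, Finset.sum_apply, Pi.single_apply]
      rw [h3, hZ, map_sum, map_sum]
      refine Finset.sum_congr rfl fun i _ ↦ ?_
      rw [map_smul, map_smul, smul_eq_mul, smul_eq_mul, mul_comm]
    obtain ⟨ξ, hξ, hle⟩ := h Z
    have h3 := h2 _ (subset_convexHull ℝ _ ⟨ξ, hξ, rfl⟩)
    rw [hfZ] at h1 h3
    linarith
  rw [← P.image_convexHull] at hmem
  obtain ⟨ξ, hξ, hξζ⟩ := hmem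
  have hsub : convexHull ℝ S ⊆ M := convexHull_min
    (fun x hx ↦ Submodule.mem_sup_left (Submodule.subset_span hx)) M.convex
  have h0 := hinj (ξ - ζ) (sub_mem (hsub hξ) (Submodule.mem_sup_right
    (Submodule.mem_span_singleton_self ζ))) (by rw [map_sub, hξζ, sub_self])
  rwa [← sub_eq_zero.mp h0]

end ConvexHull

/-! ### The sup-gradient of G -/

section SupGradient

variable {n : ℕ} {W : Rn n → ℝ} {k : ℕ}

theorem integrable_density (β : Fin k → ℝ) (φ : Fin k → L2 n) : Integrable (density β φ) :=
  integrable_finsetSum _ fun j _ ↦ (integrable_norm_sq (φ j)).const_mul (β j)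

theorem integral_density (β : Fin k → ℝ) {φ : Fin k → L2 n} (hφ : Orthonormal ℂ φ) :
    ∫ x, density β φ x = ∑ j, β j := by
  simp only [density]
  rw [integral_finsetSum _ fun j _ ↦ (integrable_norm_sq (φ j)).const_mul (β j)]
  refine Finset.sum_congr rfl fun j _ ↦ ?_
  rw [integral_const_mul, ← norm_sq_eq_integral, hφ.1 j, one_pow, mul_one]

variable (a : ℝ) (β : Fin k → ℝ)

/-- The distribution `-a ∑ⱼ βⱼ|φⱼ|²`. -/
abbrev densityDistr (φ : Fin k → L2 n) : Distr n := distr fun x ↦ -a * density β φ x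

theorem densityDistr_apply (φ : Fin k → L2 n) (Z : TestFn n) :
    densityDistr a β φ Z = -a * ∑ j, β j * ∫ x, Z x * ‖φ j x‖ ^ 2 := by
  rw [distr_apply ((integrable_density β φ).const_mul (-a))]
  simp only [← integral_const_mul]
  rw [← integral_finsetSum _ fun j _ ↦ (integrable_testFn_mul_norm_sq Z (φ j)).const_mul (β j),
    ← integral_const_mul]
  refine integral_congr_ae (ae_of_all _ fun x ↦ ?_)
  simp only [density, Finset.mul_sum]
  exact Finset.sum_congr rfl fun j _ ↦ by ring

/-- V enters the energy linearly. So G is an infimum of affine functions of V, which is behind both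
concavity and the supergradients. -/
theorem frameEnergy_eq_add (hW : IsConfining W) {φ : Fin k → L2 n} (hφ : φ ∈ frames W k)
    (V Z : TestFn n) :
    frameEnergy W a β Z φ = frameEnergy W a β V φ + densityDistr a β φ (Z - V) := by
  rw [densityDistr_apply, frameEnergy, frameEnergy, Finset.mul_sum, ← Finset.sum_add_distrib]
  refine Finset.sum_congr rfl fun j _ ↦ ?_
  have h : ∫ x, (Z - V) x * ‖φ j x‖ ^ 2 =
      (∫ x, Z x * ‖φ j x‖ ^ 2) - ∫ x, V x * ‖φ j x‖ ^ 2 := by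
    rw [← integral_sub (integrable_testFn_mul_norm_sq Z _) (integrable_testFn_mul_norm_sq V _)]
    exact integral_congr_ae (ae_of_all _ fun x ↦ sub_mul _ _ _)
  rw [h, hW.energy_eq a V (hφ.1 j), hW.energy_eq a Z (hφ.1 j)]
  ring

theorem convex_supGradient (F : TestFn n → ℝ) (V : TestFn n) : Convex ℝ (supGradient F V) := by
  intro ζ hζ ξ hξ s t hs ht hst Z
  have h1 := mul_le_mul_of_nonneg_left (hζ Z) hs
  have h2 := mul_le_mul_of_nonneg_left (hξ Z) ht
  have h3 : (s • ζ + t • ξ) (Z - V) = s * ζ (Z - V) + t * ξ (Z - V) := rfl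
  rw [h3]
  linear_combination h1 + h2 + (F V - F Z) * hst

variable {a β}

theorem densityDistr_mem_supGradient (hW : IsConfining W) (hn : 1 ≤ n) (ha : 0 < a)
    (hβ : StrictAnti β) (hβ_pos : ∀ j, 0 < β j) {V : TestFn n} {φ : Fin k → L2 n}
    (hφ : IsEigenframe W a V φ) : densityDistr a β φ ∈ supGradient (G W a β) V := by
  intro Z
  rw [G_eq hW hn ha V hβ hβ_pos, G_eq hW hn ha Z hβ hβ_pos,
    ← frameEnergy_of_isEigenframe hW hn ha V β hφ, ← frameEnergy_eq_add a β hW hφ.mem_frames]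
  exact (isLeast_frameEnergy hW hn ha Z hβ hβ_pos).2 ⟨φ, hφ.mem_frames, rfl⟩

/-- Eigenframes for potentials which converge uniformly have convergent subsequences. -/
theorem exists_isEigenframe_of_tendsto (hW : IsConfining W) (hn : 1 ≤ n) (ha : 0 < a)
    {V : TestFn n} {V' : ℕ → TestFn n} {δ : ℕ → ℝ} (hδ : Tendsto δ atTop (𝓝 0))
    (hV : ∀ m x, |V' m x - V x| ≤ δ m) {f : ℕ → Fin k → L2 n}
    (hf : ∀ m, IsEigenframe W a (V' m) (f m)) :
    ∃ g : Fin k → L2 n, IsEigenframe W a V g ∧ ∃ σ : ℕ → ℕ, StrictMono σ ∧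
      ∀ j, Tendsto (fun m ↦ f (σ m) j) atTop (𝓝 (g j)) := by
  simp only [isEigenframe_iff hW hn ha] at hf ⊢
  refine CompactForm.exists_isFrame_of_tendsto (F := hW.compactForm hn ha V)
    (F' := fun m ↦ hW.compactForm hn ha (V' m)) (fun m ↦ rfl) (δ := fun m ↦ |a| * δ m) ?_ ?_ hf
  · simpa using hδ.const_mul |a|
  · exact fun m φ hφ ψ hψ ↦ hW.norm_form_sub_le a (hV m) hφ hψ

theorem tendsto_densityDistr {f : ℕ → Fin k → L2 n} {g : Fin k → L2 n}
    (h : ∀ j, Tendsto (fun m ↦ f m j) atTop (𝓝 (g j))) (Z : TestFn n) :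
    Tendsto (fun m ↦ densityDistr a β (f m) Z) atTop (𝓝 (densityDistr a β g Z)) := by
  simp only [densityDistr_apply]
  exact (tendsto_finsetSum _ fun j _ ↦
    (tendsto_integral_testFn Z (h j)).const_mul (β j)).const_mul (-a)

/-- An eigenframe for V + tZ competes at V, so G(V) ≤ G(V + tZ) - t⟨Z, slope⟩, whereas ζ gives G(V +
tZ) ≤ G(V) + tζ(Z). Divide by t and let the frames converge as t ↓ 0. -/
theorem exists_densityDistr_le (hW : IsConfining W) (hn : 1 ≤ n) (ha : 0 < a)
    (hβ : StrictAnti β) (hβ_pos : ∀ j, 0 < β j) {V : TestFn n} {ζ : Distr n}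
    (hζ : ζ ∈ supGradient (G W a β) V) (Z : TestFn n) :
    ∃ φ : Fin k → L2 n, IsEigenframe W a V φ ∧ densityDistr a β φ Z ≤ ζ Z := by
  obtain ⟨M, hM0, hM⟩ := Z.exists_bound
  set t : ℕ → ℝ := fun m ↦ ((m : ℝ) + 1)⁻¹ with ht
  have ht0 : ∀ m, 0 < t m := fun m ↦ by positivity
  choose f hf using fun m ↦ exists_isEigenframe hW hn ha (V + t m • Z) k
  have hδ : Tendsto (fun m ↦ t m * M) atTop (𝓝 0) := by
    have h := (tendsto_natCast_atTop_atTop (R := ℝ)).atTop_add (tendsto_const_nhds (x := (1 : ℝ)))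
    simpa using h.inv_tendsto_atTop.mul_const M
  obtain ⟨g, hg, σ, hσ, hlim⟩ := exists_isEigenframe_of_tendsto hW hn ha (V := V) hδ
    (fun m x ↦ by
      have h : (V + t m • Z) x - V x = t m * Z x := by
        change V x + t m * Z x - V x = _
        ring
      rw [h, abs_mul, abs_of_pos (ht0 m)]
      exact mul_le_mul_of_nonneg_left (hM x) (ht0 m).le) hf
  refine ⟨g, hg, le_of_tendsto' (tendsto_densityDistr hlim Z) fun m ↦ ?_⟩
  set s := t (σ m) with hs
  have h1 := hζ (V + s • Z)
  have h2 := (isLeast_frameEnergy hW hn ha V hβ hβ_pos).2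
    ⟨f (σ m), (hf (σ m)).mem_frames, rfl⟩
  rw [frameEnergy_eq_add a β hW (hf (σ m)).mem_frames (V + s • Z) V,
    frameEnergy_of_isEigenframe hW hn ha _ β (hf (σ m)), ← G_eq hW hn ha V hβ hβ_pos,
    ← G_eq hW hn ha _ hβ hβ_pos, sub_add_cancel_left, map_neg, map_smul, smul_eq_mul] at h2
  rw [add_sub_cancel_left, map_smul, smul_eq_mul] at h1
  have h3 : s * densityDistr a β (f (σ m)) Z ≤ s * ζ Z := by linarith
  exact le_of_mul_le_mul_left h3 (ht0 _)

theorem integrable_re_mul_conj (φ ψ : L2 n) :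
    Integrable fun x ↦ (φ x * (starRingEnd ℂ) (ψ x)).re := by
  refine (integrable_norm_mul_norm φ ψ).mono' ?_ (ae_of_all _ fun x ↦ ?_)
  · exact Complex.continuous_re.comp_aestronglyMeasurable ((Lp.aestronglyMeasurable φ).mul
      (Complex.continuous_conj.comp_aestronglyMeasurable (Lp.aestronglyMeasurable ψ)))
  · rw [Real.norm_eq_abs]
    refine (Complex.abs_re_le_norm _).trans ?_
    rw [norm_mul, RCLike.norm_conj]

theorem Distr.ext {ζ ξ : Distr n} (h : ∀ Z : TestFn n, ζ Z = ξ Z) : ζ = ξ :=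
  ContinuousLinearMap.ext h

theorem distr_congr {f g : Rn n → ℝ} (hf : Integrable f) (h : f =ᵐ[volume] g) :
    distr f = distr g := by
  refine Distr.ext fun Z ↦ ?_
  rw [distr_apply hf, distr_apply (hf.congr h)]
  refine integral_congr_ae ?_
  filter_upwards [h] with x hx
  rw [hx]

theorem integrable_testFn_mul (Z : TestFn n) {f : Rn n → ℝ} (hf : Integrable f) :
    Integrable fun x ↦ Z x * f x := by
  obtain ⟨M, -, hM⟩ := Z.exists_bound
  exact hf.bdd_mul Z.aestronglyMeasurable (ae_of_all _ hM)

theorem distr_add {f g : Rn n → ℝ} (hf : Integrable f) (hg : Integrable g) :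
    distr (fun x ↦ f x + g x) = distr f + distr g := by
  refine Distr.ext fun Z ↦ ?_
  change _ = distr f Z + distr g Z
  rw [distr_apply hf, distr_apply hg, distr_apply (f := fun x ↦ f x + g x) (hf.add hg),
    ← integral_add (integrable_testFn_mul Z hf) (integrable_testFn_mul Z hg)]
  simp only [mul_add]

theorem distr_smul (c : ℝ) {f : Rn n → ℝ} (hf : Integrable f) :
    distr (fun x ↦ c * f x) = c • distr f := by
  refine Distr.ext fun Z ↦ ?_
  change _ = c * distr f Z
  rw [distr_apply hf, distr_apply (hf.const_mul c), ← integral_const_mul]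
  simp only [mul_left_comm]

variable (n) in
/-- The polarization of `φ ↦ |φ|²`, as a distribution. -/
def pairDistr : L2 n →ₗ[ℝ] L2 n →ₗ[ℝ] Distr n :=
  LinearMap.mk₂ ℝ (fun φ ψ ↦ distr fun x ↦ (φ x * (starRingEnd ℂ) (ψ x)).re)
    (fun φ φ' ψ ↦ by
      rw [← distr_add (integrable_re_mul_conj _ _) (integrable_re_mul_conj _ _)]
      refine distr_congr (integrable_re_mul_conj _ _) ?_
      filter_upwards [Lp.coeFn_add φ φ'] with x hx
      rw [hx, Pi.add_apply, add_mul, Complex.add_re])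
    (fun c φ ψ ↦ by
      rw [← distr_smul c (integrable_re_mul_conj _ _)]
      refine distr_congr (integrable_re_mul_conj _ _) ?_
      filter_upwards [Lp.coeFn_smul c φ] with x hx
      rw [hx, Pi.smul_apply, Complex.real_smul, mul_assoc, Complex.re_ofReal_mul])
    (fun φ ψ ψ' ↦ by
      rw [← distr_add (integrable_re_mul_conj _ _) (integrable_re_mul_conj _ _)]
      refine distr_congr (integrable_re_mul_conj _ _) ?_
      filter_upwards [Lp.coeFn_add ψ ψ'] with x hx
      rw [hx, Pi.add_apply, map_add, mul_add, Complex.add_re])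
    (fun c φ ψ ↦ by
      rw [← distr_smul c (integrable_re_mul_conj _ _)]
      refine distr_congr (integrable_re_mul_conj _ _) ?_
      filter_upwards [Lp.coeFn_smul c ψ] with x hx
      rw [hx, Pi.smul_apply, Complex.real_smul, map_mul, Complex.conj_ofReal, mul_left_comm,
        Complex.re_ofReal_mul])

theorem densityDistr_eq_sum (φ : Fin k → L2 n) :
    densityDistr a β φ = ∑ j, (-a * β j) • pairDistr n (φ j) (φ j) := by
  refine Distr.ext fun Z ↦ ?_
  have h : (∑ j, (-a * β j) • pairDistr n (φ j) (φ j)) Z =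
      ∑ j, (-a * β j) * pairDistr n (φ j) (φ j) Z := by
    exact sum_apply _ _ _
  rw [h, densityDistr_apply, Finset.mul_sum]
  refine Finset.sum_congr rfl fun j _ ↦ ?_
  have h1 : pairDistr n (φ j) (φ j) Z = ∫ x, Z x * ‖φ j x‖ ^ 2 := by
    change distr _ Z = _
    rw [distr_apply (integrable_re_mul_conj _ _)]
    simp only [Complex.mul_conj', ← Complex.ofReal_pow, Complex.ofReal_re]
  rw [h1, mul_assoc]

/-- Members of eigenframes lie in a finite sum S of finite-dimensional eigenspaces, so the slopes
lie in the span of `pairDistr` on S × S. Scalars are real because `pairDistr` is only real-bilinear.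
-/
theorem finiteDimensional_span_densityDistr (hW : IsConfining W) (hn : 1 ≤ n) (ha : 0 < a)
    (V : TestFn n) : FiniteDimensional ℝ (Submodule.span ℝ
      {ζ | ∃ φ : Fin k → L2 n, IsEigenframe W a V φ ∧ ζ = densityDistr a β φ}) := by
  set F := hW.compactForm hn ha V with hF
  set S : Submodule ℝ (L2 n) :=
    ⨆ j : Fin k, (Submodule.span ℂ (F.vec '' {i | F.val i = F.val j})).restrictScalars ℝ with hS
  have hSfg : S.FG := by
    refine Submodule.fg_iSup _ fun j ↦ ?_
    have hfin : {i | F.val i = F.val j}.Finite :=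
      (CompactForm.finite_setOf_val_le (F := F) (F.val j)).subset fun i hi ↦ le_of_eq hi
    exact (Submodule.fg_span (hfin.image F.vec)).restrictScalars
  have hfg := hSfg.map₂ (pairDistr n) hSfg
  have hle : Submodule.span ℝ
      {ζ | ∃ φ : Fin k → L2 n, IsEigenframe W a V φ ∧ ζ = densityDistr a β φ} ≤
      Submodule.map₂ (pairDistr n) S S := by
    refine Submodule.span_le.mpr ?_
    rintro _ ⟨φ, hφ, rfl⟩
    rw [isEigenframe_iff hW hn ha, ← hF] at hφ
    have hmem : ∀ j, φ j ∈ S := fun j ↦ Submodule.mem_iSup_of_mem j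
      (CompactForm.maps_iff_mem_span.mp (hφ.2 j))
    rw [densityDistr_eq_sum]
    exact sum_mem fun j _ ↦ Submodule.smul_mem _ _ (Submodule.apply_mem_map₂ _ (hmem j) (hmem j))
  have : FiniteDimensional ℝ (Submodule.map₂ (pairDistr n) S S) :=
    Module.Finite.iff_fg.mpr hfg
  exact Submodule.finiteDimensional_of_le hle

variable (n) in
/-- Evaluation of distributions. -/
def evalDistr : Distr n →ₗ[ℝ] TestFn n →ₗ[ℝ] ℝ where
  toFun ζ := (ζ : TestFn n →L[ℝ] ℝ).toLinearMap
  map_add' _ _ := rfl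
  map_smul' _ _ := rfl

theorem evalDistr_injective : Function.Injective (evalDistr n) := fun _ _ h ↦
  Distr.ext fun Z ↦ LinearMap.congr_fun h Z

theorem supGradient_eq_convexHull (hW : IsConfining W) (hn : 1 ≤ n) (ha : 0 < a)
    (hβ : StrictAnti β) (hβ_pos : ∀ j, 0 < β j) (V : TestFn n) :
    supGradient (G W a β) V = convexHull ℝ
      {ζ | ∃ φ : Fin k → L2 n, IsEigenframe W a V φ ∧ ζ = densityDistr a β φ} := by
  refine Subset.antisymm (fun ζ hζ ↦ ?_) (convexHull_min ?_ (convex_supGradient _ V))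
  · refine mem_convexHull_of_forall_exists_le (evalDistr n) evalDistr_injective
      (finiteDimensional_span_densityDistr hW hn ha V) (fun s ↦ ?_) fun Z ↦ ?_
    -- Stability of eigenframes with the constant sequence of potentials V is compactness of the set
    -- of eigenframes.
    · have hseq : IsSeqCompact {φ : Fin k → L2 n | IsEigenframe W a V φ} := by
        intro f hf
        obtain ⟨g, hg, σ, hσ, hlim⟩ := exists_isEigenframe_of_tendsto hW hn ha (V := V)
          (V' := fun _ ↦ V) (tendsto_const_nhds (x := (0 : ℝ))) (by simp) hf
        exact ⟨g, hg, σ, hσ, tendsto_pi_nhds.mpr hlim⟩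
      have hcont : Continuous fun (φ : Fin k → L2 n) (Z : s) ↦ evalDistr n (densityDistr a β φ) Z :=
        continuous_pi fun Z ↦ SeqContinuous.continuous fun f g h ↦
          tendsto_densityDistr (tendsto_pi_nhds.mp h) Z
      convert hseq.isCompact.image hcont using 1
      ext y
      constructor
      · rintro ⟨_, ⟨φ, hφ, rfl⟩, rfl⟩
        exact ⟨φ, hφ, rfl⟩
      · rintro ⟨φ, hφ, rfl⟩
        exact ⟨_, ⟨φ, hφ, rfl⟩, rfl⟩
    · obtain ⟨φ, hφ, hle⟩ := exists_densityDistr_le hW hn ha hβ hβ_pos hζ Z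
      exact ⟨_, ⟨φ, hφ, rfl⟩, hle⟩
  · rintro _ ⟨φ, hφ, rfl⟩
    exact densityDistr_mem_supGradient hW hn ha hβ hβ_pos hφ

/-- A prescribed L¹ norm is not a convex condition; a sign together with a prescribed integral is,
and it determines the norm. -/
theorem exists_integrable_of_mem_convexHull (ha : 0 < a) (hβ_pos : ∀ j, 0 < β j) {V : TestFn n}
    {ζ : Distr n} (hζ : ζ ∈ convexHull ℝ
      {ζ | ∃ φ : Fin k → L2 n, IsEigenframe W a V φ ∧ ζ = densityDistr a β φ}) :
    ∃ f : Rn n → ℝ, Integrable f ∧ ζ = distr f ∧ ∫ x, |f x| = a * ∑ j, β j := by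
  set T : Set (Distr n) := {ζ | ∃ f : Rn n → ℝ, Integrable f ∧ ζ = distr f ∧ (∀ x, f x ≤ 0) ∧
    ∫ x, f x = -(a * ∑ j, β j)} with hT
  have hconv : Convex ℝ T := by
    rintro _ ⟨f, hf, rfl, hf0, hf1⟩ _ ⟨g, hg, rfl, hg0, hg1⟩ s t hs ht hst
    refine ⟨fun x ↦ s * f x + t * g x, (hf.const_mul s).add (hg.const_mul t), ?_, fun x ↦ ?_, ?_⟩
    · rw [distr_add (hf.const_mul s) (hg.const_mul t), distr_smul s hf, distr_smul t hg]
    · have := mul_nonneg hs (neg_nonneg.mpr (hf0 x))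
      have := mul_nonneg ht (neg_nonneg.mpr (hg0 x))
      linarith
    · rw [integral_add (hf.const_mul s) (hg.const_mul t), integral_const_mul, integral_const_mul,
        hf1, hg1, ← add_mul, hst, one_mul]
  obtain ⟨f, hf, hζf, hf0, hf1⟩ := convexHull_min (t := T) (by
    rintro _ ⟨φ, hφ, rfl⟩
    refine ⟨_, (integrable_density β φ).const_mul (-a), rfl, fun x ↦ ?_, ?_⟩
    · have : 0 ≤ density β φ x :=
        Finset.sum_nonneg fun j _ ↦ mul_nonneg (hβ_pos j).le (sq_nonneg _)
      nlinarith
    · rw [integral_const_mul, integral_density β hφ.1, neg_mul]) hconv hζ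
  refine ⟨f, hf, hζf, ?_⟩
  simp only [abs_of_nonpos (hf0 _)]
  rw [integral_neg, hf1, neg_neg]

/-- Unit vectors in a one-dimensional eigenspace differ by a phase, which the density does not see.
-/
theorem densityDistr_eq_of_rank_le_one {V : TestFn n}
    (h : ∀ μ : ℝ, Module.rank ℂ (eigenspace W a V μ) ≤ 1) {φ ψ : Fin k → L2 n}
    (hφ : IsEigenframe W a V φ) (hψ : IsEigenframe W a V ψ) :
    densityDistr a β φ = densityDistr a β ψ := by
  have hj : ∀ j, ∀ᵐ x, ‖φ j x‖ = ‖ψ j x‖ := by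
    intro j
    obtain ⟨v, -, hv⟩ := (rank_submodule_le_one_iff _).mp (h (eigenvalue W a V j))
    obtain ⟨c, hc⟩ := Submodule.mem_span_singleton.mp (hv (Submodule.subset_span (hφ.2 j)))
    obtain ⟨d, hd⟩ := Submodule.mem_span_singleton.mp (hv (Submodule.subset_span (hψ.2 j)))
    have h1 : ‖c‖ * ‖v‖ = 1 := by rw [← norm_smul, hc, hφ.1.1 j]
    have h2 : ‖d‖ * ‖v‖ = 1 := by rw [← norm_smul, hd, hψ.1.1 j]
    have h3 : ‖c‖ = ‖d‖ := mul_right_cancel₀ (right_ne_zero_of_mul_eq_one h1) (h1.trans h2.symm)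
    rw [← hc, ← hd]
    filter_upwards [Lp.coeFn_smul c v, Lp.coeFn_smul d v] with x h4 h5
    rw [h4, h5, Pi.smul_apply, Pi.smul_apply, norm_smul, norm_smul, h3]
  refine distr_congr ((integrable_density β φ).const_mul (-a)) ?_
  filter_upwards [ae_all_iff.mpr hj] with x hx
  simp only [density, hx]

/-- An eigenframe at the intermediate potential competes at both endpoints, and its energy is affine
in V. -/
theorem concaveOn_sum_eigenvalue (hW : IsConfining W) (hn : 1 ≤ n) (ha : 0 < a)
    (hβ : StrictAnti β) (hβ_pos : ∀ j, 0 < β j) :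
    ConcaveOn ℝ univ fun V : TestFn n ↦ ∑ j, β j * eigenvalue W a V j := by
  refine ⟨convex_univ, fun V₁ _ V₂ _ s t hs ht hst ↦ ?_⟩
  set V := s • V₁ + t • V₂ with hV
  obtain ⟨φ, hφ⟩ := exists_isEigenframe hW hn ha V k
  have h1 := (isLeast_frameEnergy hW hn ha V₁ hβ hβ_pos).2 ⟨φ, hφ.mem_frames, rfl⟩
  have h2 := (isLeast_frameEnergy hW hn ha V₂ hβ hβ_pos).2 ⟨φ, hφ.mem_frames, rfl⟩
  rw [frameEnergy_eq_add a β hW hφ.mem_frames V, frameEnergy_of_isEigenframe hW hn ha V β hφ,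
    map_sub] at h1 h2
  have h3 : densityDistr a β φ V = s * densityDistr a β φ V₁ + t * densityDistr a β φ V₂ := by
    rw [hV, map_add, map_smul, map_smul, smul_eq_mul, smul_eq_mul]
  have h4 := mul_le_mul_of_nonneg_left h1 hs
  have h5 := mul_le_mul_of_nonneg_left h2 ht
  simp only [smul_eq_mul]
  linear_combination h4 + h5 - h3 +
    (∑ j, β j * eigenvalue W a V j - densityDistr a β φ V) * hst

end SupGradient

end

end Choquard

theorem lemma2p2 {n : ℕ} (hn : 1 ≤ n) {W : Choquard.Rn n → ℝ} (hW : Choquard.IsConfining W)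
    {a : ℝ} (ha : 0 < a) {k : ℕ} {β : Fin k → ℝ} (hβ : StrictAnti β) (hβ_pos : ∀ j, 0 < β j) :
    -- the infimum over frames is `∑ βⱼ λⱼ(V)`, and it is attained at the first eigenfunctions
    (∀ V : Choquard.TestFn n,
      Choquard.G W a β V = ∑ j, β j * Choquard.eigenvalue W a V j ∧
      IsLeast (Choquard.frameEnergy W a β V '' Choquard.frames W k)
        (∑ j, β j * Choquard.eigenvalue W a V j) ∧
      Choquard.eigenvalue W a V 0 < Choquard.eigenvalue W a V 1 ∧
      Monotone (Choquard.eigenvalue W a V) ∧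
      (∃ φ : Fin k → Choquard.L2 n, Choquard.IsEigenframe W a V φ) ∧
      ∀ φ : Fin k → Choquard.L2 n, Choquard.IsEigenframe W a V φ →
        φ ∈ Choquard.frames W k ∧
        Choquard.frameEnergy W a β V φ = ∑ j, β j * Choquard.eigenvalue W a V j) ∧
    -- concavity
    ConcaveOn ℝ Set.univ
      (fun V : Choquard.TestFn n ↦ ∑ j, β j * Choquard.eigenvalue W a V j) ∧
    -- the sup-gradient
    (∀ V : Choquard.TestFn n,
      Choquard.supGradient (Choquard.G W a β) V =
        convexHull ℝ {ζ | ∃ φ : Fin k → Choquard.L2 n, Choquard.IsEigenframe W a V φ ∧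
          ζ = Choquard.distr (fun x ↦ -a * Choquard.density β φ x)} ∧
      (∀ ζ ∈ Choquard.supGradient (Choquard.G W a β) V,
        ∃ f : Choquard.Rn n → ℝ, MeasureTheory.Integrable f ∧ ζ = Choquard.distr f ∧
          ∫ x, |f x| = a * ∑ j, β j ∧ (∑ j, β j = 1 → ∫ x, |f x| = a)) ∧
      ((∀ μ : ℝ, Module.rank ℂ (Choquard.eigenspace W a V μ) ≤ 1) →
        ∃ ζ, Choquard.supGradient (Choquard.G W a β) V = {ζ}))
  := by
  refine ⟨fun V ↦ ⟨Choquard.G_eq hW hn ha V hβ hβ_pos,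
    Choquard.isLeast_frameEnergy hW hn ha V hβ hβ_pos, Choquard.eigenvalue_zero_lt_one hW hn ha V,
    Choquard.monotone_eigenvalue hW hn ha V, Choquard.exists_isEigenframe hW hn ha V k,
    fun φ hφ ↦ ⟨hφ.mem_frames, Choquard.frameEnergy_of_isEigenframe hW hn ha V β hφ⟩⟩,
    Choquard.concaveOn_sum_eigenvalue hW hn ha hβ hβ_pos, fun V ↦ ?_⟩
  have hconv := Choquard.supGradient_eq_convexHull hW hn ha hβ hβ_pos V
  refine ⟨hconv, fun ζ hζ ↦ ?_, fun hrank ↦ ?_⟩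
  · rw [hconv] at hζ
    obtain ⟨f, hf, hζf, hnorm⟩ := Choquard.exists_integrable_of_mem_convexHull ha hβ_pos hζ
    exact ⟨f, hf, hζf, hnorm, fun hsum ↦ by rw [hnorm, hsum, mul_one]⟩
  · obtain ⟨φ, hφ⟩ := Choquard.exists_isEigenframe hW hn ha V k
    refine ⟨Choquard.densityDistr a β φ, hconv.trans ?_⟩
    rw [← convexHull_singleton (𝕜 := ℝ) (Choquard.densityDistr a β φ)]
    congr 1
    refine Set.eq_singleton_iff_unique_mem.mpr ⟨⟨φ, hφ, rfl⟩, ?_⟩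
    rintro _ ⟨ψ, hψ, rfl⟩
    exact Choquard.densityDistr_eq_of_rank_le_one hrank hψ hφ
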